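/- Let $k\in\mathbb C$ with $\mathrm{Re}\,k>0$, $\mathrm{Im}\,k>0$, let $\varsigma\in\mathbb C\setminus\{0\}$, $0<\theta<\pi/2$, $k_\parallel=k\sin\theta$, and let $\mathbb C_\pm=\{\xi\in\mathbb C:\pm\mathrm{Im}\,\xi>0\}$. Let $\mathcal K(x)=\frac i4H_0^{(1)}(k|x|)$ and consider, with $u^{\rm in}(x)=e^{ik_\parallel x}$, the integral equation $$u(x)=u^{\rm in}(x)+\frac{i\varsigma}{k}\Bigl(\frac{d^2}{dx^2}+k^2\Bigr)\int_0^\infty\mathcal K(x-x')\,u(x')\,dx',\qquad x>0. \tag{1}$$ An integrable solution of (1) is a function $u\in L^1(0,\infty)$ such that, for every $x>0$, the integral in (1) converges absolutely, is twice differentiable at $x$ as a function of $x$, and (1) holds. For real $\xi$ let $\widehat{\mathcal K}(\xi)=\int_{-\infty}^\infty\mathcal K(x)e^{-i\xi x}\,dx$ and $$\mathcal P(\xi)=1-i\frac{\varsigma}{k}(k^2-\xi^2)\widehat{\mathcal K}(\xi).$$ Assume that $\mathcal P(\xi)\neq0$ for all real $\xi$ and that $\mathrm{ind}(\mathcal P)=0$,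 i.e. the change of a continuous argument of $\mathcal P$ from $-\infty$ to $+\infty$ is zero. Let $Q=\ln\mathcal P$ be any continuous branch on $\mathbb R$, and put $$Q_\pm(\xi)=\pm\frac{\xi}{\pi i}\int_0^\infty\frac{Q(\zeta)}{\zeta^2-\xi^2}\,d\zeta,\qquad \xi\in\mathbb C_\pm .$$ Then: 1. $\mathcal K\in L^1(\mathbb R)$ and $\widehat{\mathcal K}(\xi)=\dfrac{i}{2\sqrt{k^2-\xi^2}}$, $\mathrm{Im}\sqrt{k^2-\xi^2}>0$, for all real $\xi$. 2. The integrals defining $Q_\pm$ converge absolutely, $Q_\pm$ is holomorphic in $\mathbb C_\pm$ and has a limit, again denoted $Q_\pm(\xi)$, at each real point $\xi$ (from within $\mathbb C_\pm$), and $Q=Q_++Q_-$ on $\mathbb R$. 3. $Q(\zeta)=\ln\bigl(\frac{i\varsigma}{2k}\zeta\bigr)+\mathcal O(1/\zeta)$ as $\zeta\to+\infty$ for a suitable value $c$ of $\ln\frac{i\varsigma}{2k}$, where $\ln(\frac{i\varsigma}{2k}\zeta):=c+\ln\zeta$; and, with $\ln\frac{\varsigma\xi}{2k}:=c+\mathrm{Log}(\xi/i)$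 (principal $\mathrm{Log}$) on $\mathbb C_+$, $$Q_+(\xi)=\tfrac12\ln\Bigl(\frac{\varsigma\xi}{2k}\Bigr)+o(1)\qquad\text{as }\xi\to\infty\text{ in }\mathbb C_+ .$$ 4. Equation (1) has an integrable solution that is bounded near the edge $x=0$, and this solution is unique. It is continuous on $(0,\infty)$ and is given by the absolutely convergent integral $$u(x)=\frac{e^{-Q_+(k_\parallel)}}{2\pi i}\int_{-\infty}^\infty\frac{1}{\xi-k_\parallel}\,\frac{e^{Q_+(\xi)}}{\mathcal P(\xi)}\,e^{i\xi x}\,d\xi,\qquad x>0 .$$ Its transform $\widehat u(\xi)=\int_0^\infty u(x)e^{-i\xi x}\,dx$ satisfies $e^{Q_-(\xi)}\widehat u(\xi)-e^{-Q_+(k_\parallel)}\dfrac{-i}{\xi-k_\parallel}=0$ for all $\xi\in\mathbb C_-$. -/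

import Mathlib

open Set Filter Topology MeasureTheory

noncomputable section

namespace HalfPlane

/-- The zeroth-order Hankel function of the first kind, on the upper half-plane `Im z > 0`, by
Sommerfeld's (absolutely convergent) integral
`H₀⁽¹⁾(z) = (1 / (π i)) ∫_{-∞}^{∞} exp (i z cosh t) dt`. Only arguments `z = k |x|` with `Im k > 0`
and `x ≠ 0` are used. -/
def hankelH1Zero (z : ℂ) : ℂ :=
  1 / (Real.pi * Complex.I) * ∫ t : ℝ, Complex.exp (Complex.I * z * (Real.cosh t : ℂ))

/-- The kernel `𝒦(x) = (i/4) H₀⁽¹⁾(k|x|)`. -/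
def kernel (k : ℂ) (x : ℝ) : ℂ :=
  Complex.I / 4 * hankelH1Zero (k * (|x| : ℝ))

/-- The Fourier transform `𝒦̂(ξ) = ∫ 𝒦(x) e^{-iξx} dx`, for real `ξ`. -/
def kernelHat (k : ℂ) (ξ : ℝ) : ℂ :=
  ∫ x : ℝ, kernel k x * Complex.exp (-(Complex.I * ξ * x))

/-- `𝒫(ξ) = 1 - i (ς/k) (k² - ξ²) 𝒦̂(ξ)`, for real `ξ`. -/
def symbolP (k ς : ℂ) (ξ : ℝ) : ℂ :=
  1 - Complex.I * (ς / k) * (k ^ 2 - (ξ : ℂ) ^ 2) * kernelHat k ξ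

/-- `n` is the index of `F`: the change over the real line of a continuous argument of `F`,
divided by `2π`. -/
def HasIndex (F : ℝ → ℂ) (n : ℝ) : Prop :=
  ∃ a : ℝ → ℝ, Continuous a ∧ (∀ ξ, F ξ = (‖F ξ‖ : ℂ) * Complex.exp (Complex.I * a ξ)) ∧
    Tendsto (fun M : ℝ => (a M - a (-M)) / (2 * Real.pi)) atTop (𝓝 n)

/-- `Q` is a continuous branch of `ln F` on the real line. -/
def IsLogBranch (Q F : ℝ → ℂ) : Prop :=
  Continuous Q ∧ ∀ ζ, Complex.exp (Q ζ) = F ζ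

/-- The open upper half-plane `ℂ₊`. -/
def upperHalf : Set ℂ := {z | 0 < z.im}

/-- The open lower half-plane `ℂ₋`. -/
def lowerHalf : Set ℂ := {z | z.im < 0}

/-- The split function `Q₊(ξ) = (ξ / (π i)) ∫₀^∞ Q(ζ) / (ζ² - ξ²) dζ`, for `ξ ∈ ℂ₊`. -/
def splitPlus (Q : ℝ → ℂ) (ξ : ℂ) : ℂ :=
  ξ / (Real.pi * Complex.I) * ∫ ζ in Ioi (0 : ℝ), Q ζ / ((ζ : ℂ) ^ 2 - ξ ^ 2)

/-- The split function `Q₋(ξ) = -(ξ / (π i)) ∫₀^∞ Q(ζ) / (ζ² - ξ²) dζ`, for `ξ ∈ ℂ₋`. -/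
def splitMinus (Q : ℝ → ℂ) (ξ : ℂ) : ℂ :=
  -(ξ / (Real.pi * Complex.I)) * ∫ ζ in Ioi (0 : ℝ), Q ζ / ((ζ : ℂ) ^ 2 - ξ ^ 2)

/-- The value of `Q₊` at a real point: its limit from `ℂ₊`. -/
def splitPlusReal (Q : ℝ → ℂ) (ξ : ℝ) : ℂ :=
  limUnder (𝓝[upperHalf] (ξ : ℂ)) (splitPlus Q)

/-- The value of `Q₋` at a real point: its limit from `ℂ₋`. -/
def splitMinusReal (Q : ℝ → ℂ) (ξ : ℝ) : ℂ :=
  limUnder (𝓝[lowerHalf] (ξ : ℂ)) (splitMinus Q)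

/-- The integrand `e^{Q₊(ξ)} e^{iξx} / ((ξ - κ) 𝒫(ξ))` of the Fourier integral, `ξ` real. -/
def fourierIntegrand (k ς κ : ℂ) (Q : ℝ → ℂ) (x ξ : ℝ) : ℂ :=
  1 / ((ξ : ℂ) - κ) * (Complex.exp (splitPlusReal Q ξ) / symbolP k ς ξ) *
    Complex.exp (Complex.I * ξ * x)

/-- The Fourier integral
`(e^{-Q₊(κ)} / (2π i)) ∫_{-∞}^{∞} e^{Q₊(ξ)} e^{iξx} / ((ξ - κ) 𝒫(ξ)) dξ`. -/
def fourierSolution (k ς κ : ℂ) (Q : ℝ → ℂ) (x : ℝ) : ℂ :=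
  Complex.exp (-splitPlus Q κ) / (2 * Real.pi * Complex.I) *
    ∫ ξ : ℝ, fourierIntegrand k ς κ Q x ξ

/-- `∫₀^∞ 𝒦(x - x') u(x') dx'`. -/
def potential (k : ℂ) (u : ℝ → ℂ) (x : ℝ) : ℂ :=
  ∫ y in Ioi (0 : ℝ), kernel k (x - y) * u y

/-- `u` (of which only the values on `(0, ∞)` matter) is an integrable, classical solution of
`u(x) = uIn(x) + (iς/k) (d²/dx² + k²) ∫₀^∞ 𝒦(x - x') u(x') dx'`, `x > 0`. -/
structure IsIntegrableSolution (k ς : ℂ) (uIn u : ℝ → ℂ) : Prop where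
  integrable : IntegrableOn u (Ioi 0)
  converges : ∀ x : ℝ, 0 < x → IntegrableOn (fun y => kernel k (x - y) * u y) (Ioi 0)
  differentiable : ∀ x : ℝ, 0 < x → DifferentiableAt ℝ (potential k u) x
  differentiable_deriv : ∀ x : ℝ, 0 < x → DifferentiableAt ℝ (deriv (potential k u)) x
  equation : ∀ x : ℝ, 0 < x →
    u x = uIn x + Complex.I * ς / k * (deriv (deriv (potential k u)) x + k ^ 2 * potential k u x)

/-- The edge condition: `u` is bounded near the edge `x = 0`. -/
def BoundedAtEdge (u : ℝ → ℂ) : Prop :=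
  ∃ C δ : ℝ, 0 < δ ∧ ∀ x ∈ Ioo 0 δ, ‖u x‖ ≤ C

end HalfPlane

end

open HalfPlane

open Set Filter Topology MeasureTheory

/-! ### Contour integration on strips and half-planes: Cauchy's theorem and integral formula under
power decay. -/

namespace HalfPlane

open Complex

/-! The argument is Wiener–Hopf factorisation. Sommerfeld's integral and the substitution `y = sinh
t` give the transform of the kernel, so `P = 1 + (ς/2k) √(k² - ξ²)`, and this expression continues
to an even holomorphic function on the strip `|Im z| < Im k`. Dividing out the leading term `(ς/2k)
√(k² - z²)` leaves an even factor that tends to `1`. On a thin strip free of zeros it has an even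
logarithm `q`, and normalising `q` to vanish at one end makes it vanish at the other
(`exists_even_log`). A Cauchy integral along the lower edge of a strip gives `q(z) = p(z) + p(-z)`
(`exists_additive_splitting`), while the square root factors explicitly through `log (-i(k ± z))`.

Together, `Q(ξ) = F(ξ) + F(-ξ)` on the real line, where `F` is holomorphic slightly below the real
axis and everywhere above it, and `e^{±F(z)} = O(|z|^{±1/2})` (`exists_isSplitting`). Folding the
real line and Cauchy's formula identify the split functions: `Q₊ = F` and `Q₋(ξ) = F(-ξ)`.

Existence: on the real line the Fourier integrand is `e^{-F(-ξ)}/(ξ - κ)` times `e^{iξx}`. This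
density continues into the lower half-plane and decays like `|z|^{-3/2}`, so its inverse transform
vanishes for `x ≤ 0` and decays exponentially for `x ≥ 0`. Multiplied by the symbol it becomes
`e^{F(ξ)}/(ξ - κ)`, which continues upward. Hence for `x > 0` the potential is a twice
differentiable inverse transform plus residues at `k` and `κ`; the operator `d²/dx² + k²` kills the
first residue and turns the second into the incident wave.

Uniqueness: for a solution `d` of the homogeneous equation, integration by parts and the convolution
theorem show that `e^{F(-z)} d̂(z)` in the lower half-plane and a function of growth `|z|^{3/2}` in
the upper one share their boundary values. The common continuation is affine, and the edge condition
makes it tend to zero along the negative imaginary axis, so it is zero (`eq_zero_of_eq_on_real`).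
Then the potential vanishes for `x > 0`, and the equation itself gives `d = 0`. -/

lemma integrable_of_norm_le_rpow {f : ℝ → ℂ} {C p : ℝ} (hp : 1 < p)
    (hf : AEStronglyMeasurable f) (h : ∀ x, ‖f x‖ ≤ C * (1 + |x|) ^ (-p)) : Integrable f := by
  have h1 : Integrable (fun x : ℝ => C * (1 + ‖x‖) ^ (-p)) :=
    (integrable_one_add_norm (by simpa using hp)).const_mul C
  exact h1.mono' hf (Eventually.of_forall h)

lemma rpow_neg_le_abs_re {z : ℂ} {p : ℝ} (hp : 0 ≤ p) :
    (1 + ‖z‖) ^ (-p) ≤ (1 + |z.re|) ^ (-p) :=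
  Real.rpow_le_rpow_of_nonpos (by positivity) (by linarith [abs_re_le_norm z]) (by linarith)

lemma tendsto_const_mul_one_add_rpow_neg (C : ℝ) {p : ℝ} (hp : 0 < p) :
    Tendsto (fun R : ℝ => C * (1 + R) ^ (-p)) atTop (𝓝 0) := by
  have := (tendsto_rpow_neg_atTop hp).comp (tendsto_atTop_add_const_left atTop (1 : ℝ) tendsto_id)
  simpa using this.const_mul C

lemma continuous_horizontal {G : ℂ → ℂ} {S : Set ℂ} {a : ℝ} (hc : ContinuousOn G S)
    (h : ∀ x : ℝ, (x + a * I : ℂ) ∈ S) : Continuous fun x : ℝ => G (x + a * I) :=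
  hc.comp_continuous (by fun_prop) h

/-- Cauchy's theorem on a strip. -/
lemma integral_strip_eq {G : ℂ → ℂ} {a b C p : ℝ} (hab : a ≤ b) (hp : 1 < p)
    (hc : ContinuousOn G {z | a ≤ z.im ∧ z.im ≤ b})
    (hd : DifferentiableOn ℂ G {z | a < z.im ∧ z.im < b})
    (hb : ∀ z : ℂ, a ≤ z.im → z.im ≤ b → ‖G z‖ ≤ C * (1 + |z.re|) ^ (-p)) :
    ∫ x : ℝ, G (x + a * I) = ∫ x : ℝ, G (x + b * I) := by
  have hint : ∀ y, a ≤ y → y ≤ b → Integrable fun x : ℝ => G (x + y * I) := by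
    intro y h1 h2
    refine integrable_of_norm_le_rpow (C := C) hp
      (continuous_horizontal hc fun x => ⟨by simpa, by simpa⟩).aestronglyMeasurable fun x => ?_
    simpa using hb (x + y * I) (by simpa) (by simpa)
  have ht : ∀ y, a ≤ y → y ≤ b → Tendsto (fun R : ℝ => ∫ x in (-R)..R, G (x + y * I)) atTop
      (𝓝 (∫ x : ℝ, G (x + y * I))) := fun y h1 h2 =>
    intervalIntegral_tendsto_integral (hint y h1 h2) tendsto_neg_atTop_atBot tendsto_id
  have h0 := (ht a le_rfl hab).sub (ht b hab le_rfl)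
  have hside : ∀ R : ℝ, 0 ≤ R → ∀ r : ℝ, |r| = R →
      ‖∫ y in a..b, G (r + y * I)‖ ≤ C * (1 + R) ^ (-p) * |b - a| := by
    intro R hR r hr
    refine intervalIntegral.norm_integral_le_of_norm_le_const fun y hy => ?_
    rw [uIoc_of_le hab] at hy
    simpa [hr] using hb (r + y * I) (by simpa using hy.1.le) (by simpa using hy.2)
  have h1 : Tendsto (fun R : ℝ => (∫ x in (-R)..R, G (x + a * I)) - ∫ x in (-R)..R, G (x + b * I))
      atTop (𝓝 0) := by
    have hlim := (tendsto_const_mul_one_add_rpow_neg C (p := p) (by linarith)).mul_const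
      (2 * |b - a|)
    rw [zero_mul] at hlim
    refine squeeze_zero_norm' ?_ hlim
    filter_upwards [eventually_ge_atTop 0] with R hR
    have key := integral_boundary_rect_eq_zero_of_continuousOn_of_differentiableOn G
      ((-R : ℝ) + a * I) (R + b * I) (hc.mono ?_) (hd.mono ?_)
    · simp only [add_re, ofReal_re, mul_re, I_re, mul_zero, ofReal_im, I_im, mul_one, sub_self,
        add_zero, add_im, mul_im, zero_add, smul_eq_mul] at key
      have h2 := hside R hR R (abs_of_nonneg hR)
      have h3 := hside R hR (-R) (by simp [abs_of_nonneg hR])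
      have : (∫ x in (-R)..R, G (x + a * I)) - ∫ x in (-R)..R, G (x + b * I) =
          I * (∫ y in a..b, G ((-R : ℝ) + y * I)) - I * ∫ y in a..b, G (R + y * I) := by
        linear_combination key
      rw [this]
      refine (norm_sub_le _ _).trans ?_
      rw [norm_mul, norm_mul, norm_I]
      linarith
    · intro z hz
      rw [mem_reProdIm] at hz
      simpa [uIcc_of_le hab] using hz.2
    · intro z hz
      rw [mem_reProdIm] at hz
      simpa [hab] using hz.2
  exact sub_eq_zero.1 (tendsto_nhds_unique h0 h1)

/-- Cauchy's theorem on the upper half-plane. -/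
lemma integral_eq_zero_of_upper {G : ℂ → ℂ} {C p : ℝ} (hp : 1 < p)
    (hc : ContinuousOn G {z | 0 ≤ z.im}) (hd : DifferentiableOn ℂ G {z | 0 < z.im})
    (hb : ∀ z : ℂ, 0 ≤ z.im → ‖G z‖ ≤ C * (1 + ‖z‖) ^ (-p)) :
    ∫ x : ℝ, G x = 0 := by
  have hC : 0 ≤ C := by simpa using (norm_nonneg _).trans (hb 0 le_rfl)
  have hshift : ∀ T : ℝ, 0 ≤ T → ∫ x : ℝ, G x = ∫ x : ℝ, G (x + T * I) := by
    intro T hT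
    have := integral_strip_eq (G := G) (a := 0) (b := T) (C := C) hT hp
      (hc.mono fun z hz => hz.1) (hd.mono fun z hz => hz.1) fun z hz _ =>
        (hb z hz).trans (mul_le_mul_of_nonneg_left (rpow_neg_le_abs_re (by linarith)) hC)
    simpa using this
  -- Since `1 < r < p`, the decay splits in two: the power `r` keeps the integral over `x` finite
  -- and the remaining `p - r > 0` tends to zero with the height `T`.
  set r : ℝ := (1 + p) / 2 with hr
  have hlim := (tendsto_const_mul_one_add_rpow_neg C (p := p - r) (by linarith)).mul_const
    (∫ x : ℝ, (1 + |x|) ^ (-r))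
  rw [zero_mul] at hlim
  have hconst : Tendsto (fun _ : ℝ => ∫ x : ℝ, G x) atTop (𝓝 0) := by
    refine squeeze_zero_norm' ?_ hlim
    filter_upwards [eventually_ge_atTop 0] with T hT
    rw [hshift T hT, ← integral_const_mul]
    refine norm_integral_le_of_norm_le
      ((integrable_one_add_norm (by simp; linarith)).const_mul _) (Eventually.of_forall fun x => ?_)
    refine (hb (x + T * I) (by simpa)).trans ?_
    rw [mul_assoc]
    refine mul_le_mul_of_nonneg_left ?_ hC
    have h1 : T ≤ ‖(x + T * I : ℂ)‖ := by
      simpa [abs_of_nonneg hT] using abs_im_le_norm (x + T * I : ℂ)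
    have h2 : |x| ≤ ‖(x + T * I : ℂ)‖ := by simpa using abs_re_le_norm (x + T * I : ℂ)
    have : (-p : ℝ) = -(p - r) + -r := by ring
    rw [this, Real.rpow_add (by positivity)]
    refine mul_le_mul ?_ ?_ (by positivity) (by positivity)
    · exact Real.rpow_le_rpow_of_nonpos (by positivity) (by linarith) (by linarith)
    · exact Real.rpow_le_rpow_of_nonpos (by positivity) (by linarith) (by linarith)
  exact tendsto_nhds_unique tendsto_const_nhds hconst

lemma one_add_norm_le_mul_norm_sub {z ζ : ℂ} {r : ℝ} (hr : 0 < r) (h : r ≤ ‖ζ - z‖) :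
    1 + ‖ζ‖ ≤ (1 + (1 + ‖z‖) / r) * ‖ζ - z‖ := by
  have h1 : ‖ζ‖ ≤ ‖ζ - z‖ + ‖z‖ := by simpa using norm_add_le (ζ - z) z
  have h2 : (1 + ‖z‖) ≤ (1 + ‖z‖) / r * ‖ζ - z‖ := by
    rw [div_mul_eq_mul_div, le_div_iff₀ hr]
    exact mul_le_mul_of_nonneg_left h (by positivity)
  linarith

/-- At distance at least `r` from its pole, a simple pole factor decays like `(1 + ‖ζ‖)⁻¹`. The
decay bounds for rational factors below are products of this estimate. -/
lemma norm_inv_sub_le {z ζ : ℂ} {r : ℝ} (hr : 0 < r) (h : r ≤ ‖ζ - z‖) :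
    ‖ζ - z‖⁻¹ ≤ (1 + (1 + ‖z‖) / r) * (1 + ‖ζ‖) ^ (-1 : ℝ) := by
  have h0 : 0 < ‖ζ - z‖ := hr.trans_le h
  rw [Real.rpow_neg_one, ← div_eq_mul_inv, le_div_iff₀ (by positivity), inv_mul_le_iff₀ h0, mul_comm]
  exact one_add_norm_le_mul_norm_sub hr h

lemma norm_inv_sub_mul_le {z z' ζ : ℂ} {r : ℝ} (hr : 0 < r) (h : r ≤ ‖ζ - z‖) (h' : r ≤ ‖ζ - z'‖) :
    ‖((ζ - z) * (ζ - z'))⁻¹‖ ≤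
      (1 + (1 + ‖z‖) / r) * (1 + (1 + ‖z'‖) / r) * (1 + ‖ζ‖) ^ (-2 : ℝ) := by
  have h1 := norm_inv_sub_le hr h
  have h2 := norm_inv_sub_le hr h'
  have : (-2 : ℝ) = -1 + -1 := by norm_num
  rw [norm_inv, norm_mul, mul_inv, this, Real.rpow_add (by positivity)]
  calc _ ≤ _ := mul_le_mul h1 h2 (by positivity) (by positivity)
    _ = _ := by ring

lemma abs_im_le_norm_ofReal_sub (x : ℝ) (z : ℂ) : |z.im| ≤ ‖(x : ℂ) - z‖ := by
  simpa using abs_im_le_norm ((x : ℂ) - z)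

lemma im_sub_im_le_norm_sub (ζ z : ℂ) : ζ.im - z.im ≤ ‖ζ - z‖ := by
  simpa using (le_abs_self _).trans (abs_im_le_norm (ζ - z))

lemma ofReal_sub_ne_zero {z : ℂ} (hz : z.im ≠ 0) (x : ℝ) : (x : ℂ) - z ≠ 0 := by
  intro h
  apply hz
  simpa using congrArg im h

/-- Both poles lie below the line, so the contour closes upward. A difference is needed because a
single `(x - z)⁻¹` is not absolutely integrable. -/
lemma integral_inv_sub_sub_inv_sub_of_lower {z z' : ℂ} (hz : z.im < 0) (hz' : z'.im < 0) :
    ∫ x : ℝ, (((x : ℂ) - z)⁻¹ - ((x : ℂ) - z')⁻¹) = 0 := by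
  have hne : ∀ w : ℂ, w.im < 0 → ∀ ζ : ℂ, 0 ≤ ζ.im → ζ - w ≠ 0 := by
    intro w hw ζ hζ h
    have := congrArg im h
    simp at this; linarith
  set r := min (-z.im) (-z'.im) with hr
  have hr0 : 0 < r := by simp [hr, hz, hz']
  have hd : DifferentiableOn ℂ (fun ζ : ℂ => (ζ - z)⁻¹ - (ζ - z')⁻¹) {ζ | 0 ≤ ζ.im} := by
    intro ζ hζ
    have h1 := hne z hz ζ hζ
    have h2 := hne z' hz' ζ hζ
    exact ((by fun_prop (disch := assumption) :
      DifferentiableAt ℂ (fun ζ : ℂ => (ζ - z)⁻¹ - (ζ - z')⁻¹) ζ)).differentiableWithinAt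
  refine integral_eq_zero_of_upper (G := fun ζ => (ζ - z)⁻¹ - (ζ - z')⁻¹) (p := 2)
    (C := ‖z - z'‖ * ((1 + (1 + ‖z‖) / r) * (1 + (1 + ‖z'‖) / r))) (by norm_num) hd.continuousOn
    (hd.mono fun ζ (hζ : 0 < ζ.im) => hζ.le) fun ζ hζ => ?_
  have h1 := hne z hz ζ hζ
  have h2 := hne z' hz' ζ hζ
  have e : (ζ - z)⁻¹ - (ζ - z')⁻¹ = (z - z') * ((ζ - z) * (ζ - z'))⁻¹ := by field_simp; ring
  rw [e, norm_mul, mul_assoc]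
  refine mul_le_mul_of_nonneg_left (norm_inv_sub_mul_le hr0 ?_ ?_) (norm_nonneg _)
  · have := im_sub_im_le_norm_sub ζ z
    have := min_le_left (-z.im) (-z'.im)
    linarith
  · have := im_sub_im_le_norm_sub ζ z'
    have := min_le_right (-z.im) (-z'.im)
    linarith

lemma integral_inv_sub_sub_inv_sub_of_upper {z z' : ℂ} (hz : 0 < z.im) (hz' : 0 < z'.im) :
    ∫ x : ℝ, (((x : ℂ) - z)⁻¹ - ((x : ℂ) - z')⁻¹) = 0 := by
  have h := integral_inv_sub_sub_inv_sub_of_lower (z := -z) (z' := -z') (by simpa) (by simpa)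
  rw [← integral_neg_eq_self] at h
  rw [← neg_eq_zero, ← integral_neg, ← h]
  congr 1 with x
  have h1 := ofReal_sub_ne_zero hz.ne' x
  have h2 := ofReal_sub_ne_zero hz'.ne' x
  have h3 := ofReal_sub_ne_zero (z := -z) (by simpa using hz.ne') (-x)
  have h4 := ofReal_sub_ne_zero (z := -z') (by simpa using hz'.ne') (-x)
  have e3 : ((-x : ℝ) : ℂ) - -z = -((x : ℂ) - z) := by push_cast; ring
  have e4 : ((-x : ℝ) : ℂ) - -z' = -((x : ℂ) - z') := by push_cast; ring
  rw [e3, e4, inv_neg, inv_neg]; ring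

lemma integrable_inv_sub_mul_inv_sub {z z' : ℂ} (hz : z.im ≠ 0) (hz' : z'.im ≠ 0) :
    Integrable fun x : ℝ => (((x : ℂ) - z) * ((x : ℂ) - z'))⁻¹ := by
  refine integrable_of_norm_le_rpow (p := 2) (C := (1 + (1 + ‖z‖) / min |z.im| |z'.im|) *
    (1 + (1 + ‖z'‖) / min |z.im| |z'.im|)) (by norm_num) ?_ fun x => ?_
  · refine Continuous.aestronglyMeasurable ?_
    refine Continuous.inv₀ (by fun_prop) fun x => mul_ne_zero ?_ ?_
    · exact ofReal_sub_ne_zero hz x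
    · exact ofReal_sub_ne_zero hz' x
  · have := norm_inv_sub_mul_le (ζ := x) (z := z) (z' := z') (r := min |z.im| |z'.im|)
      (by simp [hz, hz']) ((min_le_left _ _).trans (abs_im_le_norm_ofReal_sub x z))
      ((min_le_right _ _).trans (abs_im_le_norm_ofReal_sub x z'))
    simpa using this

lemma integrable_inv_sub_sub_inv_sub {z z' : ℂ} (hz : z.im ≠ 0) (hz' : z'.im ≠ 0) :
    Integrable fun x : ℝ => ((x : ℂ) - z)⁻¹ - ((x : ℂ) - z')⁻¹ := by
  refine ((integrable_inv_sub_mul_inv_sub hz hz').const_mul (z - z')).congr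
    (Eventually.of_forall fun x => ?_)
  have h1 := ofReal_sub_ne_zero hz x
  have h2 := ofReal_sub_ne_zero hz' x
  simp only
  field_simp; ring

/-- The one-sided cases move the poles to `I` and `-I`, where the integrand is `2i/(1 + x²)`. -/
lemma integral_inv_sub_sub_inv_sub {z z' : ℂ} (hz : 0 < z.im) (hz' : z'.im < 0) :
    ∫ x : ℝ, (((x : ℂ) - z)⁻¹ - ((x : ℂ) - z')⁻¹) = 2 * Real.pi * I := by
  have h1 := integral_inv_sub_sub_inv_sub_of_upper (z := z) (z' := I) hz (by simp)
  have h2 := integral_inv_sub_sub_inv_sub_of_lower (z := -I) (z' := z') (by simp) hz'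
  have h3 : ∫ x : ℝ, (((x : ℂ) - I)⁻¹ - ((x : ℂ) - -I)⁻¹) = 2 * Real.pi * I := by
    have : (fun x : ℝ => ((x : ℂ) - I)⁻¹ - ((x : ℂ) - -I)⁻¹) =
        fun x : ℝ => 2 * I * (((1 + x ^ 2)⁻¹ : ℝ) : ℂ) := by
      ext x
      have h1 := ofReal_sub_ne_zero (z := I) (by simp) x
      have h2 := ofReal_sub_ne_zero (z := -I) (by simp) x
      have h3 : (1 + (x : ℂ) ^ 2) = ((x : ℂ) - I) * ((x : ℂ) - -I) := by ring_nf; simp [add_comm]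
      have h4 : (1 + (x : ℂ) ^ 2) ≠ 0 := h3 ▸ mul_ne_zero h1 h2
      push_cast
      rw [h3]
      field_simp; ring
    rw [this, integral_const_mul, integral_complex_ofReal, integral_univ_inv_one_add_sq]
    ring
  have e : (fun x : ℝ => ((x : ℂ) - z)⁻¹ - ((x : ℂ) - z')⁻¹) = fun x : ℝ =>
      ((((x : ℂ) - z)⁻¹ - ((x : ℂ) - I)⁻¹) + (((x : ℂ) - I)⁻¹ - ((x : ℂ) - -I)⁻¹)) +
        (((x : ℂ) - -I)⁻¹ - ((x : ℂ) - z')⁻¹) := by ext; ring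
  rw [e, integral_add, integral_add, h1, h2, h3]
  · ring
  · exact integrable_inv_sub_sub_inv_sub hz.ne' (by simp)
  · exact integrable_inv_sub_sub_inv_sub (by simp) (by simp)
  · exact (integrable_inv_sub_sub_inv_sub hz.ne' (by simp)).add
      (integrable_inv_sub_sub_inv_sub (by simp) (by simp))
  · exact integrable_inv_sub_sub_inv_sub (by simp) hz'.ne

lemma isOpen_im_gt (a : ℝ) : IsOpen {z : ℂ | a < z.im} := isOpen_lt continuous_const continuous_im

lemma isOpen_im_lt (a : ℝ) : IsOpen {z : ℂ | z.im < a} := isOpen_lt continuous_im continuous_const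

/-- A divided difference that vanishes at its node decays one order faster than the function. -/
lemma exists_norm_dslope_le {f : ℂ → ℂ} {S : Set ℂ} {z : ℂ} {C p : ℝ} (hz : S ∈ 𝓝 z)
    (hc : ContinuousOn (dslope f z) S) (hb : ∀ ζ ∈ S, ‖f ζ‖ ≤ C * (1 + ‖ζ‖) ^ (-p)) (h0 : f z = 0) :
    ∃ D, ∀ ζ ∈ S, ‖dslope f z ζ‖ ≤ D * (1 + ‖ζ‖) ^ (-(p + 1)) := by
  obtain ⟨r, hr, hrS⟩ := Metric.nhds_basis_closedBall.mem_iff.1 hz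
  have hC : 0 ≤ C := by
    have := (norm_nonneg _).trans (hb z (mem_of_mem_nhds hz))
    exact nonneg_of_mul_nonneg_left this (by positivity)
  have hcont : ContinuousOn (fun ζ => ‖dslope f z ζ‖ * (1 + ‖ζ‖) ^ (p + 1))
      (Metric.closedBall z r) := by
    refine (hc.mono hrS).norm.mul (Continuous.continuousOn ?_)
    exact Continuous.rpow_const (by fun_prop) fun x => Or.inl (by positivity)
  obtain ⟨B, hB⟩ := (isCompact_closedBall z r).exists_bound_of_continuousOn hcont
  refine ⟨max B (C * (1 + (1 + ‖z‖) / r)), fun ζ hζ => ?_⟩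
  have hpos : 0 < (1 + ‖ζ‖) ^ (p + 1) := by positivity
  by_cases h : ζ ∈ Metric.closedBall z r
  · have h1 := hB ζ h
    rw [Real.norm_of_nonneg (by positivity)] at h1
    rw [Real.rpow_neg (by positivity), ← div_eq_mul_inv, le_div_iff₀ hpos]
    exact h1.trans (le_max_left _ _)
  · have hle : r ≤ ‖ζ - z‖ := by
      rw [Metric.mem_closedBall, not_le, dist_eq_norm] at h
      exact h.le
    have hne : ζ ≠ z := by
      rintro rfl
      simp at hle; linarith
    rw [dslope_of_ne _ hne, slope_def_field, h0, sub_zero, norm_div, div_eq_mul_inv]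
    have h1 := mul_le_mul (hb ζ hζ) (norm_inv_sub_le hr hle) (by positivity) (by positivity)
    refine h1.trans ?_
    have : -(p + 1) = -p + -1 := by ring
    rw [this, Real.rpow_add (by positivity)]
    calc _ = C * (1 + (1 + ‖z‖) / r) * ((1 + ‖ζ‖) ^ (-p) * (1 + ‖ζ‖) ^ (-1 : ℝ)) := by ring
      _ ≤ _ := by gcongr; exact le_max_right _ _

lemma continuousOn_dslope_of_isOpen {f : ℂ → ℂ} {S U : Set ℂ} {z : ℂ} (hU : IsOpen U) (hz : z ∈ U)
    (hUS : U ⊆ S) (hc : ContinuousOn f S) (hd : DifferentiableOn ℂ f U) :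
    ContinuousOn (dslope f z) S :=
  (continuousOn_dslope (mem_of_superset (hU.mem_nhds hz) hUS)).2
    ⟨hc, hd.differentiableAt (hU.mem_nhds hz)⟩

/-- Cauchy's integral formula on the upper half-plane. -/
lemma integral_div_sub_of_upper {f : ℂ → ℂ} {C α : ℝ} (hα : 0 < α) {z : ℂ} (hz : 0 < z.im)
    (hc : ContinuousOn f {z | 0 ≤ z.im}) (hd : DifferentiableOn ℂ f {z | 0 < z.im})
    (hb : ∀ z : ℂ, 0 ≤ z.im → ‖f z‖ ≤ C * (1 + ‖z‖) ^ (-α)) :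
    ∫ x : ℝ, f x / (x - z) = 2 * Real.pi * I * f z := by
  have hC : 0 ≤ C := by simpa using (norm_nonneg _).trans (hb 0 le_rfl)
  -- The rational correction subtracted below decays only to first order, so the rate is capped at
  -- `1`.
  set β := min α 1 with hβ
  have hβ0 : 0 < β := by simp [hβ, hα]
  have hsub : {z : ℂ | 0 < z.im} ⊆ {z | 0 ≤ z.im} := fun ζ (hζ : 0 < ζ.im) => hζ.le
  have hne : ∀ ζ : ℂ, 0 ≤ ζ.im → ζ + I ≠ 0 := by
    intro ζ hζ h
    have := congrArg im h
    simp at this; linarith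
  -- The correction agrees with `f` at `z` and has its only pole at `-I`. So `g` vanishes at `z`,
  -- its divided difference gains one order of decay and integrates to zero, and only explicit pole
  -- integrals remain.
  set g : ℂ → ℂ := fun ζ => f ζ - f z * ((z + I) / (ζ + I)) with hg
  have hφ : DifferentiableOn ℂ (fun ζ : ℂ => f z * ((z + I) / (ζ + I))) {z | 0 ≤ z.im} := by
    intro ζ hζ
    have := hne ζ hζ
    exact (by fun_prop (disch := assumption) :
      DifferentiableAt ℂ (fun ζ : ℂ => f z * ((z + I) / (ζ + I))) ζ).differentiableWithinAt
  have hgc : ContinuousOn g {z | 0 ≤ z.im} := hc.sub hφ.continuousOn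
  have hgd : DifferentiableOn ℂ g {z | 0 < z.im} := hd.sub (hφ.mono hsub)
  have hgz : g z = 0 := by
    simp only [hg]; rw [div_self (hne z hz.le)]; ring
  have hgb : ∀ ζ ∈ {z : ℂ | 0 ≤ z.im}, ‖g ζ‖ ≤ (C + ‖f z‖ * (‖z + I‖ * (1 + (1 + ‖-I‖) / 1))) *
      (1 + ‖ζ‖) ^ (-β) := by
    intro ζ hζ
    have h1 : ‖f ζ‖ ≤ C * (1 + ‖ζ‖) ^ (-β) := (hb ζ hζ).trans <| by
      gcongr
      · linarith [norm_nonneg ζ]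
      · exact min_le_left _ _
    have h2 : ‖ζ + I‖⁻¹ ≤ (1 + (1 + ‖-I‖) / 1) * (1 + ‖ζ‖) ^ (-β) := by
      have h3 := norm_inv_sub_le (z := -I) (ζ := ζ) one_pos (by
        have := im_sub_im_le_norm_sub ζ (-I)
        simp at this hζ ⊢; linarith)
      rw [sub_neg_eq_add] at h3
      refine h3.trans ?_
      gcongr
      · linarith [norm_nonneg ζ]
      · exact min_le_right _ _
    refine (norm_sub_le _ _).trans ?_
    rw [norm_mul, norm_div, div_eq_mul_inv]
    calc _ ≤ C * (1 + ‖ζ‖) ^ (-β) +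
        ‖f z‖ * (‖z + I‖ * ((1 + (1 + ‖-I‖) / 1) * (1 + ‖ζ‖) ^ (-β))) := by gcongr
      _ = _ := by ring
  have hnhds : {z : ℂ | 0 < z.im} ∈ 𝓝 z := (isOpen_im_gt 0).mem_nhds hz
  have hGc := continuousOn_dslope_of_isOpen (isOpen_im_gt 0) hz hsub hgc hgd
  obtain ⟨D, hD⟩ := exists_norm_dslope_le (mem_of_superset hnhds hsub) hGc hgb hgz
  have hG := integral_eq_zero_of_upper (p := β + 1) (by linarith) hGc
    ((differentiableOn_dslope hnhds).2 hgd) hD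
  have hGint : Integrable fun x : ℝ => dslope g z x := by
    refine integrable_of_norm_le_rpow (p := β + 1) (C := D) (by linarith) ?_ fun x => ?_
    · exact (hGc.comp_continuous continuous_ofReal fun x => by simp).aestronglyMeasurable
    · simpa using hD x (by simp)
  have e : (fun x : ℝ => f x / (x - z)) = fun x : ℝ =>
      dslope g z x + f z * (((x : ℂ) - z)⁻¹ - ((x : ℂ) - -I)⁻¹) := by
    ext x
    have h1 := ofReal_sub_ne_zero hz.ne' x
    have h2 := hne x (by simp)
    rw [dslope_of_ne _ (sub_ne_zero.1 h1), slope_def_field, hgz, hg, sub_neg_eq_add]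
    simp only
    field_simp
    ring
  rw [e, integral_add hGint ((integrable_inv_sub_sub_inv_sub hz.ne' (by simp)).const_mul _), hG,
    integral_const_mul, integral_inv_sub_sub_inv_sub hz (by simp)]
  ring

/-- Cauchy's integral formula on the lower half-plane. -/
lemma integral_div_sub_of_lower {f : ℂ → ℂ} {C α : ℝ} (hα : 0 < α) {z : ℂ} (hz : z.im < 0)
    (hc : ContinuousOn f {z | z.im ≤ 0}) (hd : DifferentiableOn ℂ f {z | z.im < 0})
    (hb : ∀ z : ℂ, z.im ≤ 0 → ‖f z‖ ≤ C * (1 + ‖z‖) ^ (-α)) :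
    ∫ x : ℝ, f x / (x - z) = -(2 * Real.pi * I * f z) := by
  have h := integral_div_sub_of_upper (f := fun ζ => f (-ζ)) (z := -z) hα (by simpa)
    (hc.comp continuous_neg.continuousOn fun ζ (hζ : 0 ≤ ζ.im) => by simpa)
    (hd.comp differentiable_neg.differentiableOn fun ζ (hζ : 0 < ζ.im) => by simpa)
    (fun ζ hζ => by simpa using hb (-ζ) (by simpa))
  rw [← integral_neg_eq_self, neg_neg] at h
  rw [← h, ← integral_neg]
  congr 1 with x
  have e : ((-x : ℝ) : ℂ) - -z = -((x : ℂ) - z) := by push_cast; ring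
  rw [e, div_neg, neg_neg]
  simp

end HalfPlane

/-! ### The Fourier transform of the kernel. -/

namespace HalfPlane

open Complex

lemma integrable_and_integral_exp_neg_abs_mul_exp {a : ℂ} (ha : 0 < a.re) (ξ : ℝ) :
    Integrable (fun x : ℝ => exp (-a * (|x| : ℝ)) * exp (-(I * ξ * x))) ∧
      ∫ x : ℝ, exp (-a * (|x| : ℝ)) * exp (-(I * ξ * x)) = 2 * a / (a ^ 2 + (ξ : ℂ) ^ 2) := by
  have e1 : ∀ x ∈ Ioi (0 : ℝ), exp ((-a - I * ξ) * x) =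
      exp (-a * (|x| : ℝ)) * exp (-(I * ξ * x)) := by
    intro x hx
    rw [abs_of_pos hx, ← exp_add]; ring_nf
  have e2 : ∀ x ∈ Iic (0 : ℝ), exp ((a - I * ξ) * x) =
      exp (-a * (|x| : ℝ)) * exp (-(I * ξ * x)) := by
    intro x hx
    rw [abs_of_nonpos hx, ← exp_add]; push_cast; ring_nf
  have r1 : (-a - I * ξ).re < 0 := by simpa
  have r2 : 0 < (a - I * ξ).re := by simpa
  have i1 := (integrableOn_exp_mul_complex_Ioi r1 0).congr_fun e1 measurableSet_Ioi
  have i2 := (integrableOn_exp_mul_complex_Iic r2 0).congr_fun e2 measurableSet_Iic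
  have n1 : a + I * ξ ≠ 0 := fun h => by
    have := congrArg re h
    simp at this; linarith
  have n2 : a - I * ξ ≠ 0 := fun h => by rw [h] at r2; simp at r2
  refine ⟨?_, ?_⟩
  · rw [← integrableOn_univ, ← Iic_union_Ioi (a := (0 : ℝ))]
    exact i2.union i1
  · rw [← intervalIntegral.integral_Iic_add_Ioi i2 i1, ← setIntegral_congr_fun measurableSet_Iic e2,
      ← setIntegral_congr_fun measurableSet_Ioi e1, integral_exp_mul_complex_Iic r2,
      integral_exp_mul_complex_Ioi r1]
    have : a ^ 2 + (ξ : ℂ) ^ 2 = (a + I * ξ) * (a - I * ξ) := by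
      ring_nf; simp
    have n3 : -a - I * ξ ≠ 0 := fun h => n1 (by linear_combination -h)
    rw [this]
    simp only [ofReal_zero, mul_zero, exp_zero]
    field_simp
    ring

lemma integral_exp_neg_mul_abs {c : ℝ} (hc : 0 < c) : ∫ x : ℝ, Real.exp (-c * |x|) = 2 / c := by
  rw [integral_comp_abs (f := fun x => Real.exp (-c * x)),
    integral_exp_mul_Ioi (by linarith : -c < 0)]
  simp
  field_simp

lemma integrable_inv_cosh : Integrable fun t : ℝ => (Real.cosh t)⁻¹ := by
  have h : Integrable fun t : ℝ => 2 * Real.exp (-|t|) := by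
    have := (integrable_and_integral_exp_neg_abs_mul_exp (a := 1) (by simp) 0).1.norm
    refine (this.const_mul 2).congr (Eventually.of_forall fun t => ?_)
    simp [norm_exp]
  refine h.mono' ?_ (Eventually.of_forall fun t => ?_)
  · exact (Real.continuous_cosh.inv₀ fun t => (Real.cosh_pos t).ne').aestronglyMeasurable
  · rw [Real.norm_of_nonneg (by positivity [Real.cosh_pos t]),
      inv_le_comm₀ (Real.cosh_pos t) (by positivity), mul_inv, ← Real.exp_neg, neg_neg,
      ← Real.cosh_abs, Real.cosh_eq]
    linarith [Real.exp_pos (-|t|)]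

lemma kernel_eq (k : ℂ) (x : ℝ) :
    kernel k x = 1 / (4 * Real.pi) * ∫ t : ℝ, exp (-(-I * k * (Real.cosh t : ℂ)) * (|x| : ℝ)) := by
  have hpi : (Real.pi : ℂ) ≠ 0 := by exact_mod_cast Real.pi_ne_zero
  rw [kernel, hankelH1Zero, ← mul_assoc]
  congr 1
  · field_simp
  · congr 1 with t
    ring_nf

lemma re_neg_I_mul_cosh (k : ℂ) (t : ℝ) :
    (-I * k * (Real.cosh t : ℂ)).re = k.im * Real.cosh t := by
  rw [re_mul_ofReal]; simp

/-- The modulus decays in `|x|` at rate `Im k · cosh t`. Integrating in `x` first leaves `2 / (Im k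
· cosh t)`, which is integrable in `t`; this justifies Fubini. -/
lemma integrable_kernel_prod {k : ℂ} (hk : 0 < k.im) (ξ : ℝ) :
    Integrable (fun p : ℝ × ℝ => exp (-(-I * k * (Real.cosh p.2 : ℂ)) * (|p.1| : ℝ)) *
      exp (-(I * ξ * p.1))) (volume.prod volume) := by
  have hre : ∀ t : ℝ, 0 < (-I * k * (Real.cosh t : ℂ)).re := fun t => by
    rw [re_neg_I_mul_cosh]; exact mul_pos hk (Real.cosh_pos t)
  rw [integrable_prod_iff']
  · refine ⟨Eventually.of_forall fun t =>
      (integrable_and_integral_exp_neg_abs_mul_exp (hre t) ξ).1, ?_⟩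
    have : (fun t : ℝ => ∫ x : ℝ, ‖exp (-(-I * k * (Real.cosh t : ℂ)) * (|x| : ℝ)) *
        exp (-(I * ξ * x))‖) = fun t => 2 / k.im * (Real.cosh t)⁻¹ := by
      ext t
      have h1 : (fun x : ℝ => ‖exp (-(-I * k * (Real.cosh t : ℂ)) * (|x| : ℝ)) *
        exp (-(I * ξ * x))‖) = fun x => Real.exp (-(k.im * Real.cosh t) * |x|) := by
        ext x
        rw [norm_mul, norm_exp, norm_exp, re_mul_ofReal, neg_re, re_neg_I_mul_cosh]
        simp
      rw [h1, integral_exp_neg_mul_abs (mul_pos hk (Real.cosh_pos t))]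
      field_simp
    rw [this]
    exact integrable_inv_cosh.const_mul _
  · refine Continuous.aestronglyMeasurable ?_
    have : Continuous fun p : ℝ × ℝ => (Real.cosh p.2 : ℂ) :=
      continuous_ofReal.comp (Real.continuous_cosh.comp continuous_snd)
    fun_prop

lemma kernel_mul_exp_eq (k : ℂ) (ξ x : ℝ) :
    kernel k x * exp (-(I * ξ * x)) = 1 / (4 * Real.pi) *
      ∫ t : ℝ, exp (-(-I * k * (Real.cosh t : ℂ)) * (|x| : ℝ)) * exp (-(I * ξ * x)) := by
  rw [kernel_eq, mul_assoc, integral_mul_const]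

lemma integrable_kernel {k : ℂ} (hk : 0 < k.im) : Integrable (kernel k) := by
  have h := (integrable_kernel_prod hk 0).integral_prod_left.const_mul (1 / (4 * Real.pi) : ℂ)
  refine h.congr (Eventually.of_forall fun x => ?_)
  simp only
  rw [← kernel_mul_exp_eq]
  simp

lemma integral_inv_sq_add_sq {σ : ℂ} (hσ : 0 < σ.re) :
    ∫ y : ℝ, 1 / ((y : ℂ) ^ 2 + σ ^ 2) = Real.pi / σ := by
  have h := integral_inv_sub_sub_inv_sub (z := I * σ) (z' := -(I * σ)) (by simpa) (by simpa)
  have hσ0 : σ ≠ 0 := fun h => by simp [h] at hσ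
  have e : (fun x : ℝ => ((x : ℂ) - I * σ)⁻¹ - ((x : ℂ) - -(I * σ))⁻¹) =
      fun x : ℝ => 2 * I * σ * (1 / ((x : ℂ) ^ 2 + σ ^ 2)) := by
    ext x
    have h1 := ofReal_sub_ne_zero (z := I * σ) (by simpa using hσ.ne') x
    have h2 := ofReal_sub_ne_zero (z := -(I * σ)) (by simpa using hσ.ne') x
    have h3 : (x : ℂ) ^ 2 + σ ^ 2 = ((x : ℂ) - I * σ) * ((x : ℂ) - -(I * σ)) := by
      ring_nf; simp
    rw [h3]
    field_simp
    ring
  rw [e, integral_const_mul] at h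
  have h4 : (2 * I * σ) ≠ 0 := by simp [hσ0]
  apply mul_left_cancel₀ h4
  rw [h]
  field_simp

/-- Since `ξ` is real, the imaginary parts of the squares agree: `Re s · Im s = Re k · Im k > 0`. So
`s` lies in the first quadrant together with `k`, and the angle between them is less than a right
angle. -/
lemma re_div_pos_of_sq_eq {k s : ℂ} (hre : 0 < k.re) (him : 0 < k.im) {ξ : ℝ}
    (hs : s ^ 2 = k ^ 2 - (ξ : ℂ) ^ 2) (hsim : 0 < s.im) : 0 < (s / k).re := by
  have h1 := congrArg im hs
  simp [pow_two] at h1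
  have hsre : 0 < s.re := by nlinarith [mul_pos hre him]
  have hn : 0 < normSq k := normSq_pos.2 fun h => by simp [h] at hre
  rw [div_re]
  positivity

/-- After Fubini the inner integral is `2a/(a² + ξ²)` with `a = -ik cosh t`, and `a² + ξ² = -k²
(sinh² t + (s/k)²)`. The factor `cosh t` is the Jacobian of `y = sinh t`, which leaves `∫ dy / (y² +
(s/k)²)`. -/
lemma kernelHat_eq {k : ℂ} (hre : 0 < k.re) (him : 0 < k.im) {ξ : ℝ} {s : ℂ}
    (hs : s ^ 2 = k ^ 2 - (ξ : ℂ) ^ 2) (hsim : 0 < s.im) : kernelHat k ξ = I / (2 * s) := by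
  have hpi : (Real.pi : ℂ) ≠ 0 := by exact_mod_cast Real.pi_ne_zero
  have hk0 : k ≠ 0 := fun h => by simp [h] at hre
  have hs0 : s ≠ 0 := fun h => by simp [h] at hsim
  have hσ := re_div_pos_of_sq_eq hre him hs hsim
  have hpos : ∀ t : ℝ, 0 < (-I * k * (Real.cosh t : ℂ)).re := fun t => by
    rw [re_neg_I_mul_cosh]; exact mul_pos him (Real.cosh_pos t)
  rw [kernelHat]
  simp_rw [kernel_mul_exp_eq]
  rw [integral_const_mul, integral_integral_swap (integrable_kernel_prod him ξ)]
  simp_rw [fun t => (integrable_and_integral_exp_neg_abs_mul_exp (hpos t) ξ).2]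
  have hsub := integral_image_eq_integral_abs_deriv_smul (s := univ) (f := Real.sinh)
    (f' := Real.cosh) MeasurableSet.univ (fun x _ => (Real.hasDerivAt_sinh x).hasDerivWithinAt)
    Real.sinh_injective.injOn fun y : ℝ => 1 / ((y : ℂ) ^ 2 + (s / k) ^ 2)
  rw [image_univ, Real.sinh_surjective.range_eq, setIntegral_univ, setIntegral_univ,
    integral_inv_sq_add_sq hσ] at hsub
  have e : ∀ t : ℝ, 2 * (-I * k * (Real.cosh t : ℂ)) /
      ((-I * k * (Real.cosh t : ℂ)) ^ 2 + (ξ : ℂ) ^ 2) =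
      2 * I / k * (|Real.cosh t| • (1 / ((Real.sinh t : ℂ) ^ 2 + (s / k) ^ 2))) := by
    intro t
    rw [abs_of_pos (Real.cosh_pos t), real_smul]
    have h1 : (Real.cosh t : ℂ) ^ 2 = (Real.sinh t : ℂ) ^ 2 + 1 := by
      exact_mod_cast Real.cosh_sq t
    have h2 : (-I * k * (Real.cosh t : ℂ)) ^ 2 + (ξ : ℂ) ^ 2 =
        -(k ^ 2 * ((Real.sinh t : ℂ) ^ 2 + (s / k) ^ 2)) := by
      rw [div_pow, hs, mul_pow, mul_pow, h1, neg_sq, I_sq]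
      field_simp
      ring
    rw [h2]
    field_simp
    try ring
  simp_rw [e]
  rw [integral_const_mul, ← hsub]
  field_simp
  norm_num

end HalfPlane

/-! ### Even logarithms on a strip, and decay of Cauchy integrals. -/

namespace HalfPlane

open Complex

/-- The horizontal strip `|Im z| < δ`. -/
def strip (δ : ℝ) : Set ℂ := {z | |z.im| < δ}

lemma isOpen_strip (δ : ℝ) : IsOpen (strip δ) :=
  isOpen_lt (continuous_abs.comp continuous_im) continuous_const

lemma strip_eq (δ : ℝ) : strip δ = {z | -δ < z.im} ∩ {z | z.im < δ} := by
  ext z; simp [strip, abs_lt]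

lemma convex_strip (δ : ℝ) : Convex ℝ (strip δ) := by
  rw [strip_eq]
  exact (convex_halfSpace_im_gt _).inter (convex_halfSpace_im_lt _)

lemma strip_mono {δ δ' : ℝ} (h : δ ≤ δ') : strip δ ⊆ strip δ' := fun _ hz => lt_of_lt_of_le hz h

lemma neg_mem_strip {δ : ℝ} {z : ℂ} (hz : z ∈ strip δ) : -z ∈ strip δ := by
  simpa [strip] using hz

/-- The values lie in the countable, hence totally disconnected, set `2πiℤ`. Applied to the
difference of two continuous logarithms, this says that they differ by a constant. -/
lemma exists_eq_int_mul_of_exp_eq_one {X : Type*} [TopologicalSpace X] {S : Set X}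
    (hS : IsPreconnected S) {f : X → ℂ} (hf : ContinuousOn f S) (h : ∀ x ∈ S, exp (f x) = 1) :
    ∃ n : ℤ, ∀ x ∈ S, f x = n * (2 * Real.pi * I) := by
  rcases S.eq_empty_or_nonempty with rfl | ⟨x₀, hx₀⟩
  · simp
  have hcount : (range fun n : ℤ => (n * (2 * Real.pi * I) : ℂ)).Countable := countable_range _
  have hsub : f '' S ⊆ range fun n : ℤ => (n * (2 * Real.pi * I) : ℂ) := by
    rintro _ ⟨x, hx, rfl⟩
    obtain ⟨n, hn⟩ := exp_eq_one_iff.1 (h x hx)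
    exact ⟨n, hn.symm⟩
  have hss := hcount.isTotallyDisconnected _ hsub (hS.image f hf)
  obtain ⟨n, hn⟩ := exp_eq_one_iff.1 (h x₀ hx₀)
  exact ⟨n, fun x hx => (hss (mem_image_of_mem f hx) (mem_image_of_mem f hx₀)).trans hn⟩

/-- A nowhere vanishing holomorphic function on an open convex set has a holomorphic logarithm. -/
lemma exists_log_of_convex {S : Set ℂ} (hS : Convex ℝ S) (hSo : IsOpen S) {g : ℂ → ℂ}
    (hg : DifferentiableOn ℂ g S) (h0 : ∀ z ∈ S, g z ≠ 0) :
    ∃ q : ℂ → ℂ, DifferentiableOn ℂ q S ∧ ∀ z ∈ S, exp (q z) = g z := by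
  rcases S.eq_empty_or_nonempty with rfl | ⟨z₀, hz₀⟩
  · exact ⟨0, by simp⟩
  obtain ⟨q, hq⟩ := hS.exists_forall_hasDerivWithinAt ((hg.deriv hSo).div hg h0)
  have hq' : ∀ z ∈ S, HasDerivAt q (deriv g z / g z) z := fun z hz =>
    (hq z hz).hasDerivAt (hSo.mem_nhds hz)
  have hd : ∀ z ∈ S, HasDerivAt (fun z => g z * exp (-q z)) 0 z := by
    intro z hz
    have h1 := (hg.differentiableAt (hSo.mem_nhds hz)).hasDerivAt.mul (hq' z hz).neg.cexp
    refine h1.congr_deriv ?_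
    have := h0 z hz
    simp only [Pi.neg_apply]
    field_simp
    ring
  have hconst : ∀ z ∈ S, g z * exp (-q z) = g z₀ * exp (-q z₀) := by
    intro z hz
    refine hSo.is_const_of_deriv_eq_zero hS.isPreconnected
      (fun w hw => (hd w hw).differentiableAt.differentiableWithinAt)
      (fun w hw => (hd w hw).deriv) hz hz₀
  refine ⟨fun z => q z - q z₀ + log (g z₀), fun z hz =>
    ((hq' z hz).differentiableAt.sub_const _ |>.add_const _).differentiableWithinAt, fun z hz => ?_⟩
  have := hconst z hz
  rw [exp_add, exp_sub, exp_log (h0 z₀ hz₀)]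
  rw [exp_neg, exp_neg] at this
  have e1 := exp_ne_zero (q z)
  have e2 := exp_ne_zero (q z₀)
  field_simp at this ⊢
  linear_combination -this

lemma norm_le_abs_re_add_abs_im (z : ℂ) : ‖z‖ ≤ |z.re| + |z.im| := Complex.norm_le_abs_re_add_abs_im z

/-- A holomorphic even function on a strip that tends to `1` at infinity and does not vanish has an
even logarithm that tends to zero. -/
lemma exists_even_log {δ η C : ℝ} (hη : 0 < η) (hηδ : η < δ) {g : ℂ → ℂ}
    (hg : DifferentiableOn ℂ g (strip δ)) (h0 : ∀ z ∈ strip δ, g z ≠ 0)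
    (heven : ∀ z, g (-z) = g z)
    (hb : ∀ z ∈ strip δ, ‖g z - 1‖ ≤ C * (1 + ‖z‖) ^ (-1 : ℝ)) :
    ∃ q : ℂ → ℂ, DifferentiableOn ℂ q (strip δ) ∧ (∀ z ∈ strip δ, exp (q z) = g z) ∧
      (∀ z ∈ strip δ, q (-z) = q z) ∧
      ∃ D, ∀ z, |z.im| ≤ η → ‖q z‖ ≤ D * (1 + ‖z‖) ^ (-1 : ℝ) := by
  have hδ : 0 < δ := hη.trans hηδ
  have hz0 : (0 : ℂ) ∈ strip δ := by simpa [strip]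
  have hC : 0 ≤ C := by simpa using (norm_nonneg _).trans (hb 0 hz0)
  obtain ⟨q₀, hq₀, hexp⟩ := exists_log_of_convex (convex_strip δ) (isOpen_strip δ) hg h0
  -- The difference `q₀(-z) - q₀(z)` is a constant, and it is zero at the origin.
  have hev₀ : ∀ z ∈ strip δ, q₀ (-z) = q₀ z := by
    obtain ⟨n, hn⟩ := exists_eq_int_mul_of_exp_eq_one (convex_strip δ).isPreconnected
      (f := fun z => q₀ (-z) - q₀ z)
      ((hq₀.continuousOn.comp continuousOn_neg fun z hz => neg_mem_strip hz).sub hq₀.continuousOn)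
      fun z hz => by
        rw [exp_sub, hexp z hz, hexp _ (neg_mem_strip hz), heven, div_self (h0 z hz)]
    have h1 := hn 0 hz0
    simp only [neg_zero, sub_self] at h1
    intro z hz
    exact sub_eq_zero.1 ((hn z hz).trans h1.symm)
  -- For `|Re z| ≥ 2C` the bound `C/(1 + ‖z‖)` is at most `1/2`, so `g` stays in a disc about `1`
  -- where the principal logarithm is available.
  set X : ℝ := 2 * C with hX
  have hsmall : ∀ z ∈ strip δ, X ≤ |z.re| → ‖g z - 1‖ ≤ 1 / 2 := by
    intro z hz h
    refine (hb z hz).trans ?_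
    rw [Real.rpow_neg_one, ← div_eq_mul_inv, div_le_iff₀ (by positivity)]
    linarith [abs_re_le_norm z]
  have hslit : ∀ z ∈ strip δ, X ≤ |z.re| → g z ∈ slitPlane := by
    intro z hz h
    have h1 := (abs_re_le_norm (g z - 1)).trans (hsmall z hz h)
    rw [sub_re, one_re, abs_le] at h1
    exact Or.inl (by linarith)
  have hconv : IsPreconnected (strip δ ∩ {z | X < z.re}) :=
    ((convex_strip δ).inter (convex_halfSpace_re_gt X)).isPreconnected
  -- At the right end `q₀` is the principal logarithm shifted by `2πin`. Removing this shift makes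
  -- the logarithm decay there, and by evenness at the left end too.
  obtain ⟨n, hn⟩ := exists_eq_int_mul_of_exp_eq_one hconv (f := fun z => q₀ z - log (g z))
    ((hq₀.continuousOn.mono inter_subset_left).sub
      ((hg.continuousOn.mono inter_subset_left).clog fun z hz =>
        hslit z hz.1 ((le_of_lt hz.2).trans (le_abs_self _))))
    fun z hz => by rw [exp_sub, hexp z hz.1, exp_log (h0 z hz.1), div_self (h0 z hz.1)]
  have hq : DifferentiableOn ℂ (fun z => q₀ z - n * (2 * Real.pi * I)) (strip δ) :=
    hq₀.sub_const _
  have hev : ∀ z ∈ strip δ, q₀ (-z) - n * (2 * Real.pi * I) = q₀ z - n * (2 * Real.pi * I) :=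
    fun z hz => by rw [hev₀ z hz]
  have hlog : ∀ z ∈ strip δ, X < z.re →
      ‖q₀ z - n * (2 * Real.pi * I)‖ ≤ 3 / 2 * C * (1 + ‖z‖) ^ (-1 : ℝ) := by
    intro z hz h
    have e : q₀ z - n * (2 * Real.pi * I) = log (1 + (g z - 1)) := by
      rw [← hn z ⟨hz, h⟩]; simp
    rw [e, mul_assoc]
    exact (norm_log_one_add_half_le_self (hsmall z hz (h.le.trans (le_abs_self _)))).trans
      (by gcongr; exact hb z hz)
  have hcomp : IsCompact {z : ℂ | |z.re| ≤ X ∧ |z.im| ≤ η} := by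
    refine Metric.isCompact_of_isClosed_isBounded ?_ ?_
    · exact (isClosed_le (continuous_abs.comp continuous_re) continuous_const).inter
        (isClosed_le (continuous_abs.comp continuous_im) continuous_const)
    · refine (Metric.isBounded_closedBall (x := (0 : ℂ)) (r := X + η)).subset fun z hz => ?_
      simp only [Metric.mem_closedBall, dist_zero_right]
      exact (norm_le_abs_re_add_abs_im z).trans (add_le_add hz.1 hz.2)
  have hcont : ContinuousOn (fun z => ‖q₀ z - n * (2 * Real.pi * I)‖ * (1 + ‖z‖))
      {z : ℂ | |z.re| ≤ X ∧ |z.im| ≤ η} :=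
    (hq.continuousOn.mono fun z hz => lt_of_le_of_lt hz.2 hηδ).norm.mul (by fun_prop)
  obtain ⟨B, hB⟩ := hcomp.exists_bound_of_continuousOn hcont
  refine ⟨fun z => q₀ z - n * (2 * Real.pi * I), hq, fun z hz => ?_, hev, max B (3 / 2 * C),
    fun z hz => ?_⟩
  · rw [exp_sub, hexp z hz, exp_int_mul_two_pi_mul_I, div_one]
  · have hzs : z ∈ strip δ := lt_of_le_of_lt hz hηδ
    by_cases h : |z.re| ≤ X
    · have h1 := hB z ⟨h, hz⟩
      rw [Real.norm_of_nonneg (by positivity)] at h1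
      rw [Real.rpow_neg_one, ← div_eq_mul_inv, le_div_iff₀ (by positivity)]
      exact h1.trans (le_max_left _ _)
    · have h2 : ‖q₀ z - n * (2 * Real.pi * I)‖ ≤ 3 / 2 * C * (1 + ‖z‖) ^ (-1 : ℝ) := by
        rw [not_le, lt_abs] at h
        rcases h with h | h
        · exact hlog z hzs h
        · have := hlog (-z) (neg_mem_strip hzs) (by simpa using h)
          rwa [hev z hzs, norm_neg] at this
      exact h2.trans (by gcongr; exact le_max_right _ _)

/-- The Cauchy integral `∫ ψ(t) / (t - z) dt`. -/
noncomputable def cauchyTransform (ψ : ℝ → ℂ) (z : ℂ) : ℂ := ∫ t : ℝ, ψ t / (t - z)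

lemma integrable_div_sub {ψ : ℝ → ℂ} {C α : ℝ} (hα : 0 < α) (hψ : AEStronglyMeasurable ψ)
    (hb : ∀ t, ‖ψ t‖ ≤ C * (1 + |t|) ^ (-α)) {z : ℂ} (hz : z.im ≠ 0) :
    Integrable fun t : ℝ => ψ t / (t - z) := by
  have hC : 0 ≤ C := by simpa using (norm_nonneg _).trans (hb 0)
  refine integrable_of_norm_le_rpow (p := α + 1) (C := C * (1 + (1 + ‖z‖) / |z.im|)) (by linarith)
    ?_ fun t => ?_
  · refine hψ.mul (Continuous.aestronglyMeasurable ?_)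
    exact Continuous.inv₀ (by fun_prop) (ofReal_sub_ne_zero hz)
  · have h1 := norm_inv_sub_le (abs_pos.2 hz) (abs_im_le_norm_ofReal_sub t z)
    have : -(α + 1) = -α + -1 := by ring
    rw [norm_div, div_eq_mul_inv, this, Real.rpow_add (by positivity)]
    have := mul_le_mul (hb t) h1 (by positivity) (by positivity)
    rw [norm_real, Real.norm_eq_abs] at this
    exact this.trans_eq (by ring)

lemma differentiableAt_cauchyTransform {ψ : ℝ → ℂ} {C α : ℝ} (hα : 0 < α)
    (hψ : AEStronglyMeasurable ψ) (hb : ∀ t, ‖ψ t‖ ≤ C * (1 + |t|) ^ (-α)) {z : ℂ}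
    (hz : z.im ≠ 0) : DifferentiableAt ℂ (cauchyTransform ψ) z := by
  set r := |z.im| / 2 with hr
  have hr0 : 0 < r := by positivity
  have hge : ∀ w ∈ Metric.ball z r, ∀ t : ℝ, ‖(t : ℂ) - z‖ / 2 ≤ ‖(t : ℂ) - w‖ := by
    intro w hw t
    rw [Metric.mem_ball, dist_eq_norm] at hw
    have h1 := abs_im_le_norm_ofReal_sub t z
    have h2 : ‖(t : ℂ) - z‖ ≤ ‖(t : ℂ) - w‖ + ‖w - z‖ := by
      simpa using norm_add_le ((t : ℂ) - w) (w - z)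
    linarith
  have hpos : ∀ t : ℝ, 0 < ‖(t : ℂ) - z‖ := fun t => norm_pos_iff.2 (ofReal_sub_ne_zero hz t)
  have hint := (integrable_div_sub hα hψ hb hz).norm.const_mul (4 / |z.im|)
  have hne : ∀ w ∈ Metric.ball z r, ∀ t : ℝ, (t : ℂ) - w ≠ 0 := fun w hw t => by
    rw [← norm_pos_iff]
    exact lt_of_lt_of_le (half_pos (hpos t)) (hge w hw t)
  have hmeas : ∀ w ∈ Metric.ball z r, AEStronglyMeasurable fun t : ℝ => ψ t / ((t : ℂ) - w) :=
    fun w hw => hψ.mul (Continuous.inv₀ (by fun_prop) (hne w hw)).aestronglyMeasurable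
  have key := hasDerivAt_integral_of_dominated_loc_of_deriv_le (μ := volume)
    (F := fun w (t : ℝ) => ψ t / ((t : ℂ) - w)) (F' := fun w (t : ℝ) => ψ t / ((t : ℂ) - w) ^ 2)
    (x₀ := z) (Metric.ball_mem_nhds z hr0)
    (mem_of_superset (Metric.ball_mem_nhds z hr0) hmeas)
    (integrable_div_sub hα hψ hb hz)
    (hψ.mul (Continuous.inv₀ (by fun_prop) fun t => pow_ne_zero 2
      (ofReal_sub_ne_zero hz t)).aestronglyMeasurable)
    (Eventually.of_forall fun t w hw => ?_) hint (Eventually.of_forall fun t w hw => ?_)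
  · exact key.2.differentiableAt
  · have h1 := hge w hw t
    have h2 := abs_im_le_norm_ofReal_sub t z
    have h3 := hpos t
    rw [norm_div, norm_div, norm_pow, div_mul_div_comm, mul_comm, ← mul_div_assoc', mul_comm]
    have h4 : |z.im| * ‖(t : ℂ) - z‖ / 4 ≤ ‖(t : ℂ) - w‖ ^ 2 := by
      have h5 : (‖(t : ℂ) - z‖ / 2) ^ 2 ≤ ‖(t : ℂ) - w‖ ^ 2 := by gcongr
      nlinarith
    have h6 : 0 < |z.im| * ‖(t : ℂ) - z‖ := by positivity
    rw [div_le_iff₀ (pow_pos (norm_pos_iff.2 (hne w hw t)) 2)]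
    have : 4 / (|z.im| * ‖(t : ℂ) - z‖) * ‖ψ t‖ * (|z.im| * ‖(t : ℂ) - z‖ / 4) = ‖ψ t‖ := by
      field_simp
    calc ‖ψ t‖ = 4 / (|z.im| * ‖(t : ℂ) - z‖) * ‖ψ t‖ * (|z.im| * ‖(t : ℂ) - z‖ / 4) := this.symm
      _ ≤ 4 / (|z.im| * ‖(t : ℂ) - z‖) * ‖ψ t‖ * ‖(t : ℂ) - w‖ ^ 2 := by gcongr
      _ = _ := by ring
  · have h1 := hne w hw t
    have := ((hasDerivAt_const w (ψ t)).div ((hasDerivAt_id w).const_sub (t : ℂ)) h1)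
    simpa using! this

/-- From `1 + ‖z‖ ≤ (1 + |t|)(1 + ‖t - z‖)` one peels off the power `1/4` of both factors. The
arithmetic–geometric mean inequality turns the remaining product of powers `3/4` into a sum of
powers `3/2`, whose integrals do not depend on `z`. Any positive decay rate is enough. -/
lemma exists_norm_cauchyTransform_le {ψ : ℝ → ℂ} {C : ℝ}
    (hb : ∀ t, ‖ψ t‖ ≤ C * (1 + |t|) ^ (-1 : ℝ)) {r : ℝ} (hr : 0 < r) :
    ∃ D, ∀ z : ℂ, r ≤ z.im → ‖cauchyTransform ψ z‖ ≤ D * (1 + ‖z‖) ^ (-(1 / 4) : ℝ) := by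
  have hC : 0 ≤ C := by simpa using (norm_nonneg _).trans (hb 0)
  have hint : Integrable fun t : ℝ => (1 + |t|) ^ (-(3 / 2) : ℝ) :=
    integrable_one_add_norm (by norm_num)
  refine ⟨C * (1 + 1 / r) * ∫ t : ℝ, (1 + |t|) ^ (-(3 / 2) : ℝ), fun z hz => ?_⟩
  have hint2 : Integrable fun t : ℝ => (1 + |t - z.re|) ^ (-(3 / 2) : ℝ) := hint.comp_sub_right z.re
  have hI2 : ∫ t : ℝ, (1 + |t - z.re|) ^ (-(3 / 2) : ℝ) = ∫ t : ℝ, (1 + |t|) ^ (-(3 / 2) : ℝ) :=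
    integral_sub_right_eq_self (fun t : ℝ => (1 + |t|) ^ (-(3 / 2) : ℝ)) z.re
  have hle : ∀ t : ℝ, ‖ψ t / (t - z)‖ ≤ C * (1 + 1 / r) * (1 + ‖z‖) ^ (-(1 / 4) : ℝ) / 2 *
      ((1 + |t|) ^ (-(3 / 2) : ℝ) + (1 + |t - z.re|) ^ (-(3 / 2) : ℝ)) := by
    intro t
    set m := ‖(t : ℂ) - z‖ with hm
    have h1 : r ≤ m := by
      have := abs_im_le_norm_ofReal_sub t z
      have := le_abs_self z.im
      linarith
    have hm0 : 0 < m := hr.trans_le h1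
    have h2 : m⁻¹ ≤ (1 + 1 / r) * (1 + m) ^ (-1 : ℝ) := by
      rw [Real.rpow_neg_one, ← div_eq_mul_inv, le_div_iff₀ (by positivity), inv_mul_le_iff₀ hm0]
      have : 1 ≤ m * (1 / r) := by rw [mul_one_div, le_div_iff₀ hr]; linarith
      linarith
    have h3 : |t - z.re| ≤ m := by simpa using abs_re_le_norm ((t : ℂ) - z)
    have h4 : 1 + ‖z‖ ≤ (1 + |t|) * (1 + m) := by
      have : ‖z‖ ≤ |t| + m := by
        have := norm_sub_le (t : ℂ) ((t : ℂ) - z)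
        simpa using this
      nlinarith [abs_nonneg t]
    set a := (1 + |t|) with ha
    set b := (1 + m) with hbdef
    have ha0 : 0 < a := by positivity
    have hb0 : 0 < b := by positivity
    have h5 : (a * b) ^ (-(1 / 4) : ℝ) ≤ (1 + ‖z‖) ^ (-(1 / 4) : ℝ) :=
      Real.rpow_le_rpow_of_nonpos (by positivity) h4 (by norm_num)
    have h6 : a ^ (-1 : ℝ) * b ^ (-1 : ℝ) =
        (a * b) ^ (-(1 / 4) : ℝ) * (a ^ (-(3 / 4) : ℝ) * b ^ (-(3 / 4) : ℝ)) := by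
      rw [← Real.mul_rpow ha0.le hb0.le, ← Real.mul_rpow ha0.le hb0.le, ← Real.rpow_add (by positivity)]
      norm_num
    have h7 : a ^ (-(3 / 4) : ℝ) * b ^ (-(3 / 4) : ℝ) ≤
        (a ^ (-(3 / 2) : ℝ) + b ^ (-(3 / 2) : ℝ)) / 2 := by
      have e : ∀ x : ℝ, 0 < x → x ^ (-(3 / 2) : ℝ) = (x ^ (-(3 / 4) : ℝ)) ^ 2 := by
        intro x hx
        rw [← Real.rpow_natCast, ← Real.rpow_mul hx.le]; norm_num
      rw [e a ha0, e b hb0]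
      nlinarith [sq_nonneg (a ^ (-(3 / 4) : ℝ) - b ^ (-(3 / 4) : ℝ))]
    have h8 : b ^ (-(3 / 2) : ℝ) ≤ (1 + |t - z.re|) ^ (-(3 / 2) : ℝ) :=
      Real.rpow_le_rpow_of_nonpos (by positivity) (by linarith) (by norm_num)
    rw [norm_div, div_eq_mul_inv]
    calc ‖ψ t‖ * m⁻¹ ≤ C * a ^ (-1 : ℝ) * ((1 + 1 / r) * b ^ (-1 : ℝ)) :=
          mul_le_mul (hb t) h2 (by positivity) (by positivity)
      _ = C * (1 + 1 / r) * (a ^ (-1 : ℝ) * b ^ (-1 : ℝ)) := by ring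
      _ = C * (1 + 1 / r) * ((a * b) ^ (-(1 / 4) : ℝ) *
            (a ^ (-(3 / 4) : ℝ) * b ^ (-(3 / 4) : ℝ))) := by rw [h6]
      _ ≤ C * (1 + 1 / r) * ((1 + ‖z‖) ^ (-(1 / 4) : ℝ) *
            ((a ^ (-(3 / 2) : ℝ) + (1 + |t - z.re|) ^ (-(3 / 2) : ℝ)) / 2)) := by
          gcongr
          exact h7.trans (by linarith)
      _ = _ := by ring
  refine (norm_integral_le_of_norm_le ((hint.add hint2).const_mul _)
    (Eventually.of_forall hle)).trans_eq ?_
  rw [integral_const_mul]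
  simp only [Pi.add_apply]
  rw [integral_add hint hint2, hI2]
  ring

end HalfPlane

/-! ### Additive splitting, and the square root on the strip. -/

namespace HalfPlane

open Complex

/-- An even holomorphic function on a strip that decays at infinity is the sum of a function
holomorphic above the strip and its reflection. -/
lemma exists_additive_splitting {δ η C : ℝ} (hη : 0 < η) (hηδ : η < δ) {q : ℂ → ℂ}
    (hq : DifferentiableOn ℂ q (strip δ)) (heven : ∀ z ∈ strip δ, q (-z) = q z)
    (hb : ∀ z, |z.im| ≤ η → ‖q z‖ ≤ C * (1 + ‖z‖) ^ (-1 : ℝ)) :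
    ∃ p : ℂ → ℂ, DifferentiableOn ℂ p {z | -η < z.im} ∧
      (∃ D, ∀ z : ℂ, -(η / 2) ≤ z.im → ‖p z‖ ≤ D * (1 + ‖z‖) ^ (-(1 / 4) : ℝ)) ∧
      ∀ z ∈ strip η, q z = p z + p (-z) := by
  have hC : 0 ≤ C := by simpa using (norm_nonneg _).trans (hb 0 (by simpa using hη.le))
  have hpi : (Real.pi : ℂ) ≠ 0 := by exact_mod_cast Real.pi_ne_zero
  have hclosed : {z : ℂ | -η ≤ z.im ∧ z.im ≤ η} ⊆ strip δ := fun z hz =>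
    lt_of_le_of_lt (abs_le.2 hz) hηδ
  set ψ : ℝ → ℂ := fun t => q (t - η * I) with hψ
  have hline : ∀ y : ℝ, |y| ≤ η → Continuous fun t : ℝ => q (t + y * I) := fun y hy =>
    continuous_horizontal hq.continuousOn fun x => by simpa [strip] using lt_of_le_of_lt hy hηδ
  have hψc : Continuous ψ := by
    have := hline (-η) (by simp [abs_of_pos hη])
    simpa [hψ, sub_eq_add_neg] using this
  have hψb : ∀ t, ‖ψ t‖ ≤ C * (1 + |t|) ^ (-1 : ℝ) := by
    intro t
    refine (hb _ (by simp [abs_of_pos hη])).trans (mul_le_mul_of_nonneg_left ?_ hC)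
    simpa using rpow_neg_le_abs_re (z := (t : ℂ) - η * I) (p := 1) zero_le_one
  -- This is the Cauchy integral of `q` along `Im = -η`. Because `q` is even, the contribution of
  -- the upper edge is the same function evaluated at `-z`.
  refine ⟨fun z => (2 * Real.pi * I)⁻¹ * cauchyTransform ψ (z + η * I), ?_, ?_, ?_⟩
  · intro z hz
    have him : (z + η * I).im ≠ 0 := by
      have : -η < z.im := hz
      simp; linarith
    have h1 := differentiableAt_cauchyTransform one_pos hψc.aestronglyMeasurable hψb him
    exact (h1.comp z (differentiableAt_id.add_const _)).const_mul _ |>.differentiableWithinAt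
  · obtain ⟨D, hD⟩ := exists_norm_cauchyTransform_le hψb (half_pos hη)
    have hD0 : 0 ≤ D := by
      have := (norm_nonneg _).trans (hD ((η / 2 : ℝ) * I) (by simp))
      exact nonneg_of_mul_nonneg_left this (by positivity)
    refine ⟨‖(2 * Real.pi * I : ℂ)⁻¹‖ * (D * (1 + η) ^ (1 / 4 : ℝ)), fun z hz => ?_⟩
    have h1 := hD (z + η * I) (by simp; linarith)
    have h2 : 1 + ‖z‖ ≤ (1 + η) * (1 + ‖z + η * I‖) := by
      have : ‖z‖ ≤ ‖z + η * I‖ + η := by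
        have := norm_sub_le (z + η * I) (η * I)
        simpa [abs_of_pos hη] using this
      nlinarith [norm_nonneg (z + η * I)]
    have h3 : (1 + ‖z + η * I‖) ^ (-(1 / 4) : ℝ) ≤
        (1 + η) ^ (1 / 4 : ℝ) * (1 + ‖z‖) ^ (-(1 / 4) : ℝ) := by
      rw [Real.rpow_neg (by positivity), Real.rpow_neg (by positivity), ← div_eq_mul_inv,
        le_div_iff₀ (by positivity), inv_mul_le_iff₀ (by positivity), mul_comm,
        ← Real.mul_rpow (by positivity) (by positivity)]
      exact Real.rpow_le_rpow (by positivity) h2 (by norm_num)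
    rw [norm_mul]
    refine (mul_le_mul_of_nonneg_left (h1.trans (mul_le_mul_of_nonneg_left h3 hD0))
      (norm_nonneg _)).trans_eq ?_
    ring
  · intro z hz
    have hz' := abs_lt.1 (show |z.im| < η from hz)
    have hzδ : z ∈ strip δ := strip_mono hηδ.le hz
    -- An auxiliary pole below the strip. Seen from the lower edge, `z` lies above and `w` below,
    -- which gives `2πi`; seen from the upper edge both lie below, which gives `0`. The difference
    -- of the two edges produces `2πi q(z)`.
    set w : ℂ := (-(2 * η) : ℝ) * I with hw
    have hwre : w.re = 0 := by simp [hw]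
    have hwim : w.im = -(2 * η) := by simp [hw]
    have hne : ∀ ζ : ℂ, -η ≤ ζ.im → ζ - w ≠ 0 := by
      intro ζ hζ h
      have := congrArg im h
      simp [hwim] at this; linarith
    set g : ℂ → ℂ := fun ζ => q ζ - q z * ((z - w) / (ζ - w)) with hg
    set S : Set ℂ := {ζ : ℂ | -η ≤ ζ.im ∧ ζ.im ≤ η} with hS
    set U : Set ℂ := {ζ : ℂ | -η < ζ.im ∧ ζ.im < η} with hU
    have hUo : IsOpen U := (isOpen_im_gt _).inter (isOpen_im_lt _)
    have hUS : U ⊆ S := fun ζ hζ => ⟨hζ.1.le, hζ.2.le⟩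
    have hgS : DifferentiableOn ℂ g S := by
      refine (hq.mono hclosed).sub fun ζ hζ => ?_
      have := hne ζ hζ.1
      exact (by fun_prop (disch := assumption) :
        DifferentiableAt ℂ (fun ζ : ℂ => q z * ((z - w) / (ζ - w))) ζ).differentiableWithinAt
    have hgz : g z = 0 := by
      simp only [hg]; rw [div_self (hne z hz'.1.le)]; ring
    have hgb : ∀ ζ ∈ S, ‖g ζ‖ ≤ (C + ‖q z‖ * (‖z - w‖ * (1 + (1 + ‖w‖) / η))) *
        (1 + ‖ζ‖) ^ (-1 : ℝ) := by
      intro ζ hζ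
      have h1 := hb ζ (abs_le.2 hζ)
      have h2 := norm_inv_sub_le (z := w) (ζ := ζ) hη (by
        have := im_sub_im_le_norm_sub ζ w
        have := hζ.1
        linarith)
      refine (norm_sub_le _ _).trans ?_
      rw [norm_mul, norm_div, div_eq_mul_inv]
      calc _ ≤ C * (1 + ‖ζ‖) ^ (-1 : ℝ) +
          ‖q z‖ * (‖z - w‖ * ((1 + (1 + ‖w‖) / η) * (1 + ‖ζ‖) ^ (-1 : ℝ))) := by gcongr
        _ = _ := by ring
    have hSn : S ∈ 𝓝 z := mem_of_superset (hUo.mem_nhds hz') hUS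
    have hGc := continuousOn_dslope_of_isOpen hUo hz' hUS hgS.continuousOn (hgS.mono hUS)
    have hGd : DifferentiableOn ℂ (dslope g z) S := (differentiableOn_dslope hSn).2 hgS
    obtain ⟨D, hD⟩ := exists_norm_dslope_le hSn hGc hgb hgz
    have hDpos : 0 ≤ D := by
      have := (norm_nonneg _).trans (hD z (mem_of_mem_nhds hSn))
      exact nonneg_of_mul_nonneg_left this (by positivity)
    have hDre : ∀ ζ : ℂ, -η ≤ ζ.im → ζ.im ≤ η →
        ‖dslope g z ζ‖ ≤ D * (1 + |ζ.re|) ^ (-(1 + 1) : ℝ) := fun ζ h1 h2 =>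
      (hD ζ ⟨h1, h2⟩).trans (mul_le_mul_of_nonneg_left (rpow_neg_le_abs_re (by norm_num)) hDpos)
    have hG := integral_strip_eq (G := dslope g z) (p := 1 + 1) (by linarith : -η ≤ η)
      (by norm_num) hGc (hGd.mono hUS) hDre
    have hsplit : ∀ y : ℝ, |y| = η → ∫ t : ℝ, q (t + y * I) / (t + y * I - z) =
        (∫ t : ℝ, dslope g z (t + y * I)) +
          q z * ∫ t : ℝ, (((t : ℂ) - (z - y * I))⁻¹ - ((t : ℂ) - (w - y * I))⁻¹) := by
      intro y hy
      have hy2 := abs_le.1 hy.le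
      have him1 : (z - y * I).im ≠ 0 := by
        simp
        intro h
        rw [sub_eq_zero] at h
        have : |z.im| < η := hz
        rw [h, hy] at this
        exact lt_irrefl _ this
      have him2 : (w - y * I).im ≠ 0 := by
        simp [hwim]; linarith
      rw [← integral_const_mul, ← integral_add]
      · congr 1 with t
        have h1 := ofReal_sub_ne_zero him1 t
        have h2 := ofReal_sub_ne_zero him2 t
        have e1 : (t : ℂ) - (z - y * I) = t + y * I - z := by ring
        have e2 : (t : ℂ) - (w - y * I) = t + y * I - w := by ring
        rw [e1] at h1 ⊢
        rw [e2] at h2 ⊢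
        rw [dslope_of_ne _ (sub_ne_zero.1 h1), slope_def_field, hgz]
        simp only [hg]
        field_simp
        ring
      · refine integrable_of_norm_le_rpow (p := 1 + 1) (C := D) (by norm_num) ?_ fun t => ?_
        · exact (continuous_horizontal hGc fun x => by simpa [hS] using hy2).aestronglyMeasurable
        · simpa using hDre (t + y * I) (by simpa using hy2.1) (by simpa using hy2.2)
      · exact (integrable_inv_sub_sub_inv_sub him1 him2).const_mul _
    have h1 := hsplit (-η) (by simp [abs_of_pos hη])
    have h2 := hsplit η (abs_of_pos hη)
    rw [integral_inv_sub_sub_inv_sub (by simp; linarith) (by simp [hwim]; linarith)] at h1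
    rw [integral_inv_sub_sub_inv_sub_of_lower (by simp; linarith) (by simp [hwim]; linarith)] at h2
    have e1 : cauchyTransform ψ (z + η * I) =
        ∫ t : ℝ, q (t + (-η : ℝ) * I) / (t + (-η : ℝ) * I - z) := by
      rw [cauchyTransform]
      congr 1 with t
      simp only [hψ]
      push_cast
      ring_nf
    have e2 : cauchyTransform ψ (-z + η * I) = -∫ t : ℝ, q (t + η * I) / (t + η * I - z) := by
      rw [cauchyTransform, ← integral_neg_eq_self, ← integral_neg]
      congr 1 with t
      simp only [hψ]
      have e3 : (((-t : ℝ) : ℂ) - η * I) = -(t + η * I) := by push_cast; ring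
      have e4 : (((-t : ℝ) : ℂ) - (-z + η * I)) = -(t + η * I - z) := by push_cast; ring
      rw [e3, e4, heven _ (by simpa [strip, abs_of_pos hη] using hηδ), div_neg]
    simp only
    rw [e1, e2, h1, h2, hG]
    field_simp
    ring

/-- The branch of `log (-i (k + z))` that is holomorphic for `Im z > -Im k`. -/
noncomputable def shiftLog (k z : ℂ) : ℂ := log (-I * (k + z))

/-- The branch of `√(k² - z²)` with positive imaginary part on the strip `|Im z| < Im k`. -/
noncomputable def root (k z : ℂ) : ℂ := I * exp (1 / 2 * (shiftLog k z + shiftLog k (-z)))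

lemma re_neg_I_mul (k z : ℂ) : (-I * (k + z)).re = k.im + z.im := by simp

lemma re_neg_I_mul_pos {k z : ℂ} (h : -k.im < z.im) : 0 < (-I * (k + z)).re := by
  rw [re_neg_I_mul]; linarith

lemma neg_I_mul_ne_zero {k z : ℂ} (h : -k.im < z.im) : -I * (k + z) ≠ 0 := fun h0 => by
  have := re_neg_I_mul_pos h
  rw [h0] at this
  simp at this

lemma add_ne_zero_of_im {k z : ℂ} (h : -k.im < z.im) : k + z ≠ 0 := fun h0 => by
  have := neg_I_mul_ne_zero h
  simp [h0] at this

lemma differentiableOn_shiftLog (k : ℂ) : DifferentiableOn ℂ (shiftLog k) {z | -k.im < z.im} := by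
  refine DifferentiableOn.clog (by fun_prop) fun z hz => Or.inl (re_neg_I_mul_pos hz)

lemma exp_shiftLog {k z : ℂ} (h : -k.im < z.im) : exp (shiftLog k z) = -I * (k + z) :=
  exp_log (neg_I_mul_ne_zero h)

lemma shiftLog_re (k z : ℂ) : (shiftLog k z).re = Real.log ‖k + z‖ := by
  rw [shiftLog, log_re, norm_mul]; simp

lemma norm_exp_half_shiftLog {k z : ℂ} (h : -k.im < z.im) :
    ‖exp (1 / 2 * shiftLog k z)‖ = ‖k + z‖ ^ (1 / 2 : ℝ) := by
  have : (1 / 2 * shiftLog k z).re = Real.log ‖k + z‖ * (1 / 2) := by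
    rw [← shiftLog_re, mul_comm]
    simp
  rw [norm_exp, this, Real.rpow_def_of_pos (norm_pos_iff.2 (add_ne_zero_of_im h))]

lemma strip_subset_upper (k : ℂ) {z : ℂ} (hz : z ∈ strip k.im) :
    -k.im < z.im ∧ -k.im < (-z).im := by
  have := abs_lt.1 (show |z.im| < k.im from hz)
  simpa using this

lemma root_sq {k z : ℂ} (hz : z ∈ strip k.im) : root k z ^ 2 = k ^ 2 - z ^ 2 := by
  obtain ⟨h1, h2⟩ := strip_subset_upper k hz
  rw [root, mul_pow, ← exp_nat_mul]
  have : ((2 : ℕ) : ℂ) * (1 / 2 * (shiftLog k z + shiftLog k (-z))) =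
      shiftLog k z + shiftLog k (-z) := by push_cast; ring
  rw [this, exp_add, exp_shiftLog h1, exp_shiftLog h2]
  ring_nf
  simp only [I_pow_four]
  ring

/-- Both `-i(k ± z)` lie in the right half-plane, so the mean of their arguments lies in `(-π/2,
π/2)` and the exponential in `root` has positive real part; the prefactor `I` makes it an imaginary
part. -/
lemma root_im_pos {k z : ℂ} (hz : z ∈ strip k.im) : 0 < (root k z).im := by
  obtain ⟨h1, h2⟩ := strip_subset_upper k hz
  have a1 := abs_lt.1 (abs_arg_lt_pi_div_two_iff.2 (Or.inl (re_neg_I_mul_pos h1)))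
  have a2 := abs_lt.1 (abs_arg_lt_pi_div_two_iff.2 (Or.inl (re_neg_I_mul_pos h2)))
  rw [← log_im, ← shiftLog] at a1 a2
  have him : (1 / 2 * (shiftLog k z + shiftLog k (-z))).im =
      1 / 2 * ((shiftLog k z).im + (shiftLog k (-z)).im) := by
    simp
  have : (root k z).im = (exp (1 / 2 * (shiftLog k z + shiftLog k (-z)))).re := by simp [root]
  rw [this, exp_re, him]
  refine mul_pos (Real.exp_pos _) (Real.cos_pos_of_mem_Ioo ⟨?_, ?_⟩) <;> linarith

lemma root_ne_zero (k z : ℂ) : root k z ≠ 0 := mul_ne_zero I_ne_zero (exp_ne_zero _)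

lemma root_neg (k z : ℂ) : root k (-z) = root k z := by rw [root, root, neg_neg, add_comm]

lemma differentiableOn_root (k : ℂ) : DifferentiableOn ℂ (root k) (strip k.im) := by
  have h1 : DifferentiableOn ℂ (shiftLog k) (strip k.im) :=
    (differentiableOn_shiftLog k).mono fun z hz => (strip_subset_upper k hz).1
  have h2 : DifferentiableOn ℂ (fun z => shiftLog k (-z)) (strip k.im) :=
    (differentiableOn_shiftLog k).comp differentiable_neg.differentiableOn
      fun z hz => (strip_subset_upper k hz).2
  exact ((h1.add h2).const_mul _).cexp.const_mul _

lemma ofReal_mem_strip {δ : ℝ} (hδ : 0 < δ) (x : ℝ) : (x : ℂ) ∈ strip δ := by simpa [strip]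

lemma symbolP_eq {k : ℂ} (hre : 0 < k.re) (him : 0 < k.im) (ς : ℂ) (ξ : ℝ) :
    symbolP k ς ξ = 1 + ς / (2 * k) * root k ξ := by
  have hx := ofReal_mem_strip him ξ
  have h0 := root_ne_zero k ξ
  have hk : k ≠ 0 := fun h => by simp [h] at hre
  rw [symbolP, kernelHat_eq hre him (root_sq hx) (root_im_pos hx), ← root_sq hx]
  field_simp
  ring_nf
  rw [I_sq]
  ring

/-- A zero satisfies `z² = k² - 1/s²`, so there are at most two, `±z₀`. Either they are real, and
then excluded by assumption, or a strip narrower than `|Im z₀|` avoids them. -/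
lemma exists_strip_ne_zero {k s : ℂ} (him : 0 < k.im)
    (h : ∀ ξ : ℝ, 1 + s * root k ξ ≠ 0) :
    ∃ δ, 0 < δ ∧ δ ≤ k.im ∧ ∀ z ∈ strip δ, 1 + s * root k z ≠ 0 := by
  obtain ⟨z₀, hz₀⟩ := IsAlgClosed.exists_pow_nat_eq (k ^ 2 - (1 / s) ^ 2) (n := 2) two_pos
  have key : ∀ z ∈ strip k.im, 1 + s * root k z = 0 → z = z₀ ∨ z = -z₀ := by
    intro z hz h0
    rw [← sq_eq_sq_iff_eq_or_eq_neg, hz₀]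
    have hs : s ≠ 0 := fun h => by simp [h] at h0
    have h1 : root k z = -(1 / s) := by field_simp; linear_combination h0
    have := root_sq hz
    rw [h1, neg_sq] at this
    linear_combination this
  by_cases hreal : z₀.im = 0
  · have hz₀' : z₀ = (z₀.re : ℂ) := Complex.ext rfl (by simpa using hreal)
    refine ⟨k.im, him, le_rfl, fun z hz h0 => ?_⟩
    rcases key z hz h0 with rfl | rfl
    · rw [hz₀'] at h0
      exact h _ h0
    · rw [root_neg, hz₀'] at h0
      exact h _ h0
  · refine ⟨min k.im |z₀.im|, lt_min him (abs_pos.2 hreal), min_le_left _ _, fun z hz h0 => ?_⟩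
    have h1 : |z.im| < |z₀.im| := lt_of_lt_of_le hz (min_le_right _ _)
    rcases key z (strip_mono (min_le_left _ _) hz) h0 with rfl | rfl
    · exact lt_irrefl _ h1
    · simp at h1

end HalfPlane

/-! ### Growth of the factors, and the multiplicative splitting of the symbol. -/

namespace HalfPlane

open Complex

lemma one_add_norm_le_mul_norm_add {k : ℂ} (him : 0 < k.im) {z : ℂ} (hz : -(k.im / 2) ≤ z.im) :
    1 + ‖z‖ ≤ (1 + (1 + ‖k‖) / (k.im / 2)) * ‖k + z‖ := by
  have h := one_add_norm_le_mul_norm_sub (z := -k) (ζ := z) (half_pos him) (by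
    have := im_sub_im_le_norm_sub z (-k)
    rw [neg_im] at this
    linarith)
  rwa [norm_neg, sub_neg_eq_add, add_comm z] at h

lemma norm_add_le_mul_one_add_norm (k z : ℂ) : ‖k + z‖ ≤ (1 + ‖k‖) * (1 + ‖z‖) := by
  have := norm_add_le k z
  nlinarith [norm_nonneg k, norm_nonneg z]

lemma norm_inv_root_le {k : ℂ} (him : 0 < k.im) {z : ℂ} (hz : |z.im| ≤ k.im / 2) :
    ‖(root k z)⁻¹‖ ≤ (1 + (1 + ‖k‖) / (k.im / 2)) * (1 + ‖z‖) ^ (-1 : ℝ) := by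
  set B := 1 + (1 + ‖k‖) / (k.im / 2) with hB
  have hB0 : 0 < B := by positivity
  have hz2 := abs_le.1 hz
  have h1 := one_add_norm_le_mul_norm_add him hz2.1
  have h2 := one_add_norm_le_mul_norm_add him (z := -z) (by simpa using hz2.2)
  rw [norm_neg] at h2
  have hsq : ‖root k z‖ ^ 2 = ‖k + z‖ * ‖k + -z‖ := by
    rw [← norm_pow, root_sq (lt_of_le_of_lt hz (by linarith)), ← norm_mul]
    ring_nf
  have h3 : (1 + ‖z‖) ^ 2 ≤ (B * ‖root k z‖) ^ 2 := by
    rw [mul_pow, hsq]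
    calc (1 + ‖z‖) ^ 2 = (1 + ‖z‖) * (1 + ‖z‖) := sq _
      _ ≤ (B * ‖k + z‖) * (B * ‖k + -z‖) := mul_le_mul h1 h2 (by positivity) (by positivity)
      _ = _ := by ring
  have h4 : 1 + ‖z‖ ≤ B * ‖root k z‖ := le_of_sq_le_sq h3 (by positivity)
  have h5 : 0 < ‖root k z‖ := norm_pos_iff.2 (root_ne_zero k z)
  rw [norm_inv, Real.rpow_neg_one, ← div_eq_mul_inv, le_div_iff₀ (by positivity),
    inv_mul_le_iff₀ h5, mul_comm]
  exact h4

/-- The modulus of the exponential is `‖k + z‖^{1/2}`, comparable with `(1 + ‖z‖)^{1/2}` at a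
distance from `-k`. For the logarithm itself the crude bound by a square root suffices, since only
integrability against `|x|⁻²` and decay after division by `z` are asked of it. -/
lemma exp_half_shiftLog_bounds {k : ℂ} (him : 0 < k.im) :
    ∃ C, ∀ z : ℂ, -(k.im / 2) ≤ z.im →
      ‖exp (1 / 2 * shiftLog k z)‖ ≤ C * (1 + ‖z‖) ^ (1 / 2 : ℝ) ∧
      ‖exp (-(1 / 2 * shiftLog k z))‖ ≤ C * (1 + ‖z‖) ^ (-(1 / 2) : ℝ) ∧
      ‖shiftLog k z‖ ≤ C * (1 + ‖z‖) ^ (1 / 2 : ℝ) := by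
  set B := 1 + (1 + ‖k‖) / (k.im / 2) with hB
  have hB0 : 0 < B := by positivity
  set A := (1 + ‖k‖) ^ (1 / 2 : ℝ) with hA
  have hA0 : 0 < A := by positivity
  have hB' : 0 < B ^ (1 / 2 : ℝ) := by positivity
  have hlog0 := abs_nonneg (Real.log B)
  refine ⟨2 * A + B ^ (1 / 2 : ℝ) + |Real.log B| + Real.pi, fun z hz => ?_⟩
  have hz' : -k.im < z.im := by linarith
  have hpos : 0 < ‖k + z‖ := norm_pos_iff.2 (add_ne_zero_of_im hz')
  have h1 := one_add_norm_le_mul_norm_add him hz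
  have h2 : ‖k + z‖ ^ (1 / 2 : ℝ) ≤ A * (1 + ‖z‖) ^ (1 / 2 : ℝ) := by
    rw [hA, ← Real.mul_rpow (by positivity) (by positivity)]
    exact Real.rpow_le_rpow hpos.le (norm_add_le_mul_one_add_norm k z) (by norm_num)
  have h3 : (1 + ‖z‖) ^ (1 / 2 : ℝ) ≤ B ^ (1 / 2 : ℝ) * ‖k + z‖ ^ (1 / 2 : ℝ) := by
    rw [← Real.mul_rpow (by positivity) (by positivity)]
    exact Real.rpow_le_rpow (by positivity) h1 (by norm_num)
  have hone : 1 ≤ (1 + ‖z‖) ^ (1 / 2 : ℝ) :=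
    Real.one_le_rpow (by linarith [norm_nonneg z]) (by norm_num)
  have hpi := Real.pi_pos
  refine ⟨?_, ?_, ?_⟩
  · rw [norm_exp_half_shiftLog hz']
    refine h2.trans ?_
    gcongr
    linarith
  · rw [exp_neg, norm_inv, norm_exp_half_shiftLog hz', Real.rpow_neg (by positivity)]
    have h4 : 0 < ‖k + z‖ ^ (1 / 2 : ℝ) := by positivity
    have h5 : (‖k + z‖ ^ (1 / 2 : ℝ))⁻¹ ≤ B ^ (1 / 2 : ℝ) * ((1 + ‖z‖) ^ (1 / 2 : ℝ))⁻¹ := by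
      rw [← div_eq_mul_inv, le_div_iff₀ (by positivity), inv_mul_le_iff₀ h4, mul_comm]
      exact h3
    refine h5.trans ?_
    gcongr
    linarith
  · have hre : |(shiftLog k z).re| ≤ 2 * A * (1 + ‖z‖) ^ (1 / 2 : ℝ) + |Real.log B| := by
      rw [shiftLog_re, abs_le]
      constructor
      · have h6 : 1 / B ≤ ‖k + z‖ := by
          rw [div_le_iff₀ hB0, mul_comm]
          exact (le_add_of_nonneg_right (norm_nonneg z)).trans h1
        have h7 := Real.log_le_log (by positivity) h6
        rw [one_div, Real.log_inv] at h7
        have := le_abs_self (Real.log B)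
        have : 0 ≤ 2 * A * (1 + ‖z‖) ^ (1 / 2 : ℝ) := by positivity
        linarith
      · have := Real.log_le_rpow_div hpos.le (ε := 1 / 2) (by norm_num)
        linarith
    have him' : |(shiftLog k z).im| ≤ Real.pi := by
      rw [shiftLog, log_im]; exact abs_arg_le_pi _
    refine (norm_le_abs_re_add_abs_im _).trans ?_
    calc _ ≤ 2 * A * (1 + ‖z‖) ^ (1 / 2 : ℝ) + |Real.log B| * 1 + Real.pi * 1 := by linarith
      _ ≤ 2 * A * (1 + ‖z‖) ^ (1 / 2 : ℝ) + |Real.log B| * (1 + ‖z‖) ^ (1 / 2 : ℝ) +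
          Real.pi * (1 + ‖z‖) ^ (1 / 2 : ℝ) := by gcongr
      _ ≤ _ := by nlinarith

/-- For large `z` the difference is `log (1 + k/z)`: both `-iz` and `1 + k/z` lie in the right
half-plane, so their arguments add without crossing the cut. -/
lemma tendsto_shiftLog_sub_log (k : ℂ) :
    Tendsto (fun z : ℂ => shiftLog k z - log (z / I)) (Bornology.cobounded ℂ ⊓ 𝓟 upperHalf)
      (𝓝 0) := by
  have hdiv : Tendsto (fun z : ℂ => 1 + k / z) (Bornology.cobounded ℂ ⊓ 𝓟 upperHalf)
      (𝓝 1) := by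
    have : Tendsto (fun z : ℂ => 1 + k * z⁻¹) (Bornology.cobounded ℂ) (𝓝 (1 + k * 0)) :=
      (tendsto_inv₀_cobounded.const_mul k).const_add 1
    simp only [mul_zero, add_zero] at this
    exact (this.mono_left inf_le_left).congr fun z => by rw [div_eq_mul_inv]
  have hlog : Tendsto (fun z : ℂ => log (1 + k / z)) (Bornology.cobounded ℂ ⊓ 𝓟 upperHalf)
      (𝓝 0) := by
    have := (continuousAt_clog (x := 1) (by simp)).tendsto.comp hdiv
    simpa [Function.comp_def] using this
  have hev : ∀ᶠ z in Bornology.cobounded ℂ ⊓ 𝓟 upperHalf, 0 < (1 + k / z).re :=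
    hdiv.eventually ((isOpen_lt continuous_const continuous_re).mem_nhds (by simp))
  have hup : ∀ᶠ z in Bornology.cobounded ℂ ⊓ 𝓟 upperHalf, 0 < z.im :=
    mem_inf_of_right (mem_principal_self _)
  refine hlog.congr' ?_
  filter_upwards [hev, hup] with z h1 h2
  have hz0 : z ≠ 0 := fun h => by simp [h] at h2
  have e1 : z / I = -I * z := by rw [div_I]; ring
  have hre : 0 < (-I * z).re := by simpa
  have e2 : -I * (k + z) = (-I * z) * (1 + k / z) := by field_simp; ring
  have a1 := abs_lt.1 (abs_arg_lt_pi_div_two_iff.2 (Or.inl hre))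
  have a2 := abs_lt.1 (abs_arg_lt_pi_div_two_iff.2 (Or.inl h1))
  rw [shiftLog, e1, e2, log_mul (by simpa) (fun h => by simp [h] at h1)
    ⟨by linarith, by linarith⟩]
  ring

/-- Factoring the positive number `ζ` out of both logarithms leaves a function `φ` of `k/ζ`,
differentiable at `0`. Its value there is zero because `log (-I)` and `log I` cancel. -/
lemma isBigO_shiftLog_add_shiftLog (k : ℂ) :
    (fun ζ : ℝ => 1 / 2 * (shiftLog k ζ + shiftLog k (-ζ)) - (Real.log ζ : ℂ)) =O[atTop]
      fun ζ : ℝ => 1 / ζ := by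
  set φ : ℂ → ℂ := fun w => 1 / 2 * (log (-I * (1 + w)) + log (I * (1 - w))) with hφ
  have hφd : DifferentiableAt ℂ φ 0 := by
    refine DifferentiableAt.const_mul (DifferentiableAt.add ?_ ?_) _
    · exact DifferentiableAt.clog (by fun_prop) (by simp [mem_slitPlane_iff])
    · exact DifferentiableAt.clog (by fun_prop) (by simp [mem_slitPlane_iff])
  have hφ0 : φ 0 = 0 := by
    simp only [hφ, add_zero, sub_zero, mul_one, log_I, log_neg_I]
    ring
  have hlim : Tendsto (fun ζ : ℝ => k / (ζ : ℂ)) atTop (𝓝 0) := by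
    have : Tendsto (fun ζ : ℝ => k * ((ζ⁻¹ : ℝ) : ℂ)) atTop (𝓝 (k * ((0 : ℝ) : ℂ))) :=
      ((continuous_ofReal.tendsto 0).comp tendsto_inv_atTop_zero).const_mul k
    simp only [ofReal_zero, mul_zero] at this
    exact this.congr fun ζ => by push_cast; rw [div_eq_mul_inv]
  have hO := hφd.isBigO_sub.comp_tendsto hlim
  have hO2 : (fun ζ : ℝ => k / (ζ : ℂ)) =O[atTop] fun ζ : ℝ => 1 / ζ := by
    refine Asymptotics.IsBigO.of_bound ‖k‖ (Eventually.of_forall fun ζ => ?_)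
    simp [div_eq_mul_inv]
  have hO3 : (φ ∘ fun ζ : ℝ => k / (ζ : ℂ)) =O[atTop] fun ζ : ℝ => 1 / ζ := by
    have h := hO.trans (hO2.congr' (Eventually.of_forall fun ζ => by simp) EventuallyEq.rfl)
    refine h.congr' (Eventually.of_forall fun ζ => by simp [hφ0]) EventuallyEq.rfl
  refine hO3.congr' ?_ EventuallyEq.rfl
  have hne : ∀ᶠ ζ : ℝ in atTop, ‖k / (ζ : ℂ)‖ < 1 := by
    have := hlim.norm
    rw [norm_zero] at this
    exact this.eventually (gt_mem_nhds one_pos)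
  filter_upwards [hne, eventually_gt_atTop 0] with ζ h1 h2
  have hζ : (ζ : ℂ) ≠ 0 := by exact_mod_cast h2.ne'
  have n1 : 1 + k / (ζ : ℂ) ≠ 0 := fun h => by
    have : k / (ζ : ℂ) = -1 := by linear_combination h
    rw [this] at h1; simp at h1
  have n2 : 1 - k / (ζ : ℂ) ≠ 0 := fun h => by
    have : k / (ζ : ℂ) = 1 := by linear_combination -h
    rw [this] at h1; simp at h1
  have e1 : -I * (k + ζ) = (ζ : ℂ) * (-I * (1 + k / ζ)) := by field_simp; ring
  have e2 : -I * (k + -ζ) = (ζ : ℂ) * (I * (1 - k / ζ)) := by field_simp; ring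
  simp only [Function.comp, hφ, shiftLog]
  rw [e1, e2, log_ofReal_mul h2 (mul_ne_zero (neg_ne_zero.2 I_ne_zero) n1),
    log_ofReal_mul h2 (mul_ne_zero I_ne_zero n2)]
  ring

/-- A multiplicative (Wiener-Hopf) splitting `exp Q(ξ) = exp (F ξ) exp (F (-ξ))`, with `F`
holomorphic above the line `Im z = -δ`. -/
structure IsSplitting (Q : ℝ → ℂ) (F : ℂ → ℂ) (δ C : ℝ) : Prop where
  pos : 0 < δ
  differentiableOn : DifferentiableOn ℂ F {z | -δ < z.im}
  add_neg : ∀ ξ : ℝ, Q ξ = F ξ + F (-ξ)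
  norm_exp_le : ∀ z : ℂ, -δ < z.im → ‖exp (F z)‖ ≤ C * (1 + ‖z‖) ^ (1 / 2 : ℝ)
  norm_exp_neg_le : ∀ z : ℂ, -δ < z.im → ‖exp (-F z)‖ ≤ C * (1 + ‖z‖) ^ (-(1 / 2) : ℝ)
  norm_le : ∀ z : ℂ, -δ < z.im → ‖F z‖ ≤ C * (1 + ‖z‖) ^ (1 / 2 : ℝ)

/-- The symbol is `i s · exp (½(shiftLog k ξ + shiftLog k (-ξ))) · e^{q(ξ)}` with `s = ς/(2k)`. Each
of the three logarithms is shared evenly between `ξ` and `-ξ`: the constant is halved, the two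
shifted logarithms are separated, and `q` splits as `p(ξ) + p(-ξ)`. -/
lemma exists_isSplitting {k ς : ℂ} (hre : 0 < k.re) (him : 0 < k.im) (hς : ς ≠ 0)
    (hP : ∀ ξ : ℝ, symbolP k ς ξ ≠ 0) {Q : ℝ → ℂ} (hQ : IsLogBranch Q (symbolP k ς)) :
    ∃ F δ C c, IsSplitting Q F δ C ∧ exp c = I * ς / (2 * k) ∧
      (fun ζ : ℝ => Q ζ - (c + (Real.log ζ : ℂ))) =O[atTop] (fun ζ : ℝ => 1 / ζ) ∧
      Tendsto (fun ξ : ℂ => F ξ - 1 / 2 * (c + log (ξ / I)))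
        (Bornology.cobounded ℂ ⊓ 𝓟 upperHalf) (𝓝 0) := by
  have hk : k ≠ 0 := fun h => by simp [h] at hre
  set s : ℂ := ς / (2 * k) with hs
  have hs0 : s ≠ 0 := div_ne_zero hς (by simp [hk])
  obtain ⟨δ₀, hδ₀, hδ₀k, hne⟩ := exists_strip_ne_zero (s := s) him fun ξ => by
    rw [← symbolP_eq hre him]; exact hP ξ
  set δ := min δ₀ (k.im / 2) with hδ
  have hδpos : 0 < δ := lt_min hδ₀ (half_pos him)
  have hδ1 : δ ≤ δ₀ := min_le_left _ _
  have hδ2 : δ ≤ k.im / 2 := min_le_right _ _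
  set η := δ / 2 with hη
  have hηpos : 0 < η := half_pos hδpos
  have hηδ : η < δ := half_lt_self hδpos
  have hstrip : strip δ ⊆ strip k.im := strip_mono (by linarith)
  -- The symbol divided by its leading term `s * root k z`, so that what remains tends to `1`.
  set g : ℂ → ℂ := fun z => 1 + s⁻¹ * (root k z)⁻¹ with hg
  have hgmul : ∀ z, s * root k z * g z = 1 + s * root k z := by
    intro z
    have := root_ne_zero k z
    simp only [hg]
    field_simp
    ring
  obtain ⟨q, hqd, hqexp, hqev, D, hqD⟩ := exists_even_log (C := ‖s⁻¹‖ *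
      (1 + (1 + ‖k‖) / (k.im / 2))) hηpos hηδ (g := g)
    ((((differentiableOn_root k).mono hstrip).inv fun z _ => root_ne_zero k z).const_mul _
      |>.const_add _)
    (fun z hz h0 => hne z (strip_mono hδ1 hz) (by rw [← hgmul, h0, mul_zero]))
    (fun z => by simp only [hg, root_neg])
    (fun z hz => by
      simp only [hg, add_sub_cancel_left, norm_mul, mul_assoc]
      exact mul_le_mul_of_nonneg_left
        (norm_inv_root_le him ((show |z.im| < δ from hz).le.trans hδ2)) (norm_nonneg _))
  obtain ⟨p, hpd, ⟨E, hpE⟩, hpq⟩ := exists_additive_splitting hηpos hηδ hqd hqev hqD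
  have hlogc : Continuous fun ξ : ℝ => shiftLog k ξ := by
    refine (differentiableOn_shiftLog k).continuousOn.comp_continuous continuous_ofReal fun x => ?_
    simpa using him
  have hlogc' : Continuous fun ξ : ℝ => shiftLog k (-ξ) := by
    have := hlogc.comp continuous_neg
    simpa [Function.comp_def] using this
  have hqc : Continuous fun ξ : ℝ => q ξ :=
    hqd.continuousOn.comp_continuous continuous_ofReal (ofReal_mem_strip hδpos)
  -- The given branch `Q` may differ from the constructed logarithm by `2πin`; this integer is
  -- absorbed into the constant `c`.
  obtain ⟨n, hn⟩ := exists_eq_int_mul_of_exp_eq_one (isPreconnected_univ (α := ℝ))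
    (f := fun ξ => Q ξ - (log (I * s) + 1 / 2 * (shiftLog k ξ + shiftLog k (-ξ)) + q ξ))
    (hQ.1.sub ((continuous_const.add (continuous_const.mul (hlogc.add hlogc'))).add
      hqc)).continuousOn fun ξ _ => by
      have h1 : exp (log (I * s) + 1 / 2 * (shiftLog k ξ + shiftLog k (-ξ)) + q ξ) =
          symbolP k ς ξ := by
        rw [symbolP_eq hre him, ← hs, ← hgmul, exp_add, exp_add, hqexp _ (ofReal_mem_strip hδpos ξ),
          exp_log (mul_ne_zero I_ne_zero hs0), root]
        ring
      rw [exp_sub, hQ.2, h1, div_self (hP ξ)]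
  set c := log (I * s) + n * (2 * Real.pi * I) with hc
  have hQeq : ∀ ξ : ℝ, Q ξ = c + 1 / 2 * (shiftLog k ξ + shiftLog k (-ξ)) + q ξ := by
    intro ξ
    have := hn ξ (mem_univ _)
    linear_combination this
  obtain ⟨A, hA⟩ := exp_half_shiftLog_bounds him
  have hA0 : 0 ≤ A := by
    have := (norm_nonneg _).trans (hA 0 (by simpa using (half_pos him).le)).1
    exact nonneg_of_mul_nonneg_left this (by positivity)
  have hE0 : 0 ≤ E := by
    have := (norm_nonneg _).trans (hpE 0 (by simpa using (half_pos hηpos).le))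
    exact nonneg_of_mul_nonneg_left this (by positivity)
  have hpE' : ∀ z : ℂ, -(η / 2) < z.im → ‖p z‖ ≤ E := fun z hz =>
    (hpE z hz.le).trans <| mul_le_of_le_one_right hE0 <|
      Real.rpow_le_one_of_one_le_of_nonpos (by linarith [norm_nonneg z]) (by norm_num)
  have hhalf : ∀ z : ℂ, -(η / 2) < z.im → -(k.im / 2) ≤ z.im := fun z hz => by linarith
  have hone : ∀ z : ℂ, 1 ≤ (1 + ‖z‖) ^ (1 / 2 : ℝ) := fun z =>
    Real.one_le_rpow (by linarith [norm_nonneg z]) (by norm_num)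
  set M := Real.exp (‖c / 2‖ + E) with hM
  have hM0 : 0 < M := Real.exp_pos _
  refine ⟨fun z => c / 2 + 1 / 2 * shiftLog k z + p z, η / 2, A * M + A + ‖c / 2‖ + E, c,
    ⟨half_pos hηpos, ?_, fun ξ => ?_, fun z hz => ?_, fun z hz => ?_, fun z hz => ?_⟩, ?_, ?_, ?_⟩
  · refine (((differentiableOn_shiftLog k).mono fun z hz => ?_).const_mul _ |>.const_add _).add
      (hpd.mono fun z hz => ?_)
    · have : -(η / 2) < z.im := hz
      exact show -k.im < z.im by linarith
    · have : -(η / 2) < z.im := hz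
      exact show -η < z.im by linarith
  · rw [hQeq, hpq _ (ofReal_mem_strip hηpos ξ)]
    ring
  · have e : exp (c / 2 + 1 / 2 * shiftLog k z + p z) =
        exp (c / 2 + p z) * exp (1 / 2 * shiftLog k z) := by rw [← exp_add]; ring_nf
    have h1 : ‖exp (c / 2 + p z)‖ ≤ M := (norm_exp_le_exp_norm _).trans
      (Real.exp_le_exp.2 ((norm_add_le _ _).trans (by linarith [hpE' z hz])))
    rw [e, norm_mul]
    calc _ ≤ M * (A * (1 + ‖z‖) ^ (1 / 2 : ℝ)) :=
          mul_le_mul h1 (hA z (hhalf z hz)).1 (norm_nonneg _) hM0.le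
      _ = A * M * (1 + ‖z‖) ^ (1 / 2 : ℝ) := by ring
      _ ≤ _ := by gcongr; linarith [norm_nonneg (c / 2)]
  · have e : exp (-(c / 2 + 1 / 2 * shiftLog k z + p z)) =
        exp (-(c / 2 + p z)) * exp (-(1 / 2 * shiftLog k z)) := by rw [← exp_add]; ring_nf
    have h1 : ‖exp (-(c / 2 + p z))‖ ≤ M := (norm_exp_le_exp_norm _).trans
      (Real.exp_le_exp.2 (by rw [norm_neg]; exact (norm_add_le _ _).trans (by linarith [hpE' z hz])))
    rw [e, norm_mul]
    calc _ ≤ M * (A * (1 + ‖z‖) ^ (-(1 / 2) : ℝ)) :=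
          mul_le_mul h1 (hA z (hhalf z hz)).2.1 (norm_nonneg _) hM0.le
      _ = A * M * (1 + ‖z‖) ^ (-(1 / 2) : ℝ) := by ring
      _ ≤ _ := by gcongr; linarith [norm_nonneg (c / 2)]
  · have h1 := (hA z (hhalf z hz)).2.2
    have h2 := hpE' z hz
    have h3 := hone z
    have h4 : ‖1 / 2 * shiftLog k z‖ ≤ ‖shiftLog k z‖ := by
      rw [norm_mul]
      refine mul_le_of_le_one_left (norm_nonneg _) ?_
      norm_num
    refine (norm_add_le _ _).trans ((add_le_add_left (norm_add_le _ _) _).trans ?_)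
    calc _ ≤ ‖c / 2‖ * 1 + A * (1 + ‖z‖) ^ (1 / 2 : ℝ) + E * 1 := by linarith
      _ ≤ ‖c / 2‖ * (1 + ‖z‖) ^ (1 / 2 : ℝ) + A * (1 + ‖z‖) ^ (1 / 2 : ℝ) +
          E * (1 + ‖z‖) ^ (1 / 2 : ℝ) := by gcongr
      _ ≤ _ := by nlinarith [mul_nonneg hA0 hM0.le]
  · rw [hc, exp_add, exp_int_mul_two_pi_mul_I, mul_one, exp_log (mul_ne_zero I_ne_zero hs0), hs]
    ring
  · have h1 : (fun ζ : ℝ => q ζ) =O[atTop] fun ζ : ℝ => 1 / ζ := by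
      refine Asymptotics.IsBigO.of_bound (max D 0) ?_
      filter_upwards [eventually_gt_atTop 0] with ζ hζ
      refine (hqD ζ (by simpa using hηpos.le)).trans ?_
      rw [Real.rpow_neg_one, norm_real, Real.norm_of_nonneg hζ.le,
        Real.norm_of_nonneg (by positivity), one_div]
      refine mul_le_mul (le_max_left _ _) ?_ (by positivity) (le_max_right _ _)
      exact inv_anti₀ hζ (by linarith)
    refine ((isBigO_shiftLog_add_shiftLog k).add h1).congr_left fun ζ => ?_
    rw [hQeq]
    ring
  · have h1 : Tendsto p (Bornology.cobounded ℂ ⊓ 𝓟 upperHalf) (𝓝 0) := by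
      have h2 : Tendsto (fun z : ℂ => E * (1 + ‖z‖) ^ (-(1 / 4) : ℝ))
          (Bornology.cobounded ℂ ⊓ 𝓟 upperHalf) (𝓝 0) :=
        ((tendsto_const_mul_one_add_rpow_neg E (by norm_num)).comp
          tendsto_norm_cobounded_atTop).mono_left inf_le_left
      refine squeeze_zero_norm' ?_ h2
      have hup : ∀ᶠ z in Bornology.cobounded ℂ ⊓ 𝓟 upperHalf, 0 < z.im :=
        mem_inf_of_right (mem_principal_self _)
      filter_upwards [hup] with z hz
      exact hpE z (by linarith)
    have h2 := ((tendsto_shiftLog_sub_log k).const_mul (1 / 2)).add h1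
    simp only [mul_zero, add_zero] at h2
    refine h2.congr fun z => ?_
    ring

end HalfPlane

/-! ### Identification of the split functions with the splitting. -/

namespace HalfPlane

open Complex

namespace IsSplitting

variable {Q : ℝ → ℂ} {F : ℂ → ℂ} {δ C : ℝ}

lemma const_nonneg (h : IsSplitting Q F δ C) : 0 ≤ C := by
  simpa using (norm_nonneg _).trans (h.norm_le 0 (by simpa using h.pos))

lemma continuousOn_closed (h : IsSplitting Q F δ C) : ContinuousOn F {z | 0 ≤ z.im} :=
  h.differentiableOn.continuousOn.mono fun z (hz : 0 ≤ z.im) =>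
    show -δ < z.im by linarith [h.pos]

lemma differentiableOn_upper (h : IsSplitting Q F δ C) : DifferentiableOn ℂ F {z | 0 < z.im} :=
  h.differentiableOn.mono fun z (hz : 0 < z.im) => show -δ < z.im by linarith [h.pos]

lemma continuous_ofReal (h : IsSplitting Q F δ C) : Continuous fun x : ℝ => F x :=
  h.continuousOn_closed.comp_continuous Complex.continuous_ofReal fun x => by simp

lemma integrable_div_sq_sub_sq (h : IsSplitting Q F δ C) {ξ : ℂ} (hξ : ξ.im ≠ 0) :
    Integrable fun x : ℝ => F x / ((x : ℂ) ^ 2 - ξ ^ 2) := by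
  have hξ' : (-ξ).im ≠ 0 := by simpa
  have e : ∀ x : ℝ, (x : ℂ) ^ 2 - ξ ^ 2 = ((x : ℂ) - ξ) * ((x : ℂ) - -ξ) := fun x => by ring
  have hr : 0 < |ξ.im| := abs_pos.2 hξ
  refine integrable_of_norm_le_rpow (p := 3 / 2) (C := C * ((1 + (1 + ‖ξ‖) / |ξ.im|) *
    (1 + (1 + ‖-ξ‖) / |ξ.im|))) (by norm_num) ?_ fun x => ?_
  · refine (h.continuous_ofReal.div (by fun_prop) fun x => ?_).aestronglyMeasurable
    rw [e]
    exact mul_ne_zero (ofReal_sub_ne_zero hξ x) (ofReal_sub_ne_zero hξ' x)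
  · have h1 := norm_inv_sub_mul_le (z' := -ξ) (ζ := x) hr (abs_im_le_norm_ofReal_sub x ξ)
      (by simpa using abs_im_le_norm_ofReal_sub x (-ξ))
    have h2 := h.norm_le x (by simpa using h.pos)
    rw [div_eq_mul_inv, norm_mul, e]
    refine (mul_le_mul h2 h1 (norm_nonneg _) (mul_nonneg h.const_nonneg (by positivity))).trans_eq ?_
    have : (-(3 / 2) : ℝ) = 1 / 2 + -2 := by norm_num
    rw [this, Real.rpow_add (by positivity), norm_real, Real.norm_eq_abs]
    ring

lemma integrableOn_div_sq_sub_sq (h : IsSplitting Q F δ C) {ξ : ℂ} (hξ : ξ.im ≠ 0) :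
    IntegrableOn (fun ζ : ℝ => Q ζ / ((ζ : ℂ) ^ 2 - ξ ^ 2)) (Ioi 0) := by
  have h1 := h.integrable_div_sq_sub_sq hξ
  refine ((h1.add h1.comp_neg).congr (Eventually.of_forall fun x => ?_)).integrableOn
  simp only [Pi.add_apply, ofReal_neg, neg_sq]
  rw [h.add_neg, add_div]

/-- Since `Q(ζ) = F(ζ) + F(-ζ)` and the denominator is even, the half-line integral unfolds to an
integral of `F` over the real line. Cauchy's formula for `F(z)/(z + ξ)` then evaluates it at the
only pole in the upper half-plane, `ξ`. -/
lemma integral_div_sq_sub_sq (h : IsSplitting Q F δ C) {ξ : ℂ} (hξ : 0 < ξ.im) :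
    ∫ ζ in Ioi (0 : ℝ), Q ζ / ((ζ : ℂ) ^ 2 - ξ ^ 2) = Real.pi * I / ξ * F ξ := by
  have hξ0 : ξ ≠ 0 := fun h => by simp [h] at hξ
  have hint := h.integrable_div_sq_sub_sq hξ.ne'
  have e1 : ∫ ζ in Ioi (0 : ℝ), Q ζ / ((ζ : ℂ) ^ 2 - ξ ^ 2) =
      ∫ x : ℝ, F x / ((x : ℂ) ^ 2 - ξ ^ 2) := by
    rw [← intervalIntegral.integral_Iic_add_Ioi (b := 0) hint.integrableOn hint.integrableOn]
    have h2 := integral_comp_neg_Ioi 0 fun x : ℝ => F x / ((x : ℂ) ^ 2 - ξ ^ 2)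
    rw [neg_zero] at h2
    rw [← h2, ← integral_add hint.comp_neg.integrableOn hint.integrableOn]
    congr 1 with x
    simp only [ofReal_neg, neg_sq]
    rw [h.add_neg, add_div, add_comm]
  have hne : ∀ z : ℂ, 0 ≤ z.im → z + ξ ≠ 0 := fun z hz h0 => by
    have := congrArg im h0
    simp at this; linarith
  have hd : DifferentiableOn ℂ (fun z : ℂ => (z + ξ)⁻¹) {z | 0 ≤ z.im} := fun z hz => by
    have := hne z hz
    exact (by fun_prop (disch := assumption) :
      DifferentiableAt ℂ (fun z : ℂ => (z + ξ)⁻¹) z).differentiableWithinAt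
  have hcauchy := integral_div_sub_of_upper (f := fun z => F z * (z + ξ)⁻¹) (α := 1 / 2)
    (C := C * (1 + (1 + ‖-ξ‖) / ξ.im)) (by norm_num) hξ
    (h.continuousOn_closed.mul hd.continuousOn)
    (h.differentiableOn_upper.mul (hd.mono fun z (hz : 0 < z.im) => hz.le)) fun z hz => by
      have h1 := norm_inv_sub_le (z := -ξ) (ζ := z) hξ (by
        have := im_sub_im_le_norm_sub z (-ξ)
        rw [neg_im] at this
        linarith)
      rw [sub_neg_eq_add] at h1
      have h2 := h.norm_le z (by linarith [h.pos])
      rw [norm_mul, norm_inv]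
      refine (mul_le_mul h2 h1 (by positivity)
        (mul_nonneg h.const_nonneg (by positivity))).trans_eq ?_
      have : (-(1 / 2) : ℝ) = 1 / 2 + -1 := by norm_num
      rw [this, Real.rpow_add (by positivity)]
      ring
  have e2 : ∀ x : ℝ, F x * ((x : ℂ) + ξ)⁻¹ / (x - ξ) = F x / ((x : ℂ) ^ 2 - ξ ^ 2) := fun x => by
    have : (x : ℂ) ^ 2 - ξ ^ 2 = (x + ξ) * (x - ξ) := by ring
    rw [this, div_mul_eq_div_div]
    rfl
  simp_rw [e2] at hcauchy
  rw [e1, hcauchy]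
  have := hne ξ hξ.le
  rw [← two_mul]
  field_simp

lemma splitPlus_eq (h : IsSplitting Q F δ C) {ξ : ℂ} (hξ : 0 < ξ.im) : splitPlus Q ξ = F ξ := by
  have hξ0 : ξ ≠ 0 := fun h => by simp [h] at hξ
  have hpi : (Real.pi : ℂ) ≠ 0 := by exact_mod_cast Real.pi_ne_zero
  rw [splitPlus, h.integral_div_sq_sub_sq hξ]
  field_simp

lemma splitMinus_eq (h : IsSplitting Q F δ C) {ξ : ℂ} (hξ : ξ.im < 0) :
    splitMinus Q ξ = F (-ξ) := by
  rw [← h.splitPlus_eq (by simpa), splitMinus, splitPlus]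
  simp only [neg_sq]
  ring

lemma differentiableOn_splitPlus (h : IsSplitting Q F δ C) :
    DifferentiableOn ℂ (splitPlus Q) upperHalf :=
  h.differentiableOn_upper.congr fun _ hz => h.splitPlus_eq hz

lemma differentiableOn_comp_neg (h : IsSplitting Q F δ C) :
    DifferentiableOn ℂ (fun z => F (-z)) {z | z.im < δ} :=
  h.differentiableOn.comp differentiable_neg.differentiableOn fun z (hz : z.im < δ) =>
    show -δ < (-z).im by simpa

lemma differentiableOn_splitMinus (h : IsSplitting Q F δ C) :
    DifferentiableOn ℂ (splitMinus Q) lowerHalf :=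
  (h.differentiableOn_comp_neg.mono fun z (hz : z.im < 0) => hz.trans h.pos).congr
    fun _ hz => h.splitMinus_eq hz

lemma tendsto_splitPlus (h : IsSplitting Q F δ C) (ξ : ℝ) :
    Tendsto (splitPlus Q) (𝓝[upperHalf] (ξ : ℂ)) (𝓝 (F ξ)) := by
  have h1 : ContinuousAt F ξ := (h.differentiableOn.differentiableAt
    ((isOpen_im_gt _).mem_nhds (by simpa using h.pos))).continuousAt
  refine (h1.tendsto.mono_left nhdsWithin_le_nhds).congr' ?_
  filter_upwards [self_mem_nhdsWithin] with z hz
  exact (h.splitPlus_eq hz).symm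

lemma tendsto_splitMinus (h : IsSplitting Q F δ C) (ξ : ℝ) :
    Tendsto (splitMinus Q) (𝓝[lowerHalf] (ξ : ℂ)) (𝓝 (F (-ξ))) := by
  have h1 : ContinuousAt (fun z => F (-z)) ξ := (h.differentiableOn_comp_neg.differentiableAt
    ((isOpen_im_lt _).mem_nhds (by simpa using h.pos))).continuousAt
  refine (h1.tendsto.mono_left nhdsWithin_le_nhds).congr' ?_
  filter_upwards [self_mem_nhdsWithin] with z hz
  exact (h.splitMinus_eq hz).symm

lemma splitPlusReal_eq (h : IsSplitting Q F δ C) (ξ : ℝ) : splitPlusReal Q ξ = F ξ := by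
  -- Real points lie in the closure of the half-plane; properness of the filter is what makes
  -- `limUnder` return the limit.
  have : (𝓝[upperHalf] (ξ : ℂ)).NeBot := by
    rw [← mem_closure_iff_nhdsWithin_neBot, upperHalf, closure_setOfPred_lt_im]
    simp
  exact (h.tendsto_splitPlus ξ).limUnder_eq

lemma splitMinusReal_eq (h : IsSplitting Q F δ C) (ξ : ℝ) : splitMinusReal Q ξ = F (-ξ) := by
  have : (𝓝[lowerHalf] (ξ : ℂ)).NeBot := by
    rw [← mem_closure_iff_nhdsWithin_neBot, lowerHalf, closure_setOfPred_im_lt]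
    simp
  exact (h.tendsto_splitMinus ξ).limUnder_eq

end IsSplitting

end HalfPlane

/-! ### Inverse Fourier integrals of densities holomorphic below a horizontal line. -/

namespace HalfPlane

open Complex

/-- The inverse Fourier integral `∫ h(ξ) e^{iξx} dξ`. -/
noncomputable def invTransform (h : ℝ → ℂ) (x : ℝ) : ℂ := ∫ ξ : ℝ, h ξ * exp (I * ξ * x)

lemma norm_exp_I_mul (z : ℂ) (x : ℝ) : ‖exp (I * z * x)‖ = Real.exp (-z.im * x) := by
  rw [norm_exp, re_mul_ofReal]; simp

lemma norm_exp_I_mul_ofReal (ξ x : ℝ) : ‖exp (I * ξ * x)‖ = 1 := by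
  rw [norm_exp_I_mul]; simp

lemma integrable_mul_exp_I {h : ℝ → ℂ} (hh : Integrable h) (x : ℝ) :
    Integrable fun ξ : ℝ => h ξ * exp (I * ξ * x) := by
  refine hh.norm.mono' (hh.1.mul (by fun_prop)) (Eventually.of_forall fun ξ => ?_)
  rw [norm_mul, norm_exp_I_mul_ofReal, mul_one]

lemma continuous_invTransform {h : ℝ → ℂ} (hh : Integrable h) : Continuous (invTransform h) := by
  refine continuous_of_dominated (fun x => (integrable_mul_exp_I hh x).1) (bound := fun ξ => ‖h ξ‖)
    (fun x => Eventually.of_forall fun ξ => ?_) hh.norm (Eventually.of_forall fun ξ => by fun_prop)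
  rw [norm_mul, norm_exp_I_mul_ofReal, mul_one]

lemma hasDerivAt_invTransform {h : ℝ → ℂ} (hh : Integrable h)
    (hh' : Integrable fun ξ : ℝ => I * ξ * h ξ) (x : ℝ) :
    HasDerivAt (invTransform h) (invTransform (fun ξ => I * ξ * h ξ) x) x := by
  refine (hasDerivAt_integral_of_dominated_loc_of_deriv_le (μ := volume)
    (F := fun (x : ℝ) (ξ : ℝ) => h ξ * exp (I * ξ * x))
    (F' := fun (x : ℝ) (ξ : ℝ) => I * ξ * h ξ * exp (I * ξ * x)) (x₀ := x) univ_mem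
    (Eventually.of_forall fun x => (integrable_mul_exp_I hh x).1) (integrable_mul_exp_I hh x)
    (integrable_mul_exp_I hh' x).1
    (Eventually.of_forall fun ξ x _ => ?_) hh'.norm (Eventually.of_forall fun ξ x _ => ?_)).2
  · rw [norm_mul, norm_exp_I_mul_ofReal, mul_one]
  · have h1 : HasDerivAt (fun x : ℝ => I * (ξ : ℂ) * (x : ℂ)) (I * ξ * 1) x :=
      (hasDerivAt_id x).ofReal_comp.const_mul _
    exact (h1.cexp.const_mul (h ξ)).congr_deriv (by ring)

section Analytic

variable {h : ℂ → ℂ} {ε ε' C p : ℝ}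

lemma integrable_of_bound (hε : 0 < ε) (hε' : ε < ε') (hp : 1 < p)
    (hd : DifferentiableOn ℂ h {z | z.im < ε'})
    (hb : ∀ z : ℂ, z.im ≤ ε → ‖h z‖ ≤ C * (1 + ‖z‖) ^ (-p)) : Integrable fun ξ : ℝ => h ξ := by
  refine integrable_of_norm_le_rpow hp ?_ fun x => by simpa using hb x (by simpa using hε.le)
  exact (hd.continuousOn.comp_continuous continuous_ofReal fun x => by
    simpa using hε.trans hε').aestronglyMeasurable

/-- For `x ≤ 0` the exponential is bounded in the lower half-plane, so the contour closes downward;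
the reflection `z ↦ -z` reduces this to the upper half-plane. -/
lemma invTransform_eq_zero (hε : 0 < ε) (hε' : ε < ε') (hp : 1 < p)
    (hd : DifferentiableOn ℂ h {z | z.im < ε'})
    (hb : ∀ z : ℂ, z.im ≤ ε → ‖h z‖ ≤ C * (1 + ‖z‖) ^ (-p)) {x : ℝ} (hx : x ≤ 0) :
    invTransform (fun ξ => h ξ) x = 0 := by
  have hd' : DifferentiableOn ℂ (fun z => h (-z) * exp (I * (-z) * x)) {z | 0 ≤ z.im} := by
    refine DifferentiableOn.mul ?_ (by fun_prop)
    exact hd.comp differentiable_neg.differentiableOn fun z (hz : 0 ≤ z.im) =>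
      show (-z).im < ε' by rw [neg_im]; linarith
  have key := integral_eq_zero_of_upper (G := fun z => h (-z) * exp (I * (-z) * x)) (C := C) hp
    hd'.continuousOn (hd'.mono fun z (hz : 0 < z.im) => hz.le) fun z hz => by
      rw [norm_mul, norm_exp_I_mul]
      have h1 := hb (-z) (by rw [neg_im]; linarith)
      rw [norm_neg] at h1
      refine (mul_le_of_le_one_right (norm_nonneg _) ?_).trans h1
      rw [Real.exp_le_one_iff, neg_im, neg_neg]
      exact mul_nonpos_of_nonneg_of_nonpos hz hx
  rw [invTransform, ← integral_neg_eq_self, ← key]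
  simp

/-- Shifting the contour up to `Im z = ε` produces the factor `e^{-εx}`. -/
lemma norm_invTransform_le (hε : 0 < ε) (hε' : ε < ε') (hp : 1 < p)
    (hd : DifferentiableOn ℂ h {z | z.im < ε'})
    (hb : ∀ z : ℂ, z.im ≤ ε → ‖h z‖ ≤ C * (1 + ‖z‖) ^ (-p)) :
    ∃ D, ∀ x : ℝ, 0 ≤ x → ‖invTransform (fun ξ => h ξ) x‖ ≤ D * Real.exp (-ε * x) := by
  have hC : 0 ≤ C := by simpa using (norm_nonneg _).trans (hb 0 (by simpa using hε.le))
  refine ⟨∫ t : ℝ, C * (1 + |t|) ^ (-p), fun x hx => ?_⟩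
  have hd' : DifferentiableOn ℂ (fun z => h z * exp (I * z * x)) {z | z.im < ε'} :=
    hd.mul (by fun_prop)
  have hb' : ∀ z : ℂ, z.im ≤ ε → ‖h z‖ ≤ C * (1 + |z.re|) ^ (-p) := fun z hz =>
    (hb z hz).trans (mul_le_mul_of_nonneg_left (rpow_neg_le_abs_re (by linarith)) hC)
  have key := integral_strip_eq (G := fun z => h z * exp (I * z * x)) (C := C) hε.le hp
    (hd'.continuousOn.mono fun z hz => lt_of_le_of_lt hz.2 hε')
    (hd'.mono fun z hz => hz.2.trans hε') fun z h0 hz => by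
      rw [norm_mul, norm_exp_I_mul]
      refine (mul_le_of_le_one_right (norm_nonneg _) ?_).trans (hb' z hz)
      rw [Real.exp_le_one_iff]
      nlinarith
  simp only [ofReal_zero, zero_mul, add_zero] at key
  rw [invTransform, key, ← integral_mul_const]
  refine norm_integral_le_of_norm_le (((integrable_one_add_norm (by simpa using hp)).const_mul
    _).mul_const _) (Eventually.of_forall fun t => ?_)
  rw [norm_mul, norm_exp_I_mul]
  have h1 := hb' (t + ε * I) (by simp)
  simp only [add_re, ofReal_re, mul_re, I_re, mul_zero, ofReal_im, I_im, mul_one, sub_self,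
    add_zero] at h1
  simp only [add_im, ofReal_im, mul_im, ofReal_re, I_im, mul_one, I_re, mul_zero, add_zero, zero_add]
  exact mul_le_mul_of_nonneg_right h1 (Real.exp_pos _).le

/-- `Im ξ < 0` makes the double integral absolutely convergent. The inner integral in `x` is `i/(t -
ξ)`, and Cauchy's formula in the lower half-plane does the rest. -/
lemma integral_invTransform_mul_exp (hε : 0 < ε) (hε' : ε < ε') (hp : 1 < p)
    (hd : DifferentiableOn ℂ h {z | z.im < ε'})
    (hb : ∀ z : ℂ, z.im ≤ ε → ‖h z‖ ≤ C * (1 + ‖z‖) ^ (-p)) {ξ : ℂ} (hξ : ξ.im < 0) :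
    ∫ x in Ioi (0 : ℝ), invTransform (fun ξ => h ξ) x * exp (-(I * ξ * x)) =
      2 * Real.pi * h ξ := by
  have hh := integrable_of_bound hε hε' hp hd hb
  have hre : ∀ t : ℝ, (I * (t - ξ)).re < 0 := fun t => by simpa
  have e1 : ∀ x : ℝ, invTransform (fun ξ => h ξ) x * exp (-(I * ξ * x)) =
      ∫ t : ℝ, h t * exp (I * (t - ξ) * x) := by
    intro x
    rw [invTransform, ← integral_mul_const]
    congr 1 with t
    rw [mul_assoc, ← exp_add]
    ring_nf
  simp_rw [e1]
  have hexp : Integrable (fun x : ℝ => Real.exp (ξ.im * x)) (volume.restrict (Ioi 0)) :=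
    integrableOn_exp_mul_Ioi hξ 0
  have hprod : Integrable (Function.uncurry fun (x t : ℝ) => h t * exp (I * (t - ξ) * x))
      ((volume.restrict (Ioi 0)).prod volume) := by
    refine (hexp.mul_prod hh.norm).mono' ?_ (Eventually.of_forall fun q => ?_)
    · refine hh.1.comp_snd.mul (Continuous.aestronglyMeasurable ?_)
      fun_prop
    · simp only [Function.uncurry]
      rw [norm_mul, norm_exp_I_mul]
      simp [mul_comm]
  rw [integral_integral_swap hprod]
  have e2 : ∀ t : ℝ, ∫ x in Ioi (0 : ℝ), h t * exp (I * (t - ξ) * x) = I * (h t / (t - ξ)) := by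
    intro t
    rw [integral_const_mul, integral_exp_mul_complex_Ioi (hre t)]
    have h1 := ofReal_sub_ne_zero hξ.ne t
    simp only [ofReal_zero, mul_zero, exp_zero]
    field_simp
    simp
  simp_rw [e2]
  rw [integral_const_mul, integral_div_sub_of_lower (α := p) (by linarith) hξ
    (hd.continuousOn.mono fun z (hz : z.im ≤ 0) => by
      exact show z.im < ε' by linarith)
    (hd.mono fun z (hz : z.im < 0) => by exact show z.im < ε' by linarith)
    fun z hz => hb z (by linarith)]
  linear_combination (-(2 * Real.pi * h ξ)) * I_sq

end Analytic

lemma integral_kernel_mul_invTransform {k : ℂ} (hk : 0 < k.im) {h : ℝ → ℂ} (hh : Integrable h)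
    (x : ℝ) : ∫ y : ℝ, kernel k (x - y) * invTransform h y =
      invTransform (fun ξ => h ξ * kernelHat k ξ) x := by
  have hK := (integrable_kernel hk).comp_sub_left x
  have e1 : ∀ y : ℝ, kernel k (x - y) * invTransform h y =
      ∫ ξ : ℝ, kernel k (x - y) * (h ξ * exp (I * ξ * y)) := fun y => by
    rw [invTransform, integral_const_mul]
  simp_rw [e1]
  have hprod : Integrable (Function.uncurry fun (y ξ : ℝ) =>
      kernel k (x - y) * (h ξ * exp (I * ξ * y))) (volume.prod volume) := by
    refine (hK.norm.mul_prod hh.norm).mono' ?_ (Eventually.of_forall fun q => ?_)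
    · refine hK.1.comp_fst.mul (hh.1.comp_snd.mul (Continuous.aestronglyMeasurable ?_))
      fun_prop
    · simp only [Function.uncurry]
      rw [norm_mul, norm_mul, norm_exp_I_mul_ofReal, mul_one]
  rw [integral_integral_swap hprod, invTransform]
  congr 1 with ξ
  have e2 : ∀ y : ℝ, kernel k (x - y) * (h ξ * exp (I * ξ * y)) =
      (h ξ * exp (I * ξ * x)) * (kernel k (x - y) * exp (-(I * ξ * (x - y : ℝ)))) := by
    intro y
    have : exp (I * ξ * y) = exp (I * ξ * x) * exp (-(I * ξ * (x - y : ℝ))) := by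
      rw [← exp_add]; push_cast; ring_nf
    rw [this]; ring
  simp_rw [e2]
  rw [integral_const_mul,
    integral_sub_left_eq_self (fun y : ℝ => kernel k y * exp (-(I * ξ * y))) volume x, ← kernelHat]
  ring

end HalfPlane

/-! ### Existence: the Fourier integral solves the equation. -/

namespace HalfPlane

open Complex

/-- The transform, up to a constant factor, of the solution of the half-line equation. -/
noncomputable def density (F : ℂ → ℂ) (κ z : ℂ) : ℂ := exp (-F (-z)) / (z - κ)

lemma norm_mul_I_mul_le {f : ℝ → ℂ} {C p : ℝ} (h : ∀ x, ‖f x‖ ≤ C * (1 + |x|) ^ (-p)) (x : ℝ) :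
    ‖I * x * f x‖ ≤ C * (1 + |x|) ^ (-(p - 1)) := by
  have : -(p - 1) = 1 + -p := by ring
  rw [this, Real.rpow_add (by positivity), Real.rpow_one, norm_mul, norm_mul, norm_I, one_mul,
    norm_real, Real.norm_eq_abs, ← mul_assoc, mul_comm C, mul_assoc]
  exact mul_le_mul (by linarith) (h x) (norm_nonneg _) (by positivity)

namespace IsSplitting

variable {Q : ℝ → ℂ} {F : ℂ → ℂ} {δ C : ℝ} {κ : ℂ}

/-- The exponential contributes decay `1/2` and the pole factor `1`; holomorphy extends above the
real axis up to the lower of the heights `δ` and `Im κ`. -/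
lemma exists_density_bound (h : IsSplitting Q F δ C) (hκ : 0 < κ.im) :
    ∃ ε ε' D, 0 < ε ∧ ε < ε' ∧ DifferentiableOn ℂ (density F κ) {z | z.im < ε'} ∧
      ∀ z : ℂ, z.im ≤ ε → ‖density F κ z‖ ≤ D * (1 + ‖z‖) ^ (-(3 / 2) : ℝ) := by
  have hpos : 0 < min δ κ.im := lt_min h.pos hκ
  refine ⟨min δ κ.im / 2, min δ κ.im, C * (1 + (1 + ‖κ‖) / (κ.im / 2)), half_pos hpos,
    half_lt_self hpos, ?_, fun z hz => ?_⟩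
  · refine DifferentiableOn.div ?_ (by fun_prop) fun z hz h0 => ?_
    · exact (h.differentiableOn_comp_neg.neg.mono fun z (hz : z.im < min δ κ.im) =>
        show z.im < δ from lt_of_lt_of_le hz (min_le_left _ _)).cexp
    · have h1 : z.im < κ.im := lt_of_lt_of_le hz (min_le_right _ _)
      have := congrArg im h0
      simp at this; linarith
  · have hm1 := min_le_left δ κ.im
    have hm2 := min_le_right δ κ.im
    have hδ := h.pos
    have h1 := h.norm_exp_neg_le (-z) (by rw [neg_im]; linarith)
    have h2 := norm_inv_sub_le (z := κ) (ζ := z) (half_pos hκ) (by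
      have := im_sub_im_le_norm_sub κ z
      rw [norm_sub_rev] at this
      linarith)
    rw [norm_neg] at h1
    rw [density, norm_div, div_eq_mul_inv]
    refine (mul_le_mul h1 h2 (by positivity) (mul_nonneg h.const_nonneg (by positivity))).trans_eq ?_
    have : (-(3 / 2) : ℝ) = -(1 / 2) + -1 := by norm_num
    rw [this, Real.rpow_add (by positivity)]
    ring

variable {k ς : ℂ}

/-- Dividing `e^{F(ξ)}` by the symbol `e^{F(ξ) + F(-ξ)}` exchanges a factor holomorphic above for
one holomorphic below. -/
lemma fourierIntegrand_eq (h : IsSplitting Q F δ C) (hQ : ∀ ζ, exp (Q ζ) = symbolP k ς ζ)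
    (x ξ : ℝ) : fourierIntegrand k ς κ Q x ξ = density F κ ξ * exp (I * ξ * x) := by
  have e : exp (F ξ) / symbolP k ς ξ = exp (-F (-ξ)) := by
    rw [← hQ, h.add_neg, exp_add, exp_neg]
    have := exp_ne_zero (F ξ)
    field_simp
  rw [fourierIntegrand, h.splitPlusReal_eq, e, density]
  ring

lemma fourierSolution_eq (h : IsSplitting Q F δ C) (hQ : ∀ ζ, exp (Q ζ) = symbolP k ς ζ)
    (hκ : 0 < κ.im) (x : ℝ) : fourierSolution k ς κ Q x =
      exp (-F κ) / (2 * Real.pi * I) * invTransform (fun ξ => density F κ ξ) x := by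
  rw [fourierSolution, h.splitPlus_eq hκ, invTransform]
  simp_rw [h.fourierIntegrand_eq hQ]

/-- The Fourier integral vanishes for `x ≤ 0`, so integrating over the half-line equals convolving
over the whole line, where the kernel acts as a multiplier. -/
lemma potential_fourierSolution (h : IsSplitting Q F δ C) (hQ : ∀ ζ, exp (Q ζ) = symbolP k ς ζ)
    (hk : 0 < k.im) (hκ : 0 < κ.im) (x : ℝ) : potential k (fourierSolution k ς κ Q) x =
      exp (-F κ) / (2 * Real.pi * I) *
        invTransform (fun ξ => density F κ ξ * kernelHat k ξ) x := by
  obtain ⟨ε, ε', D, hε, hε', hd, hb⟩ := h.exists_density_bound hκ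
  rw [potential, setIntegral_eq_integral_of_forall_compl_eq_zero,
    ← integral_kernel_mul_invTransform hk (integrable_of_bound hε hε' (by norm_num) hd hb),
    ← integral_const_mul]
  · congr 1 with y
    rw [h.fourierSolution_eq hQ hκ]
    ring
  · intro y hy
    rw [h.fourierSolution_eq hQ hκ,
      invTransform_eq_zero hε hε' (by norm_num) hd hb (not_lt.1 hy), mul_zero, mul_zero]

lemma integral_exp_div (h : IsSplitting Q F δ C) (hk : 0 < k.im) {x : ℝ} (hx : 0 ≤ x) {z : ℂ}
    (hz : 0 < z.im) : ∫ ξ : ℝ, exp (F ξ) * exp (I * ξ * x) * ((ξ : ℂ) + k)⁻¹ / (ξ - z) =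
      2 * Real.pi * I * (exp (F z) * exp (I * z * x) * (z + k)⁻¹) := by
  have hne : ∀ z : ℂ, 0 ≤ z.im → z + k ≠ 0 := fun z hz h0 => by
    have := congrArg im h0
    simp at this; linarith
  have hd : DifferentiableOn ℂ (fun z : ℂ => (z + k)⁻¹) {z | 0 ≤ z.im} := fun z hz => by
    have := hne z hz
    exact (by fun_prop (disch := assumption) :
      DifferentiableAt ℂ (fun z : ℂ => (z + k)⁻¹) z).differentiableWithinAt
  have he : Differentiable ℂ fun z : ℂ => exp (I * z * x) := by fun_prop
  refine integral_div_sub_of_upper (f := fun z => exp (F z) * exp (I * z * x) * (z + k)⁻¹)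
    (α := 1 / 2) (C := C * (1 + (1 + ‖-k‖) / k.im)) (by norm_num) hz
    ((h.continuousOn_closed.cexp.mul he.continuous.continuousOn).mul hd.continuousOn)
    ((h.differentiableOn_upper.cexp.mul he.differentiableOn).mul
      (hd.mono fun z (hz : 0 < z.im) => hz.le)) fun z hz => ?_
  have h1 := norm_inv_sub_le (z := -k) (ζ := z) hk (by
    have := im_sub_im_le_norm_sub z (-k)
    rw [neg_im] at this
    linarith)
  rw [sub_neg_eq_add] at h1
  have h2 := h.norm_exp_le z (by linarith [h.pos])
  have h3 : Real.exp (-z.im * x) ≤ 1 := by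
    rw [Real.exp_le_one_iff]; nlinarith
  rw [norm_mul, norm_mul, norm_exp_I_mul, norm_inv]
  refine (mul_le_mul ((mul_le_of_le_one_right (norm_nonneg _) h3).trans h2) h1 (by positivity)
    (mul_nonneg h.const_nonneg (by positivity))).trans_eq ?_
  have : (-(1 / 2) : ℝ) = 1 / 2 + -1 := by norm_num
  rw [this, Real.rpow_add (by positivity)]
  ring

lemma norm_exp_div_le (h : IsSplitting Q F δ C) (hk : 0 < k.im) (hκ : 0 < κ.im) :
    ∃ D, ∀ ξ : ℝ, ‖exp (F ξ) / ((ξ - κ) * (k ^ 2 - (ξ : ℂ) ^ 2))‖ ≤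
      D * (1 + |ξ|) ^ (-(5 / 2) : ℝ) := by
  refine ⟨C * ((1 + (1 + ‖κ‖) / κ.im) * ((1 + (1 + ‖k‖) / k.im) * (1 + (1 + ‖-k‖) / k.im))),
    fun ξ => ?_⟩
  have e : exp (F ξ) / ((ξ - κ) * (k ^ 2 - (ξ : ℂ) ^ 2)) =
      -(exp (F ξ) * (((ξ : ℂ) - κ)⁻¹ * (((ξ : ℂ) - k) * ((ξ : ℂ) - -k))⁻¹)) := by
    rw [← mul_inv, ← div_eq_mul_inv, ← div_neg]
    congr 1
    ring
  have h1 := norm_inv_sub_le (z := κ) (ζ := ξ) hκ (by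
    simpa [abs_of_pos hκ] using abs_im_le_norm_ofReal_sub ξ κ)
  have h2 := norm_inv_sub_mul_le (z := k) (z' := -k) (ζ := ξ) hk
    (by simpa [abs_of_pos hk] using abs_im_le_norm_ofReal_sub ξ k)
    (by simpa [abs_of_pos hk] using abs_im_le_norm_ofReal_sub ξ (-k))
  have h3 := h.norm_exp_le ξ (by simpa using h.pos)
  rw [e, norm_neg, norm_mul, norm_mul, norm_inv ((ξ : ℂ) - κ)]
  refine (mul_le_mul h3 (mul_le_mul h1 h2 (norm_nonneg _) (by positivity)) (by positivity)
    (mul_nonneg h.const_nonneg (by positivity))).trans_eq ?_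
  have : (-(5 / 2) : ℝ) = 1 / 2 + (-1 + -2) := by norm_num
  rw [this, Real.rpow_add (by positivity), Real.rpow_add (by positivity), norm_real,
    Real.norm_eq_abs]
  ring

/-- For `x ≥ 0` the contour closes upward, where the poles are `κ` and `k`. They are distinct, so
partial fractions reduce the residues to two applications of Cauchy's formula, with `(ξ + k)⁻¹` kept
to ensure decay. -/
lemma invTransform_exp_div (h : IsSplitting Q F δ C) (hk : 0 < k.im) (hκ : 0 < κ.im)
    (hκk : κ ≠ k) {x : ℝ} (hx : 0 ≤ x) :
    invTransform (fun ξ => exp (F ξ) / ((ξ - κ) * (k ^ 2 - (ξ : ℂ) ^ 2))) x =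
      2 * Real.pi * I * (exp (F k) / (2 * k * (κ - k)) * exp (I * k * x) -
        exp (F κ) / (κ ^ 2 - k ^ 2) * exp (I * κ * x)) := by
  have hne : ∀ z : ℂ, 0 ≤ z.im → z + k ≠ 0 := fun z hz h0 => by
    have := congrArg im h0
    simp at this; linarith
  have hsub : κ - k ≠ 0 := sub_ne_zero.2 hκk
  have hk0 : k ≠ 0 := fun h => by simp [h] at hk
  have hκk' := hne κ hκ.le
  set f : ℝ → ℂ := fun ξ => exp (F ξ) * exp (I * ξ * x) * ((ξ : ℂ) + k)⁻¹ with hf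
  have hfb : ∃ D, ∀ ξ, ‖f ξ‖ ≤ D * (1 + |ξ|) ^ (-(1 / 2) : ℝ) := by
    refine ⟨C * (1 + (1 + ‖-k‖) / k.im), fun ξ => ?_⟩
    have h1 := norm_inv_sub_le (z := -k) (ζ := ξ) hk (by
      simpa [abs_of_pos hk] using abs_im_le_norm_ofReal_sub ξ (-k))
    rw [sub_neg_eq_add] at h1
    have h3 := h.norm_exp_le ξ (by simpa using h.pos)
    rw [norm_mul, norm_mul, norm_exp_I_mul_ofReal, mul_one, norm_inv]
    refine (mul_le_mul h3 h1 (by positivity) (mul_nonneg h.const_nonneg (by positivity))).trans_eq ?_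
    have : (-(1 / 2) : ℝ) = 1 / 2 + -1 := by norm_num
    rw [this, Real.rpow_add (by positivity), norm_real, Real.norm_eq_abs]
    ring
  obtain ⟨D, hD⟩ := hfb
  have hfm : AEStronglyMeasurable f := by
    refine Continuous.aestronglyMeasurable ((h.continuous_ofReal.cexp.mul (by fun_prop)).mul
      (Continuous.inv₀ (by fun_prop) fun ξ => hne ξ (by simp)))
  have i1 := integrable_div_sub (by norm_num) hfm hD hκ.ne'
  have i2 := integrable_div_sub (by norm_num) hfm hD hk.ne'
  have e : ∀ ξ : ℝ, exp (F ξ) / ((ξ - κ) * (k ^ 2 - (ξ : ℂ) ^ 2)) * exp (I * ξ * x) =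
      -(κ - k)⁻¹ * (f ξ / (ξ - κ) - f ξ / (ξ - k)) := by
    intro ξ
    have n1 := ofReal_sub_ne_zero hκ.ne' ξ
    have n2 := ofReal_sub_ne_zero hk.ne' ξ
    have n3 := hne ξ (by simp)
    have : k ^ 2 - (ξ : ℂ) ^ 2 = -((ξ - k) * (ξ + k)) := by ring
    rw [this]
    simp only [hf]
    field_simp
    ring
  rw [invTransform]
  simp_rw [e]
  rw [integral_const_mul, integral_sub i1 i2, h.integral_exp_div hk hx hκ,
    h.integral_exp_div hk hx hk]
  have : κ ^ 2 - k ^ 2 = (κ - k) * (κ + k) := by ring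
  rw [this, ← two_mul k]
  field_simp
  ring

/-- Here the Wiener–Hopf relation enters: `(iς/k) 𝒦̂ = (1 - 𝒫)/(k² - ξ²)`, and the symbol times the
density is `e^{F(ξ)}/(ξ - κ)`, which continues upward. The potential is thereby split into a smooth
part and a part computed by residues. -/
lemma density_mul_kernelHat (h : IsSplitting Q F δ C) (hQ : ∀ ζ, exp (Q ζ) = symbolP k ς ζ)
    (hk : 0 < k.im) (ξ : ℝ) :
    I * ς / k * (density F κ ξ * kernelHat k ξ) = density F κ ξ / (k ^ 2 - (ξ : ℂ) ^ 2) -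
      exp (F ξ) / ((ξ - κ) * (k ^ 2 - (ξ : ℂ) ^ 2)) := by
  have hne : k ^ 2 - (ξ : ℂ) ^ 2 ≠ 0 := by
    have h1 := ofReal_sub_ne_zero (z := k) hk.ne' ξ
    have h2 := ofReal_sub_ne_zero (z := -k) (by simpa using hk.ne') ξ
    have : k ^ 2 - (ξ : ℂ) ^ 2 = -((ξ - k) * (ξ - -k)) := by ring
    rw [this]
    exact neg_ne_zero.2 (mul_ne_zero h1 h2)
  have h1 : I * ς / k * kernelHat k ξ = (1 - symbolP k ς ξ) / (k ^ 2 - (ξ : ℂ) ^ 2) := by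
    rw [eq_div_iff hne, symbolP]
    ring
  have h2 : symbolP k ς ξ * density F κ ξ = exp (F ξ) / (ξ - κ) := by
    rw [← hQ, h.add_neg, exp_add, density, exp_neg]
    have := exp_ne_zero (F (-ξ))
    field_simp
  calc _ = density F κ ξ * (I * ς / k * kernelHat k ξ) := by ring
    _ = (density F κ ξ - symbolP k ς ξ * density F κ ξ) / (k ^ 2 - (ξ : ℂ) ^ 2) := by
      rw [h1]; ring
    _ = _ := by rw [h2, sub_div, div_div]

/-- The Fourier integral solves the half-line equation. -/
theorem isIntegrableSolution (h : IsSplitting Q F δ C) (hQ : ∀ ζ, exp (Q ζ) = symbolP k ς ζ)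
    (hk : 0 < k.im) (hς : ς ≠ 0) (hκ : 0 < κ.im) (hκk : κ ≠ k) :
    (∀ x : ℝ, Integrable (fourierIntegrand k ς κ Q x)) ∧
    Continuous (fourierSolution k ς κ Q) ∧
    BoundedAtEdge (fourierSolution k ς κ Q) ∧
    IsIntegrableSolution k ς (fun x : ℝ => exp (I * κ * x)) (fourierSolution k ς κ Q) ∧
    ∀ ξ : ℂ, ξ.im < 0 → ∫ x in Ioi (0 : ℝ), fourierSolution k ς κ Q x * exp (-(I * ξ * x)) =
      exp (-F κ) * (-I * density F κ ξ) := by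
  obtain ⟨ε, ε', D, hε, hε', hd, hb⟩ := h.exists_density_bound hκ
  have hp : (1 : ℝ) < 3 / 2 := by norm_num
  have hpi : (Real.pi : ℂ) ≠ 0 := by exact_mod_cast Real.pi_ne_zero
  have hk0 : k ≠ 0 := fun h => by simp [h] at hk
  have hint := integrable_of_bound hε hε' hp hd hb
  set u := fourierSolution k ς κ Q with hu
  set c₀ : ℂ := exp (-F κ) / (2 * Real.pi * I) with hc₀
  have hueq : ∀ x, u x = c₀ * invTransform (fun ξ => density F κ ξ) x := h.fourierSolution_eq hQ hκ
  have hucont : Continuous u := by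
    have := continuous_const.mul (continuous_invTransform hint) (f := fun _ : ℝ => c₀)
    exact this.congr fun x => (hueq x).symm
  obtain ⟨B, hB⟩ := norm_invTransform_le hε hε' hp hd hb
  have hbound : ∀ x, 0 ≤ x → ‖u x‖ ≤ ‖c₀‖ * B * Real.exp (-ε * x) := fun x hx => by
    rw [hueq, norm_mul, mul_assoc]
    exact mul_le_mul_of_nonneg_left (hB x hx) (norm_nonneg _)
  have hB0 : 0 ≤ ‖c₀‖ * B := by simpa using (norm_nonneg _).trans (hbound 0 le_rfl)
  have hbound' : ∀ x, 0 ≤ x → ‖u x‖ ≤ ‖c₀‖ * B := fun x hx => (hbound x hx).trans <|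
    mul_le_of_le_one_right hB0 (Real.exp_le_one_iff.2 (by nlinarith))
  have huint : IntegrableOn u (Ioi 0) := by
    refine ((integrableOn_exp_mul_Ioi (neg_lt_zero.2 hε) 0).const_mul (‖c₀‖ * B)).mono'
      hucont.aestronglyMeasurable ?_
    filter_upwards [ae_restrict_mem measurableSet_Ioi] with x hx
    exact hbound x (le_of_lt hx)
  have hconv : ∀ x : ℝ, 0 < x → IntegrableOn (fun y => kernel k (x - y) * u y) (Ioi 0) := by
    intro x _
    have hK := ((integrable_kernel hk).comp_sub_left x).integrableOn (s := Ioi 0)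
    refine Integrable.mul_bdd (c := ‖c₀‖ * B) hK hucont.aestronglyMeasurable ?_
    filter_upwards [ae_restrict_mem measurableSet_Ioi] with y hy
    exact hbound' y (le_of_lt hy)
  -- the potential and its derivatives on `(0, ∞)`
  set H : ℝ → ℂ := fun ξ => density F κ ξ / (k ^ 2 - (ξ : ℂ) ^ 2) with hH
  have hne : ∀ ξ : ℝ, k ^ 2 - (ξ : ℂ) ^ 2 ≠ 0 := fun ξ => by
    have h1 := ofReal_sub_ne_zero (z := k) hk.ne' ξ
    have h2 := ofReal_sub_ne_zero (z := -k) (by simpa using hk.ne') ξ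
    have : k ^ 2 - (ξ : ℂ) ^ 2 = -((ξ - k) * (ξ - -k)) := by ring
    rw [this]
    exact neg_ne_zero.2 (mul_ne_zero h1 h2)
  have hdc : Continuous fun ξ : ℝ => density F κ ξ :=
    hd.continuousOn.comp_continuous Complex.continuous_ofReal fun x => by simpa using hε.trans hε'
  have hHc : Continuous H := hdc.div (by fun_prop) hne
  -- Decay `3/2` from the density plus `2` from the denominator. Two differentiations cost two
  -- powers and leave `3/2`, still integrable.
  obtain ⟨E, hE⟩ : ∃ E, ∀ ξ, ‖H ξ‖ ≤ E * (1 + |ξ|) ^ (-(7 / 2) : ℝ) := by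
    refine ⟨D * ((1 + (1 + ‖k‖) / k.im) * (1 + (1 + ‖-k‖) / k.im)), fun ξ => ?_⟩
    have h2 := norm_inv_sub_mul_le (z := k) (z' := -k) (ζ := ξ) hk
      (by simpa [abs_of_pos hk] using abs_im_le_norm_ofReal_sub ξ k)
      (by simpa [abs_of_pos hk] using abs_im_le_norm_ofReal_sub ξ (-k))
    have h3 := hb ξ (by simpa using hε.le)
    have e : H ξ = -(density F κ ξ * (((ξ : ℂ) - k) * ((ξ : ℂ) - -k))⁻¹) := by
      rw [← div_eq_mul_inv, ← div_neg]
      simp only [hH]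
      congr 1
      ring
    rw [e, norm_neg, norm_mul]
    refine (mul_le_mul h3 h2 (norm_nonneg _) ((norm_nonneg _).trans h3)).trans_eq ?_
    have : (-(7 / 2) : ℝ) = -(3 / 2) + -2 := by norm_num
    rw [this, Real.rpow_add (by positivity), norm_real, Real.norm_eq_abs]
    ring
  have hE1 := norm_mul_I_mul_le hE
  have hE2 := norm_mul_I_mul_le hE1
  have iH : Integrable H := integrable_of_norm_le_rpow (by norm_num) hHc.aestronglyMeasurable hE
  have iH1 : Integrable fun ξ : ℝ => I * ξ * H ξ :=
    integrable_of_norm_le_rpow (by norm_num)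
      (Continuous.aestronglyMeasurable (by fun_prop)) hE1
  have iH2 : Integrable fun ξ : ℝ => I * ξ * (I * ξ * H ξ) :=
    integrable_of_norm_le_rpow (by norm_num)
      (Continuous.aestronglyMeasurable (by fun_prop)) hE2
  obtain ⟨E', hE'⟩ := h.norm_exp_div_le hk hκ
  have iG : Integrable fun ξ : ℝ => exp (F ξ) / ((ξ - κ) * (k ^ 2 - (ξ : ℂ) ^ 2)) :=
    integrable_of_norm_le_rpow (by norm_num) (h.continuous_ofReal.cexp.div (by fun_prop)
      fun ξ => mul_ne_zero (ofReal_sub_ne_zero hκ.ne' ξ) (hne ξ)).aestronglyMeasurable hE'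
  set a : ℂ := I * ς / k with ha
  have ha0 : a ≠ 0 := div_ne_zero (mul_ne_zero I_ne_zero hς) hk0
  set α : ℂ := 2 * Real.pi * I * (exp (F k) / (2 * k * (κ - k))) with hα
  set β : ℂ := -(2 * Real.pi * I * (exp (F κ) / (κ ^ 2 - k ^ 2))) with hβ
  have hV : ∀ x : ℝ, 0 < x → potential k u x =
      c₀ / a * (invTransform H x - (α * exp (I * k * x) + β * exp (I * κ * x))) := by
    intro x hx
    have h1 : a * invTransform (fun ξ => density F κ ξ * kernelHat k ξ) x =
        invTransform H x -
          invTransform (fun ξ => exp (F ξ) / ((ξ - κ) * (k ^ 2 - (ξ : ℂ) ^ 2))) x := by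
      simp only [invTransform]
      rw [← integral_const_mul, ← integral_sub (integrable_mul_exp_I iH x)
        (integrable_mul_exp_I iG x)]
      congr 1 with ξ
      rw [← mul_assoc, h.density_mul_kernelHat hQ hk, sub_mul]
    rw [hu, h.potential_fourierSolution hQ hk hκ, ← hc₀]
    rw [h.invTransform_exp_div hk hκ hκk hx.le] at h1
    have h2 : invTransform (fun ξ => density F κ ξ * kernelHat k ξ) x = a⁻¹ *
        (a * invTransform (fun ξ => density F κ ξ * kernelHat k ξ) x) := by
      field_simp
    rw [h2, h1, hα, hβ]
    ring
  have hexpd : ∀ (z : ℂ) (x : ℝ), HasDerivAt (fun x : ℝ => exp (I * z * x))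
      (I * z * exp (I * z * x)) x := fun z x => by
    have h1 : HasDerivAt (fun x : ℝ => I * z * (x : ℂ)) (I * z * 1) x :=
      (hasDerivAt_id x).ofReal_comp.const_mul _
    exact h1.cexp.congr_deriv (by ring)
  have hd1 : ∀ x : ℝ, 0 < x → HasDerivAt (potential k u) (c₀ / a *
      (invTransform (fun ξ => I * ξ * H ξ) x -
        (α * (I * k * exp (I * k * x)) + β * (I * κ * exp (I * κ * x))))) x := by
    intro x hx
    refine HasDerivAt.congr_of_eventuallyEq (((hasDerivAt_invTransform iH iH1 x).sub
      (((hexpd k x).const_mul α).add ((hexpd κ x).const_mul β))).const_mul (c₀ / a)) ?_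
    filter_upwards [eventually_gt_nhds hx] with y hy
    exact hV y hy
  have hd2 : ∀ x : ℝ, 0 < x → HasDerivAt (deriv (potential k u)) (c₀ / a *
      (invTransform (fun ξ => I * ξ * (I * ξ * H ξ)) x -
        (α * (I * k * (I * k * exp (I * k * x))) +
          β * (I * κ * (I * κ * exp (I * κ * x)))))) x := by
    intro x hx
    refine HasDerivAt.congr_of_eventuallyEq (((hasDerivAt_invTransform iH1 iH2 x).sub
      ((((hexpd k x).const_mul (I * k)).const_mul α).add
        (((hexpd κ x).const_mul (I * κ)).const_mul β))).const_mul (c₀ / a)) ?_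
    filter_upwards [eventually_gt_nhds hx] with y hy
    exact (hd1 y hy).deriv
  refine ⟨fun x => ?_, hucont, ⟨‖c₀‖ * B, 1, one_pos, fun x hx => hbound' x hx.1.le⟩,
    ⟨huint, hconv, fun x hx => (hd1 x hx).differentiableAt,
      fun x hx => (hd2 x hx).differentiableAt, fun x hx => ?_⟩, fun ξ hξ => ?_⟩
  · exact (integrable_mul_exp_I hint x).congr
      (Eventually.of_forall fun ξ => (h.fourierIntegrand_eq hQ x ξ).symm)
  · rw [(hd2 x hx).deriv, hV x hx, hueq]
    have h1 : invTransform (fun ξ => I * ξ * (I * ξ * H ξ)) x + k ^ 2 * invTransform H x =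
        invTransform (fun ξ => density F κ ξ) x := by
      simp only [invTransform]
      rw [← integral_const_mul, ← integral_add (integrable_mul_exp_I iH2 x)
        ((integrable_mul_exp_I iH x).const_mul _)]
      congr 1 with ξ
      have := hne ξ
      simp only [hH]
      field_simp
      ring_nf
      rw [I_sq]
      ring
    have h2 : κ ^ 2 - k ^ 2 ≠ 0 := by
      have h3 : κ + k ≠ 0 := fun h0 => by
        have := congrArg im h0
        simp at this; linarith
      have : κ ^ 2 - k ^ 2 = (κ - k) * (κ + k) := by ring
      rw [this]
      exact mul_ne_zero (sub_ne_zero.2 hκk) h3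
    -- The prefactor `e^{-F(κ)}/(2πi)` is chosen so that the residue at `κ` reproduces the incident
    -- wave with amplitude exactly one.
    have h3 : c₀ * β * (k ^ 2 - κ ^ 2) = 1 := by
      have h4 := exp_ne_zero (F κ)
      rw [hc₀, hβ, exp_neg]
      field_simp
      ring
    have h5 : a * (c₀ / a) = c₀ := by field_simp
    rw [← h1]
    linear_combination (-(invTransform (fun ξ => I * ξ * (I * ξ * H ξ)) x -
        (α * (I * k * (I * k * exp (I * k * x))) + β * (I * κ * (I * κ * exp (I * κ * x)))) +
        k ^ 2 * (invTransform H x - (α * exp (I * k * x) + β * exp (I * κ * x))))) * h5 +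
      exp (I * κ * x) * h3 +
      (c₀ * (α * k ^ 2 * exp (I * k * x) + β * κ ^ 2 * exp (I * κ * x))) * I_sq
  · simp_rw [hueq, mul_assoc c₀]
    rw [integral_const_mul, integral_invTransform_mul_exp hε hε' hp hd hb hξ, hc₀]
    field_simp
    ring_nf
    rw [I_sq]
    ring

end IsSplitting

end HalfPlane

/-! ### One-sided transforms, and a Liouville argument across the real line. -/

namespace HalfPlane

open Complex

/-- The one-sided Fourier transform `∫₀^∞ g(x) e^{-iξx} dx`, for `Im ξ ≤ 0`. -/
noncomputable def halfTransform (g : ℝ → ℂ) (ξ : ℂ) : ℂ :=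
  ∫ x in Ioi (0 : ℝ), g x * exp (-(I * ξ * x))

lemma norm_exp_neg_I_mul (z : ℂ) (x : ℝ) : ‖exp (-(I * z * x))‖ = Real.exp (z.im * x) := by
  rw [norm_exp, neg_re, re_mul_ofReal]; simp

lemma norm_exp_neg_I_mul_le_one {z : ℂ} (hz : z.im ≤ 0) {x : ℝ} (hx : x ∈ Ioi (0 : ℝ)) :
    ‖exp (-(I * z * x))‖ ≤ 1 := by
  rw [norm_exp_neg_I_mul, Real.exp_le_one_iff]
  exact mul_nonpos_of_nonpos_of_nonneg hz (le_of_lt hx)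

lemma integrableOn_mul_exp {g : ℝ → ℂ} (hg : IntegrableOn g (Ioi 0)) {z : ℂ} (hz : z.im ≤ 0) :
    IntegrableOn (fun x => g x * exp (-(I * z * x))) (Ioi 0) := by
  refine Integrable.mul_bdd (c := 1) hg (by fun_prop) ?_
  filter_upwards [ae_restrict_mem measurableSet_Ioi] with x hx
  exact norm_exp_neg_I_mul_le_one hz hx

lemma norm_halfTransform_le {g : ℝ → ℂ} (hg : IntegrableOn g (Ioi 0)) {z : ℂ} (hz : z.im ≤ 0) :
    ‖halfTransform g z‖ ≤ ∫ x in Ioi (0 : ℝ), ‖g x‖ := by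
  refine norm_integral_le_of_norm_le hg.norm ?_
  filter_upwards [ae_restrict_mem measurableSet_Ioi] with x hx
  rw [norm_mul]
  exact mul_le_of_le_one_right (norm_nonneg _) (norm_exp_neg_I_mul_le_one hz hx)

lemma continuousOn_halfTransform {g : ℝ → ℂ} (hg : IntegrableOn g (Ioi 0)) :
    ContinuousOn (halfTransform g) {z | z.im ≤ 0} := by
  refine continuousOn_of_dominated (bound := fun x => ‖g x‖)
    (fun z hz => (integrableOn_mul_exp hg hz).1) (fun z hz => ?_) hg.norm
    (Eventually.of_forall fun x => by fun_prop)
  filter_upwards [ae_restrict_mem measurableSet_Ioi] with x hx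
  rw [norm_mul]
  exact mul_le_of_le_one_right (norm_nonneg _) (norm_exp_neg_I_mul_le_one hz hx)

lemma differentiableOn_halfTransform {g : ℝ → ℂ} (hg : IntegrableOn g (Ioi 0)) :
    DifferentiableOn ℂ (halfTransform g) {z | z.im < 0} := by
  intro z hz
  have hz0 : z.im < 0 := hz
  set r : ℝ := -z.im / 2 with hr
  have hr0 : 0 < r := by rw [hr]; linarith
  have him : ∀ w ∈ Metric.ball z r, w.im ≤ -r := by
    intro w hw
    rw [Metric.mem_ball, dist_eq_norm] at hw
    have := im_sub_im_le_norm_sub w z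
    linarith
  have key := hasDerivAt_integral_of_dominated_loc_of_deriv_le (μ := volume.restrict (Ioi 0))
    (F := fun (w : ℂ) (x : ℝ) => g x * exp (-(I * w * x)))
    (F' := fun (w : ℂ) (x : ℝ) => g x * (exp (-(I * w * x)) * (-(I * x))))
    (bound := fun x => ‖g x‖ * r⁻¹) (x₀ := z) (Metric.ball_mem_nhds z hr0)
    (mem_of_superset (Metric.ball_mem_nhds z hr0) fun w hw =>
      (integrableOn_mul_exp hg ((him w hw).trans (by linarith))).1)
    (integrableOn_mul_exp hg hz0.le) (hg.1.mul (Continuous.aestronglyMeasurable (by fun_prop)))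
    ?_ (hg.norm.mul_const _) (Eventually.of_forall fun x w _ => ?_)
  · exact key.2.differentiableAt.differentiableWithinAt
  · filter_upwards [ae_restrict_mem measurableSet_Ioi] with x hx w hw
    have hx0 : (0 : ℝ) < x := hx
    rw [norm_mul, norm_mul, norm_exp_neg_I_mul, norm_neg, norm_mul, norm_I, one_mul, norm_real,
      Real.norm_of_nonneg hx0.le]
    refine mul_le_mul_of_nonneg_left ?_ (norm_nonneg _)
    have h1 : Real.exp (w.im * x) ≤ Real.exp (-(r * x)) :=
      Real.exp_le_exp.2 (by nlinarith [him w hw])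
    have h2 : r * x ≤ Real.exp (r * x) := by linarith [Real.add_one_le_exp (r * x)]
    have h3 : Real.exp (-(r * x)) * x ≤ r⁻¹ := by
      rw [Real.exp_neg, inv_mul_le_iff₀ (Real.exp_pos _), ← div_eq_mul_inv, le_div_iff₀ hr0,
        mul_comm]
      exact h2
    exact (mul_le_mul_of_nonneg_right h1 hx0.le).trans h3
  · have h1 : HasDerivAt (fun w : ℂ => -(I * w * x)) (-(I * 1 * x)) w :=
      (((hasDerivAt_id w).const_mul I).mul_const _).neg
    simpa using h1.cexp.const_mul (g x)

lemma integrable_potential {k : ℂ} (hk : 0 < k.im) {d : ℝ → ℂ} (hd : IntegrableOn d (Ioi 0)) :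
    Integrable (potential k d) := by
  have h := ((integrable_indicator_iff measurableSet_Ioi).2 hd).integrable_convolution
    (ContinuousLinearMap.mul ℂ ℂ) (integrable_kernel hk)
  refine h.congr (Eventually.of_forall fun x => ?_)
  rw [convolution_def, potential, ← integral_indicator measurableSet_Ioi]
  congr 1 with y
  by_cases hy : y ∈ Ioi (0 : ℝ) <;> simp [hy, mul_comm]

lemma integral_potential_mul_exp {k : ℂ} (hk : 0 < k.im) {d : ℝ → ℂ} (hd : IntegrableOn d (Ioi 0))
    (ξ : ℝ) : ∫ x : ℝ, potential k d x * exp (-(I * ξ * x)) =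
      kernelHat k ξ * halfTransform d ξ := by
  have h1 : IntegrableOn (fun x => d x * exp (-(I * ξ * x))) (Ioi 0) :=
    integrableOn_mul_exp hd (by simp)
  have h2 : Integrable (fun x : ℝ => kernel k x * exp (-(I * ξ * x))) := by
    refine Integrable.mul_bdd (c := 1) (integrable_kernel hk) (by fun_prop)
      (Eventually.of_forall fun x => ?_)
    rw [norm_exp_neg_I_mul]; simp
  have h := integral_convolution (ContinuousLinearMap.mul ℂ ℂ)
    ((integrable_indicator_iff measurableSet_Ioi).2 h1) h2
  rw [integral_indicator measurableSet_Ioi, ContinuousLinearMap.mul_apply'] at h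
  rw [kernelHat, halfTransform]
  refine Eq.trans ?_ (h.trans (mul_comm _ _))
  congr 1 with x
  rw [convolution_def, potential, ← integral_indicator measurableSet_Ioi, ← integral_mul_const]
  congr 1 with y
  by_cases hy : y ∈ Ioi (0 : ℝ)
  · have : exp (-(I * ξ * x)) = exp (-(I * ξ * y)) * exp (-(I * ξ * (x - y : ℝ))) := by
      rw [← exp_add]; push_cast; ring_nf
    simp only [hy, indicator_of_mem, ContinuousLinearMap.mul_apply']
    rw [this]
    ring
  · simp [hy]

/-- Both claims come from `φ(x) = φ(1) - ∫ₓ¹ φ'`. -/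
lemma exists_limit_of_deriv_integrable {φ φ' : ℝ → ℂ} (hd : ∀ x, 0 < x → HasDerivAt φ (φ' x) x)
    (hi : IntegrableOn φ' (Ioi 0)) :
    (∃ L, Tendsto φ (𝓝[>] 0) (𝓝 L)) ∧ ∃ B, ∀ x, 0 < x → ‖φ x‖ ≤ B := by
  have hsub : ∀ x, 0 < x → uIcc x 1 ⊆ Ioi (0 : ℝ) := fun x hx y hy =>
    lt_of_lt_of_le (lt_min hx one_pos) hy.1
  have heq : ∀ x, 0 < x → φ x = φ 1 - ∫ y in x..1, φ' y := by
    intro x hx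
    rw [intervalIntegral.integral_eq_sub_of_hasDerivAt (fun y hy => hd y (hsub x hx hy))
      (intervalIntegrable_iff.2 (hi.mono_set (uIoc_subset_uIcc.trans (hsub x hx))))]
    ring
  refine ⟨⟨φ 1 - ∫ y in (0 : ℝ)..1, φ' y, ?_⟩, ‖φ 1‖ + ∫ y in Ioi (0 : ℝ), ‖φ' y‖, fun x hx => ?_⟩
  · have hc := intervalIntegral.continuousOn_primitive_interval_left (f := φ') (a := 0) (b := 1)
      (μ := volume) (by
        rw [uIcc_of_le zero_le_one, integrableOn_Icc_iff_integrableOn_Ioc]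
        exact hi.mono_set fun y hy => hy.1)
    have h1 := (hc 0 (by simp)).tendsto
    rw [uIcc_of_le zero_le_one] at h1
    have h2 : 𝓝[>] (0 : ℝ) ≤ 𝓝[Icc 0 1] 0 := by
      rw [← nhdsWithin_Ioo_eq_nhdsGT zero_lt_one]
      exact nhdsWithin_mono _ Ioo_subset_Icc_self
    refine ((h1.mono_left h2).const_sub (φ 1)).congr' ?_
    filter_upwards [self_mem_nhdsWithin] with x hx
    exact (heq x hx).symm
  · rw [heq x hx]
    refine (norm_sub_le _ _).trans (add_le_add_right ?_ _)
    refine intervalIntegral.norm_integral_le_integral_norm_uIoc.trans ?_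
    exact setIntegral_mono_set hi.norm (Eventually.of_forall fun y => norm_nonneg _)
      (uIoc_subset_uIcc.trans (hsub x hx)).eventuallyLE

/-- If a function on the lower half-plane that grows like `|z|^{1/2}` and vanishes at infinity along
the imaginary axis has the same boundary values as a function on the upper half-plane that grows like
`|z|^{3/2}`, then it is zero. -/
lemma eq_zero_of_eq_on_real {f g : ℂ → ℂ} {A B : ℝ}
    (hfc : ContinuousOn f {z | z.im ≤ 0}) (hfd : DifferentiableOn ℂ f {z | z.im < 0})
    (hfb : ∀ z : ℂ, z.im ≤ 0 → ‖f z‖ ≤ A * (1 + ‖z‖) ^ (1 / 2 : ℝ))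
    (hgc : ContinuousOn g {z | 0 ≤ z.im}) (hgd : DifferentiableOn ℂ g {z | 0 < z.im})
    (hgb : ∀ z : ℂ, 0 ≤ z.im → ‖g z‖ ≤ B * (1 + ‖z‖) ^ (3 / 2 : ℝ))
    (hfg : ∀ x : ℝ, f x = g x)
    (hlim : Tendsto (fun t : ℝ => f (-(I * t))) atTop (𝓝 0)) :
    ∀ z : ℂ, z.im < 0 → f z = 0 := by
  have hA : 0 ≤ A := by simpa using (norm_nonneg _).trans (hfb 0 le_rfl)
  have hB : 0 ≤ B := by simpa using (norm_nonneg _).trans (hgb 0 le_rfl)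
  have hpi : (Real.pi : ℂ) ≠ 0 := by exact_mod_cast Real.pi_ne_zero
  have hI : ∀ ζ : ℂ, ζ.im ≤ 0 → ζ - I ≠ 0 := fun ζ hζ h0 => by
    have := congrArg im h0
    simp at this; linarith
  have hJd : DifferentiableOn ℂ (fun ζ : ℂ => (ζ - I)⁻¹) {z | z.im ≤ 0} := fun ζ hζ => by
    have := hI ζ hζ
    exact (by fun_prop (disch := assumption) :
      DifferentiableAt ℂ (fun z : ℂ => (z - I)⁻¹) ζ).differentiableWithinAt
  -- Dividing by a factor whose zero lies in the upper half-plane turns growth `1/2` into decay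
  -- `1/2`, so that Cauchy's formula applies in the lower half-plane.
  set φ : ℂ → ℂ := fun ζ => f ζ * (ζ - I)⁻¹ with hφ
  have hφb : ∀ z : ℂ, z.im ≤ 0 → ‖φ z‖ ≤ A * (1 + (1 + ‖I‖) / 1) * (1 + ‖z‖) ^ (-(1 / 2) : ℝ) := by
    intro z hz
    have h1 := norm_inv_sub_le (z := I) (ζ := z) one_pos (by
      have := im_sub_im_le_norm_sub I z
      rw [norm_sub_rev, I_im] at this
      linarith)
    rw [hφ, norm_mul, norm_inv]
    refine (mul_le_mul (hfb z hz) h1 (by positivity) (by positivity)).trans_eq ?_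
    have : (-(1 / 2) : ℝ) = 1 / 2 + -1 := by norm_num
    rw [this, Real.rpow_add (by positivity)]
    ring
  have hφc : ContinuousOn φ {z | z.im ≤ 0} := hfc.mul hJd.continuousOn
  have hφd : DifferentiableOn ℂ φ {z | z.im < 0} :=
    hfd.mul (hJd.mono fun z (hz : z.im < 0) => hz.le)
  have hφm : AEStronglyMeasurable fun x : ℝ => φ x :=
    (hφc.comp_continuous continuous_ofReal fun x => by simp).aestronglyMeasurable
  have hJ : ∀ z : ℂ, z.im < 0 → Integrable (fun x : ℝ => φ x / (x - z) * (z - I)) ∧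
      ∫ x : ℝ, φ x / (x - z) * (z - I) = -(2 * Real.pi * I * f z) := by
    intro z hz
    have h1 := integral_div_sub_of_lower (by norm_num) hz hφc hφd hφb
    refine ⟨(integrable_div_sub (α := 1 / 2) (by norm_num) hφm (fun t => by simpa using hφb t (by simp))
      hz.ne).mul_const _, ?_⟩
    have := hI z hz.le
    rw [integral_mul_const, h1, hφ]
    field_simp
  -- The relation says that `f` is affine. Three nodes are taken because three pole factors lower
  -- the growth `3/2` of `g` to the integrable decay `3/2`. This second divided difference replaces
  -- gluing `f` and `g` to an entire function.
  have hrel : ∀ z₀ z₁ z₂ : ℂ, z₀.im < 0 → z₁.im < 0 → z₂.im < 0 →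
      (z₂ - z₁) * f z₀ + (z₀ - z₂) * f z₁ + (z₁ - z₀) * f z₂ = 0 := by
    intro z₀ z₁ z₂ h₀ h₁ h₂
    have hne : ∀ z : ℂ, z.im < 0 → ∀ ζ : ℂ, 0 ≤ ζ.im → ζ - z ≠ 0 := by
      intro z hz ζ hζ h
      have := congrArg im h
      simp at this; linarith
    have hnorm : ∀ z : ℂ, z.im < 0 → ∀ ζ : ℂ, 0 ≤ ζ.im →
        ‖(ζ - z)⁻¹‖ ≤ (1 + (1 + ‖z‖) / (-z.im)) * (1 + ‖ζ‖) ^ (-1 : ℝ) := by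
      intro z hz ζ hζ
      rw [norm_inv]
      refine norm_inv_sub_le (by linarith) ?_
      have := im_sub_im_le_norm_sub ζ z
      linarith
    have hc : ∀ z : ℂ, z.im < 0 → 0 ≤ 1 + (1 + ‖z‖) / (-z.im) := fun z hz => by
      have : 0 < -z.im := by linarith
      positivity
    have hinv : ∀ z : ℂ, z.im < 0 → DifferentiableOn ℂ (fun ζ : ℂ => (ζ - z)⁻¹) {z | 0 ≤ z.im} := by
      intro z hz ζ hζ
      have := hne z hz ζ hζ
      exact (by fun_prop (disch := assumption) :
        DifferentiableAt ℂ (fun ζ : ℂ => (ζ - z)⁻¹) ζ).differentiableWithinAt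
    have hsub : {z : ℂ | 0 < z.im} ⊆ {z | 0 ≤ z.im} := fun z (hz : 0 < z.im) => hz.le
    have hGd := ((hinv z₀ h₀).mul (hinv z₁ h₁)).mul (hinv z₂ h₂)
    have hG := integral_eq_zero_of_upper
      (G := fun ζ => g ζ * ((ζ - z₀)⁻¹ * (ζ - z₁)⁻¹ * (ζ - z₂)⁻¹)) (p := 3 / 2)
      (C := B * ((1 + (1 + ‖z₀‖) / (-z₀.im)) * (1 + (1 + ‖z₁‖) / (-z₁.im)) *
        (1 + (1 + ‖z₂‖) / (-z₂.im)))) (by norm_num)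
      (hgc.mul hGd.continuousOn) (hgd.mul (hGd.mono hsub)) fun ζ hζ => by
        rw [norm_mul, norm_mul, norm_mul]
        have p0 := hc z₀ h₀
        have p1 := hc z₁ h₁
        have p2 := hc z₂ h₂
        refine (mul_le_mul (hgb ζ hζ) (mul_le_mul (mul_le_mul (hnorm z₀ h₀ ζ hζ) (hnorm z₁ h₁ ζ hζ)
          (norm_nonneg _) (by positivity)) (hnorm z₂ h₂ ζ hζ) (norm_nonneg _) (by positivity))
          (by positivity) (by positivity)).trans_eq ?_
        have : (-(3 / 2) : ℝ) = 3 / 2 + (-1 + (-1 + -1)) := by norm_num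
        rw [this, Real.rpow_add (by positivity), Real.rpow_add (by positivity),
          Real.rpow_add (by positivity)]
        ring
    obtain ⟨i0, e0⟩ := hJ z₀ h₀
    obtain ⟨i1, e1⟩ := hJ z₁ h₁
    obtain ⟨i2, e2⟩ := hJ z₂ h₂
    have hsum : ∫ x : ℝ, ((z₂ - z₁) * (φ x / (x - z₀) * (z₀ - I)) +
        (z₀ - z₂) * (φ x / (x - z₁) * (z₁ - I))) + (z₁ - z₀) * (φ x / (x - z₂) * (z₂ - I)) = 0 := by
      -- Each term is a weight times `f(x) ((x - zⱼ)⁻¹ - (x - I)⁻¹)`. The weights add up to zero, so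
      -- the pole at `I` cancels; what is left is the product of the three pole factors, and `f` may
      -- be replaced by `g` on the real line.
      have e : (fun x : ℝ => ((z₂ - z₁) * (φ x / (x - z₀) * (z₀ - I)) +
          (z₀ - z₂) * (φ x / (x - z₁) * (z₁ - I))) + (z₁ - z₀) * (φ x / (x - z₂) * (z₂ - I))) =
          fun x : ℝ => ((z₂ - z₁) * (z₀ - z₂) * (z₁ - z₀)) *
            -(g x * (((x : ℂ) - z₀)⁻¹ * ((x : ℂ) - z₁)⁻¹ * ((x : ℂ) - z₂)⁻¹)) := by
        ext x
        have n0 := hne z₀ h₀ x (by simp)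
        have n1 := hne z₁ h₁ x (by simp)
        have n2 := hne z₂ h₂ x (by simp)
        have n3 := hI x (by simp)
        simp only [hφ]
        rw [← hfg]
        field_simp
        ring
      rw [e, integral_const_mul, integral_neg, hG]
      simp
    have i01 : Integrable fun x : ℝ => (z₂ - z₁) * (φ x / (x - z₀) * (z₀ - I)) +
        (z₀ - z₂) * (φ x / (x - z₁) * (z₁ - I)) := (i0.const_mul _).add (i1.const_mul _)
    rw [integral_add i01 (i2.const_mul _),
      integral_add (i0.const_mul _) (i1.const_mul _), integral_const_mul, integral_const_mul,
      integral_const_mul, e0, e1, e2] at hsum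
    have h2pi : (2 * Real.pi * I : ℂ) ≠ 0 := by simp [hpi]
    apply mul_left_cancel₀ h2pi
    linear_combination -hsum
  -- Divide the affine relation by the third node and send that node to `-i∞`, where `f` tends to
  -- zero.
  have hconst : ∀ z₀ z₁ : ℂ, z₀.im < 0 → z₁.im < 0 → f z₀ = f z₁ := by
    intro z₀ z₁ h₀ h₁
    have hinv : Tendsto (fun t : ℝ => (-(I * t))⁻¹) atTop (𝓝 (0 : ℂ)) := by
      have : Tendsto (fun t : ℝ => I * ((t⁻¹ : ℝ) : ℂ)) atTop (𝓝 (I * ((0 : ℝ) : ℂ))) :=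
        ((continuous_ofReal.tendsto 0).comp tendsto_inv_atTop_zero).const_mul I
      rw [ofReal_zero, mul_zero] at this
      refine this.congr fun t => ?_
      rw [inv_neg, mul_inv, inv_I]
      push_cast
      ring
    have h1 : Tendsto (fun t : ℝ => (1 - z₁ * (-(I * t))⁻¹) * f z₀ +
        (z₀ * (-(I * t))⁻¹ - 1) * f z₁ + (z₁ - z₀) * (-(I * t))⁻¹ * f (-(I * t))) atTop
        (𝓝 ((1 - z₁ * 0) * f z₀ + (z₀ * 0 - 1) * f z₁ + (z₁ - z₀) * 0 * 0)) :=
      ((((hinv.const_mul z₁).const_sub 1).mul_const _).add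
        (((hinv.const_mul z₀).sub_const 1).mul_const _)).add ((hinv.const_mul _).mul hlim)
    have h2 : (fun t : ℝ => (1 - z₁ * (-(I * t))⁻¹) * f z₀ +
        (z₀ * (-(I * t))⁻¹ - 1) * f z₁ + (z₁ - z₀) * (-(I * t))⁻¹ * f (-(I * t))) =ᶠ[atTop]
        fun _ => 0 := by
      filter_upwards [eventually_gt_atTop 0] with t ht
      have ht0 : (-(I * t) : ℂ) ≠ 0 := by simp [ht.ne']
      have := hrel z₀ z₁ (-(I * t)) h₀ h₁ (by simpa)
      have h3 : (-(I * t))⁻¹ * ((-(I * t) - z₁) * f z₀ + (z₀ - -(I * t)) * f z₁ +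
        (z₁ - z₀) * f (-(I * t))) = 0 := by rw [this, mul_zero]
      rw [← h3]
      linear_combination (f z₁ - f z₀) * inv_mul_cancel₀ ht0
    have h4 := tendsto_nhds_unique (h1.congr' h2) tendsto_const_nhds
    linear_combination h4
  intro z hz
  refine tendsto_nhds_unique (tendsto_const_nhds.congr' ?_) hlim
  filter_upwards [eventually_gt_atTop 0] with t ht
  exact hconst z _ hz (by simpa)

end HalfPlane

/-! ### Uniqueness: the homogeneous equation. -/

namespace HalfPlane

open Complex

/-- Integrability of `W = V'` is not available. Instead `(W + iV) e^{-ix}` has the integrable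
derivative `(W' + V) e^{-ix}`, so it is bounded with a limit at the edge; as `W` is too, `V` can be
recovered. -/
lemma exists_limit_of_deriv_two_integrable {V W W' : ℝ → ℂ}
    (hV : ∀ x, 0 < x → HasDerivAt V (W x) x) (hW : ∀ x, 0 < x → HasDerivAt W (W' x) x)
    (iV : IntegrableOn V (Ioi 0)) (iW : IntegrableOn W' (Ioi 0)) :
    (∃ L, Tendsto V (𝓝[>] 0) (𝓝 L)) ∧ ∃ B, ∀ x, 0 < x → ‖V x‖ ≤ B := by
  obtain ⟨⟨L, hL⟩, B, hB⟩ := exists_limit_of_deriv_integrable hW iW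
  have he : ∀ x : ℝ, HasDerivAt (fun x : ℝ => exp (-(I * 1 * x))) (exp (-(I * 1 * x)) * -(I * 1)) x :=
    fun x => by
      have h1 : HasDerivAt (fun x : ℝ => -(I * 1 * (x : ℂ))) (-(I * 1 * 1)) x :=
        ((hasDerivAt_id x).ofReal_comp.const_mul _).neg
      simpa using h1.cexp
  have hd : ∀ x, 0 < x → HasDerivAt (fun x : ℝ => (W x + I * V x) * exp (-(I * 1 * x)))
      ((W' x + V x) * exp (-(I * 1 * x))) x := fun x hx => by
    refine (((hW x hx).add ((hV x hx).const_mul I)).mul (he x)).congr_deriv ?_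
    simp only [Pi.add_apply]
    linear_combination (-(V x * exp (-(I * 1 * x)))) * I_sq
  obtain ⟨⟨M, hM⟩, A, hA⟩ := exists_limit_of_deriv_integrable hd
    (integrableOn_mul_exp (z := 1) (iW.add iV) (by simp))
  have hVeq : ∀ x : ℝ, V x =
      -I * ((W x + I * V x) * exp (-(I * 1 * x)) * exp (I * 1 * x) - W x) := fun x => by
    rw [mul_assoc (W x + I * V x), ← exp_add]
    simp only [neg_add_cancel, exp_zero]
    linear_combination (V x) * I_sq
  refine ⟨⟨-I * (M * exp (I * 1 * (0 : ℝ)) - L), ?_⟩, A + B, fun x hx => ?_⟩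
  · have hc : Tendsto (fun x : ℝ => exp (I * 1 * x)) (𝓝[>] 0) (𝓝 (exp (I * 1 * (0 : ℝ)))) :=
      (Continuous.tendsto (by fun_prop) 0).mono_left nhdsWithin_le_nhds
    exact (((hM.mul hc).sub hL).const_mul (-I)).congr fun x => (hVeq x).symm
  · rw [hVeq x, norm_mul, norm_neg, norm_I, one_mul]
    refine (norm_sub_le _ _).trans (add_le_add ?_ (hB x hx))
    rw [norm_mul, norm_exp_I_mul, one_im, neg_zero, zero_mul, Real.exp_zero, mul_one]
    exact hA x hx

/-- The one-sided transform of `W' = V''` in terms of that of `V` and of boundary values. -/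
lemma exists_halfTransform_deriv_two {V W W' : ℝ → ℂ}
    (hV : ∀ x, 0 < x → HasDerivAt V (W x) x) (hW : ∀ x, 0 < x → HasDerivAt W (W' x) x)
    (iV : IntegrableOn V (Ioi 0)) (iW : IntegrableOn W' (Ioi 0)) :
    ∃ V₀ V₁, ∀ z : ℂ, z.im ≤ 0 →
      halfTransform W' z = -z ^ 2 * halfTransform V z - (V₁ + I * z * V₀) := by
  obtain ⟨⟨V₁, hV₁⟩, B, hB⟩ := exists_limit_of_deriv_integrable hW iW
  obtain ⟨⟨V₀, hV₀⟩, A, hA⟩ := exists_limit_of_deriv_two_integrable hV hW iV iW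
  refine ⟨V₀, V₁, ?_⟩
  have hcl : ({z | z.im ≤ 0} : Set ℂ) ⊆ closure {z | z.im < 0} := by
    rw [closure_setOfPred_im_lt]
  -- `V` and `W` are only known to be bounded, so the boundary term at infinity is made to vanish by
  -- taking `Im z < 0`; the real axis is reached by continuity.
  refine Set.EqOn.of_subset_closure (s := {z : ℂ | z.im < 0}) (fun z hz => ?_)
    (continuousOn_halfTransform iW)
    (ContinuousOn.sub (ContinuousOn.mul (by fun_prop) (continuousOn_halfTransform iV))
      (by fun_prop)) (fun z (hz : z.im < 0) => hz.le) hcl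
  have hz0 : z.im < 0 := hz
  have he : ∀ x : ℝ, HasDerivAt (fun x : ℝ => exp (-(I * z * x))) (exp (-(I * z * x)) * -(I * z)) x :=
    fun x => by
      have h1 : HasDerivAt (fun x : ℝ => -(I * z * (x : ℂ))) (-(I * z * 1)) x :=
        ((hasDerivAt_id x).ofReal_comp.const_mul _).neg
      simpa using h1.cexp
  have i1 := integrableOn_mul_exp iW hz0.le
  have i2 := (integrableOn_mul_exp iV hz0.le).const_mul (z ^ 2)
  have hc : Tendsto (fun x : ℝ => exp (-(I * z * x))) (𝓝[>] 0) (𝓝 1) := by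
    have : Continuous fun x : ℝ => exp (-(I * z * x)) := by fun_prop
    simpa using (this.tendsto 0).mono_left nhdsWithin_le_nhds
  have h0 := (hV₁.add (hV₀.const_mul (I * z))).mul hc
  have hinf : Tendsto (fun x : ℝ => (W x + I * z * V x) * exp (-(I * z * x))) atTop (𝓝 0) := by
    have h1 : Tendsto (fun x : ℝ => (B + ‖z‖ * A) * Real.exp (z.im * x)) atTop (𝓝 0) := by
      have := (Real.tendsto_exp_atBot.comp (tendsto_id.const_mul_atTop_of_neg hz0)).const_mul
        (B + ‖z‖ * A)
      simpa using this
    refine squeeze_zero_norm' ?_ h1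
    filter_upwards [eventually_gt_atTop 0] with x hx
    rw [norm_mul, norm_exp_neg_I_mul]
    refine mul_le_mul_of_nonneg_right ((norm_add_le _ _).trans (add_le_add (hB x hx) ?_))
      (Real.exp_nonneg _)
    rw [norm_mul, norm_mul, norm_I, one_mul]
    exact mul_le_mul_of_nonneg_left (hA x hx) (norm_nonneg _)
  have heq : ∀ x : ℝ, (W' x + I * z * W x) * exp (-(I * z * x)) +
      (W x + I * z * V x) * (exp (-(I * z * x)) * -(I * z)) =
        W' x * exp (-(I * z * x)) + z ^ 2 * (V x * exp (-(I * z * x))) := fun x => by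
    linear_combination (-(z ^ 2 * V x * exp (-(I * z * x)))) * I_sq
  have hmain := integral_Ioi_deriv_mul_eq_sub
    (fun x hx => (hW x hx).add ((hV x hx).const_mul (I * z))) (fun x _ => he x)
    ((i1.add i2).congr (Eventually.of_forall fun x => (heq x).symm)) h0 hinf
  simp only [Pi.add_apply, heq] at hmain
  rw [integral_add i1 i2, integral_const_mul] at hmain
  simp only [halfTransform]
  linear_combination hmain

/-- The edge condition enters here. On `(0, δ)` a bounded function contributes `C ∫ e^{-tx} dx =
O(1/t)`; beyond `δ` one has `e^{-tx} ≤ 1/(δt)`, and integrability suffices. -/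
lemma exists_norm_halfTransform_neg_I_mul_le {d : ℝ → ℂ} (hd : IntegrableOn d (Ioi 0))
    (hb : BoundedAtEdge d) : ∃ A, ∀ t : ℝ, 0 < t → ‖halfTransform d (-(I * t))‖ ≤ A * t⁻¹ := by
  obtain ⟨C, δ, hδ, hC⟩ := hb
  have hC0 : 0 ≤ C := (norm_nonneg _).trans (hC (δ / 2) ⟨by linarith, by linarith⟩)
  set N : ℝ := ∫ x in Ioi (0 : ℝ), ‖d x‖ with hN
  have hN0 : 0 ≤ N := integral_nonneg fun x => norm_nonneg _
  refine ⟨C + δ⁻¹ * N, fun t ht => ?_⟩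
  have hexp := integrableOn_exp_mul_Ioi (neg_lt_zero.2 ht) 0
  have hbd : ∀ x ∈ Ioi (0 : ℝ), ‖d x * exp (-(I * -(I * t) * x))‖ ≤
      C * Real.exp (-t * x) + (δ⁻¹ * t⁻¹) * ‖d x‖ := by
    intro x hx
    have hx0 : 0 < x := hx
    have him : (-(I * t)).im = -t := by simp
    rw [norm_mul, norm_exp_neg_I_mul, him]
    rcases lt_or_ge x δ with h | h
    · have := mul_le_mul_of_nonneg_right (hC x ⟨hx0, h⟩) (Real.exp_nonneg (-t * x))
      have h2 : 0 ≤ δ⁻¹ * t⁻¹ * ‖d x‖ := by positivity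
      linarith
    · have h1 : Real.exp (-t * x) ≤ δ⁻¹ * t⁻¹ := by
        rw [neg_mul, Real.exp_neg, ← mul_inv]
        refine inv_anti₀ (by positivity) ?_
        nlinarith [Real.add_one_le_exp (t * x)]
      have h2 := mul_le_mul_of_nonneg_left h1 (norm_nonneg (d x))
      have h3 : 0 ≤ C * Real.exp (-t * x) := by positivity
      linarith
  refine (norm_integral_le_of_norm_le ((hexp.const_mul C).add (hd.norm.const_mul (δ⁻¹ * t⁻¹)))
    ((ae_restrict_mem measurableSet_Ioi).mono hbd)).trans_eq ?_
  simp only [Pi.add_apply]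
  rw [integral_add (hexp.const_mul C) (hd.norm.const_mul _), integral_const_mul, integral_const_mul,
    integral_exp_mul_Ioi (neg_lt_zero.2 ht)]
  simp only [mul_zero, Real.exp_zero]
  rw [← hN]
  field_simp

/-- Fourier inversion at a point of continuity, after the rescaling `ξ = 2πw`. -/
lemma eq_zero_of_integral_mul_exp_eq_zero {V : ℝ → ℂ} (hV : Integrable V)
    (h : ∀ ξ : ℝ, ∫ x : ℝ, V x * exp (-(I * ξ * x)) = 0) {x : ℝ} (hx : ContinuousAt V x) :
    V x = 0 := by
  have h0 : FourierTransform.fourier V = 0 := by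
    ext w
    rw [Real.fourier_real_eq_integral_exp_smul, Pi.zero_apply, ← h (2 * Real.pi * w)]
    congr 1 with v
    rw [smul_eq_mul, mul_comm]
    congr 2
    push_cast
    ring
  rw [← hV.fourierInv_fourier_eq (by rw [h0]; exact integrable_zero _ _ _) hx, h0,
    Real.fourierInv_eq]
  simp

lemma integral_mul_exp_eq_add {V : ℝ → ℂ} (hV : Integrable V) (ξ : ℝ) :
    ∫ x : ℝ, V x * exp (-(I * ξ * x)) =
      halfTransform V ξ + halfTransform (fun x => V (-x)) (-ξ) := by
  have hi : Integrable (fun x : ℝ => V x * exp (-(I * ξ * x))) := by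
    refine Integrable.mul_bdd (c := 1) hV (by fun_prop) (Eventually.of_forall fun x => ?_)
    rw [norm_exp_neg_I_mul]; simp
  rw [← intervalIntegral.integral_Iic_add_Ioi hi.integrableOn hi.integrableOn (b := 0), add_comm,
    ← neg_zero, ← integral_comp_neg_Ioi, neg_zero]
  simp [halfTransform]

lemma IsIntegrableSolution.sub {k ς : ℂ} {f u v : ℝ → ℂ} (hu : IsIntegrableSolution k ς f u)
    (hv : IsIntegrableSolution k ς f v) :
    IsIntegrableSolution k ς (fun _ => 0) (fun x => u x - v x) := by
  have hp : ∀ x, 0 < x → potential k (fun x => u x - v x) x = potential k u x - potential k v x := by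
    intro x hx
    simp only [potential, mul_sub]
    exact integral_sub (hu.converges x hx) (hv.converges x hx)
  have hd : ∀ x, 0 < x → HasDerivAt (potential k fun x => u x - v x)
      (deriv (potential k u) x - deriv (potential k v) x) x := fun x hx =>
    ((hu.differentiable x hx).hasDerivAt.sub (hv.differentiable x hx).hasDerivAt).congr_of_eventuallyEq
      ((eventually_gt_nhds hx).mono hp)
  have hd2 : ∀ x, 0 < x → HasDerivAt (deriv (potential k fun x => u x - v x))
      (deriv (deriv (potential k u)) x - deriv (deriv (potential k v)) x) x := fun x hx =>
    ((hu.differentiable_deriv x hx).hasDerivAt.sub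
      (hv.differentiable_deriv x hx).hasDerivAt).congr_of_eventuallyEq
      ((eventually_gt_nhds hx).mono fun y hy => (hd y hy).deriv)
  refine ⟨hu.integrable.sub hv.integrable, fun x hx => ?_, fun x hx => (hd x hx).differentiableAt,
    fun x hx => (hd2 x hx).differentiableAt, fun x hx => ?_⟩
  · simp only [mul_sub]
    exact (hu.converges x hx).sub (hv.converges x hx)
  · rw [(hd2 x hx).deriv, hp x hx, hu.equation x hx, hv.equation x hx]
    ring

lemma BoundedAtEdge.sub {u v : ℝ → ℂ} (hu : BoundedAtEdge u) (hv : BoundedAtEdge v) :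
    BoundedAtEdge fun x => u x - v x := by
  obtain ⟨C, δ, hδ, hC⟩ := hu
  obtain ⟨D, δ', hδ', hD⟩ := hv
  refine ⟨C + D, min δ δ', lt_min hδ hδ', fun x hx => (norm_sub_le _ _).trans (add_le_add ?_ ?_)⟩
  · exact hC x ⟨hx.1, hx.2.trans_le (min_le_left _ _)⟩
  · exact hD x ⟨hx.1, hx.2.trans_le (min_le_right _ _)⟩

namespace IsSplitting

variable {Q : ℝ → ℂ} {F : ℂ → ℂ} {δ C : ℝ} {k ς : ℂ}

/-- A function with the one-sided transform of a solution of the homogeneous equation vanishes in the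
lower half-plane. -/
lemma halfTransform_eq_zero (h : IsSplitting Q F δ C) (hQ : ∀ ζ, exp (Q ζ) = symbolP k ς ζ)
    {d V : ℝ → ℂ} (id : IntegrableOn d (Ioi 0)) (hb : BoundedAtEdge d)
    (iV : IntegrableOn V (Ioi 0)) {a b₀ b₁ : ℂ}
    (hrel : ∀ ξ : ℝ, symbolP k ς ξ * halfTransform d ξ =
      a * (k ^ 2 - (ξ : ℂ) ^ 2) * halfTransform V (-ξ) + (b₁ + ξ * b₀)) :
    ∀ z : ℂ, z.im < 0 → halfTransform d z = 0 := by
  set N : ℝ := ∫ x in Ioi (0 : ℝ), ‖d x‖ with hN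
  set M : ℝ := ∫ x in Ioi (0 : ℝ), ‖V x‖ with hM
  have hM0 : 0 ≤ M := integral_nonneg fun x => norm_nonneg _
  have hδ := h.pos
  have hcF : ContinuousOn (fun z : ℂ => F (-z)) {z | z.im ≤ 0} :=
    h.continuousOn_closed.comp (by fun_prop) fun z (hz : z.im ≤ 0) => by simpa using hz
  have hdF : DifferentiableOn ℂ (fun z : ℂ => F (-z)) {z | z.im < 0} :=
    h.differentiableOn_comp_neg.mono fun z (hz : z.im < 0) => show z.im < δ by linarith
  have hneg : ContinuousOn (fun z : ℂ => halfTransform V (-z)) {z | 0 ≤ z.im} :=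
    (continuousOn_halfTransform iV).comp (by fun_prop) fun z (hz : 0 ≤ z.im) => by simpa using hz
  have hnegd : DifferentiableOn ℂ (fun z : ℂ => halfTransform V (-z)) {z | 0 < z.im} :=
    (differentiableOn_halfTransform iV).comp (by fun_prop) fun z (hz : 0 < z.im) => by simpa using hz
  -- Dividing the relation by `e^{F(ξ)}` separates it: the left side continues downward with growth
  -- `1/2`, the right side upward with growth `-1/2 + 2 = 3/2`.
  have hzero := eq_zero_of_eq_on_real
    (f := fun z => exp (F (-z)) * halfTransform d z)
    (g := fun z => exp (-F z) *
      (a * (k ^ 2 - z ^ 2) * halfTransform V (-z) + (b₁ + z * b₀)))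
    (A := C * N) (B := C * (‖a‖ * (‖k‖ ^ 2 + 1) * M + (‖b₁‖ + ‖b₀‖)))
    (hcF.cexp.mul (continuousOn_halfTransform id))
    (hdF.cexp.mul (differentiableOn_halfTransform id)) (fun z hz => ?_)
    (h.continuousOn_closed.neg.cexp.mul
      ((ContinuousOn.mul (by fun_prop) hneg).add (by fun_prop)))
    (h.differentiableOn_upper.neg.cexp.mul
      ((DifferentiableOn.mul (by fun_prop) hnegd).add (by fun_prop))) (fun z hz => ?_)
    (fun x => ?_) ?_
  · intro z hz
    exact (mul_eq_zero.1 (hzero z hz)).resolve_left (exp_ne_zero _)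
  · have h1 := h.norm_exp_le (-z) (by rw [neg_im]; linarith)
    rw [norm_neg] at h1
    rw [norm_mul]
    refine (mul_le_mul h1 (norm_halfTransform_le id hz) (norm_nonneg _)
      (mul_nonneg h.const_nonneg (by positivity))).trans_eq ?_
    ring
  · have h1 := h.norm_exp_neg_le z (by linarith)
    have h2 := norm_halfTransform_le iV (z := -z) (by simpa using hz)
    have h3 : ‖a * (k ^ 2 - z ^ 2) * halfTransform V (-z) + (b₁ + z * b₀)‖ ≤
        (‖a‖ * (‖k‖ ^ 2 + 1) * M + (‖b₁‖ + ‖b₀‖)) * (1 + ‖z‖) ^ 2 := by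
      have h4 : ‖k ^ 2 - z ^ 2‖ ≤ ‖k‖ ^ 2 + ‖z‖ ^ 2 := by
        rw [← norm_pow, ← norm_pow]
        exact norm_sub_le _ _
      have h5 : ‖a * (k ^ 2 - z ^ 2) * halfTransform V (-z)‖ ≤
          ‖a‖ * (‖k‖ ^ 2 + ‖z‖ ^ 2) * M := by
        rw [norm_mul, norm_mul]
        gcongr
      have h6 : ‖b₁ + z * b₀‖ ≤ ‖b₁‖ + ‖z‖ * ‖b₀‖ := by
        simpa only [norm_mul] using norm_add_le b₁ (z * b₀)
      have h7 : ‖k‖ ^ 2 + ‖z‖ ^ 2 ≤ (‖k‖ ^ 2 + 1) * (1 + ‖z‖) ^ 2 := by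
        nlinarith [norm_nonneg z, sq_nonneg ‖k‖, mul_nonneg (sq_nonneg ‖k‖) (norm_nonneg z),
          mul_nonneg (sq_nonneg ‖k‖) (sq_nonneg ‖z‖)]
      have h8 : ‖b₁‖ + ‖z‖ * ‖b₀‖ ≤ (‖b₁‖ + ‖b₀‖) * (1 + ‖z‖) ^ 2 := by
        nlinarith [norm_nonneg z, norm_nonneg b₀, norm_nonneg b₁, sq_nonneg ‖z‖,
          mul_nonneg (norm_nonneg b₁) (norm_nonneg z), mul_nonneg (norm_nonneg b₀) (norm_nonneg z),
          mul_nonneg (norm_nonneg b₁) (sq_nonneg ‖z‖), mul_nonneg (norm_nonneg b₀) (sq_nonneg ‖z‖)]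
      have h9 : ‖a‖ * (‖k‖ ^ 2 + ‖z‖ ^ 2) * M ≤ ‖a‖ * ((‖k‖ ^ 2 + 1) * (1 + ‖z‖) ^ 2) * M := by
        gcongr
      refine (norm_add_le _ _).trans ((add_le_add (h5.trans h9) (h6.trans h8)).trans_eq ?_)
      ring
    rw [norm_mul]
    refine (mul_le_mul h1 h3 (norm_nonneg _)
      (mul_nonneg h.const_nonneg (by positivity))).trans_eq ?_
    have : (3 / 2 : ℝ) = -(1 / 2) + (2 : ℕ) := by norm_num
    rw [this, Real.rpow_add (by positivity), Real.rpow_natCast]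
    ring
  · rw [← hrel, ← hQ, h.add_neg, exp_add, exp_neg]
    have := exp_ne_zero (F x)
    field_simp
  · obtain ⟨A, hA⟩ := exists_norm_halfTransform_neg_I_mul_le id hb
    have hA0 : 0 ≤ A := by simpa using (norm_nonneg _).trans (hA 1 one_pos)
    refine squeeze_zero_norm' ?_
      (tendsto_const_mul_one_add_rpow_neg (p := 1 / 2) (C * (2 * A)) (by norm_num))
    filter_upwards [eventually_ge_atTop 1] with t ht
    have ht0 : 0 < t := by linarith
    have hn : ‖-(-(I * (t : ℂ)))‖ = t := by
      rw [neg_neg, norm_mul, norm_I, one_mul, norm_real, Real.norm_of_nonneg ht0.le]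
    have h1 := h.norm_exp_le (-(-(I * (t : ℂ)))) (by simp; linarith)
    rw [hn] at h1
    have h2 : A * t⁻¹ ≤ 2 * A * (1 + t) ^ (-1 : ℝ) := by
      rw [Real.rpow_neg_one, mul_comm 2 A, mul_assoc]
      refine mul_le_mul_of_nonneg_left ?_ hA0
      rw [← div_eq_mul_inv, le_div_iff₀ (by linarith), inv_mul_le_iff₀ ht0]
      linarith
    rw [norm_mul]
    refine (mul_le_mul h1 ((hA t ht0).trans h2) (norm_nonneg _)
      (mul_nonneg h.const_nonneg (by positivity))).trans_eq ?_
    have : (-(1 / 2) : ℝ) = 1 / 2 + -1 := by norm_num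
    rw [this, Real.rpow_add (by positivity)]
    ring

/-- The homogeneous half-line equation has only the zero solution. -/
theorem eq_zero_of_isIntegrableSolution (h : IsSplitting Q F δ C)
    (hQ : ∀ ζ, exp (Q ζ) = symbolP k ς ζ) (hk : 0 < k.im) (hς : ς ≠ 0) {d : ℝ → ℂ}
    (hd : IsIntegrableSolution k ς (fun _ => 0) d) (hb : BoundedAtEdge d) {x : ℝ} (hx : 0 < x) :
    d x = 0 := by
  have hk0 : k ≠ 0 := fun h => by simp [h] at hk
  set a : ℂ := I * ς / k with ha
  have ha0 : a ≠ 0 := div_ne_zero (mul_ne_zero I_ne_zero hς) hk0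
  set V := potential k d with hV
  have iV : Integrable V := integrable_potential hk hd.integrable
  -- On `x > 0` this is `V''` solved from the equation, which shows that `V''` is integrable.
  set W' : ℝ → ℂ := fun x => a⁻¹ * d x - k ^ 2 * V x with hW'
  have iW : IntegrableOn W' (Ioi 0) :=
    (hd.integrable.const_mul _).sub (iV.integrableOn.const_mul _)
  have hdV : ∀ x, 0 < x → HasDerivAt V (deriv V x) x := fun x hx =>
    (hd.differentiable x hx).hasDerivAt
  have hdW : ∀ x, 0 < x → HasDerivAt (deriv V) (W' x) x := fun x hx => by
    refine (hd.differentiable_deriv x hx).hasDerivAt.congr_deriv ?_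
    simp only [hW']
    rw [hd.equation x hx, ← ha, zero_add, inv_mul_cancel_left₀ ha0]
    ring
  obtain ⟨V₀, V₁, hbd⟩ := exists_halfTransform_deriv_two hdV hdW iV.integrableOn iW
  have hW'' : ∀ ξ : ℝ, halfTransform W' ξ =
      a⁻¹ * halfTransform d ξ - k ^ 2 * halfTransform V ξ := fun ξ => by
    have i1 := integrableOn_mul_exp hd.integrable (z := ξ) (by simp)
    have i2 := integrableOn_mul_exp iV.integrableOn (z := ξ) (by simp)
    simp only [halfTransform]
    rw [← integral_const_mul, ← integral_const_mul,
      ← integral_sub (i1.const_mul _) (i2.const_mul _)]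
    congr 1 with y
    simp only [hW']
    ring
  -- The full transform of `V` is `𝒦̂ d̂`, and it is also the sum of the transforms over the two
  -- half-lines. Eliminating the one over `x > 0` leaves the unknown transform over `x < 0` and the
  -- edge values of `V` and `V'`.
  have hrel : ∀ ξ : ℝ, symbolP k ς ξ * halfTransform d ξ =
      -a * (k ^ 2 - (ξ : ℂ) ^ 2) * halfTransform (fun x => V (-x)) (-ξ) +
        (-a * V₁ + ξ * (-a * I * V₀)) := fun ξ => by
    have h1 := hbd ξ (by simp)
    rw [hW''] at h1
    have h2 := integral_potential_mul_exp hk hd.integrable ξ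
    rw [← hV, integral_mul_exp_eq_add iV] at h2
    have h3 : I * (ς / k) = a := by rw [ha]; ring
    rw [symbolP, h3]
    have h4 : a * a⁻¹ = 1 := mul_inv_cancel₀ ha0
    linear_combination a * h1 + a * (k ^ 2 - (ξ : ℂ) ^ 2) * h2 - halfTransform d ξ * h4
  have hz := h.halfTransform_eq_zero hQ hd.integrable hb iV.comp_neg.integrableOn hrel
  have hcl : ({z | z.im ≤ 0} : Set ℂ) ⊆ closure {z | z.im < 0} := by
    rw [closure_setOfPred_im_lt]
  have hz' : Set.EqOn (halfTransform d) (fun _ => 0) {z | z.im ≤ 0} :=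
    Set.EqOn.of_subset_closure hz (continuousOn_halfTransform hd.integrable) continuousOn_const
      (fun z (hz : z.im < 0) => hz.le) hcl
  -- Applying injectivity of the Fourier transform to `V`, which is continuous for `x > 0`, gives
  -- vanishing at every point there; for `d` itself it would give only almost everywhere.
  have hV0 : ∀ x, 0 < x → V x = 0 := fun x hx =>
    eq_zero_of_integral_mul_exp_eq_zero iV (fun ξ => by
      rw [hV, integral_potential_mul_exp hk hd.integrable, hz' (by simp), mul_zero])
      (hdV x hx).continuousAt
  have hW0 : ∀ x, 0 < x → deriv V x = 0 := fun x hx => by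
    have : V =ᶠ[𝓝 x] fun _ => 0 := (eventually_gt_nhds hx).mono hV0
    rw [this.deriv_eq, deriv_const]
  have hW1 : deriv (deriv V) x = 0 := by
    have : deriv V =ᶠ[𝓝 x] fun _ => 0 := (eventually_gt_nhds hx).mono hW0
    rw [this.deriv_eq, deriv_const]
  rw [hd.equation x hx, hW1, ← hV, hV0 x hx]
  simp

end IsSplitting

end HalfPlane

/-! ### Assembly of the main theorem. -/

open HalfPlane
theorem mainTheorem1
    (k ς : ℂ) (hk_re : 0 < k.re) (hk_im : 0 < k.im) (hς : ς ≠ 0)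
    (θ : ℝ) (hθ : θ ∈ Ioo 0 (Real.pi / 2))
    (κ : ℂ) (hκ : κ = k * (Real.sin θ : ℂ))
    (hP : ∀ ξ : ℝ, symbolP k ς ξ ≠ 0)
    (hind : HasIndex (symbolP k ς) 0)
    (Q : ℝ → ℂ) (hQ : IsLogBranch Q (symbolP k ς)) :
    -- the Fourier transform of the kernel
    (Integrable (kernel k) ∧
      ∀ (ξ : ℝ) (s : ℂ), s ^ 2 = k ^ 2 - (ξ : ℂ) ^ 2 → 0 < s.im →
        kernelHat k ξ = Complex.I / (2 * s)) ∧
    -- the split functions: absolute convergence, analyticity, splitting on the real line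
    (∀ ξ : ℂ, ξ.im ≠ 0 → IntegrableOn (fun ζ : ℝ => Q ζ / ((ζ : ℂ) ^ 2 - ξ ^ 2)) (Ioi 0)) ∧
    DifferentiableOn ℂ (splitPlus Q) upperHalf ∧
    DifferentiableOn ℂ (splitMinus Q) lowerHalf ∧
    (∀ ξ : ℝ, Tendsto (splitPlus Q) (𝓝[upperHalf] (ξ : ℂ)) (𝓝 (splitPlusReal Q ξ)) ∧
      Tendsto (splitMinus Q) (𝓝[lowerHalf] (ξ : ℂ)) (𝓝 (splitMinusReal Q ξ)) ∧
      Q ξ = splitPlusReal Q ξ + splitMinusReal Q ξ) ∧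
    -- asymptotics, where `ln (ς ξ / (2k)) = c + Log (ξ / i)`
    (∃ c : ℂ, Complex.exp c = Complex.I * ς / (2 * k) ∧
      (fun ζ : ℝ => Q ζ - (c + (Real.log ζ : ℂ))) =O[atTop] (fun ζ : ℝ => 1 / ζ) ∧
      Tendsto (fun ξ : ℂ => splitPlus Q ξ - 1 / 2 * (c + Complex.log (ξ / Complex.I)))
        (Bornology.cobounded ℂ ⊓ 𝓟 upperHalf) (𝓝 0)) ∧
    -- the Fourier integral converges absolutely and is an integrable solution
    (∀ x : ℝ, 0 < x → Integrable (fourierIntegrand k ς κ Q x)) ∧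
    ContinuousOn (fourierSolution k ς κ Q) (Ioi 0) ∧
    IsIntegrableSolution k ς (fun x : ℝ => Complex.exp (Complex.I * κ * x))
      (fourierSolution k ς κ Q) ∧
    BoundedAtEdge (fourierSolution k ς κ Q) ∧
    -- it is the only one, and the entire function of the Wiener-Hopf splitting vanishes
    (∀ u : ℝ → ℂ,
      IsIntegrableSolution k ς (fun x : ℝ => Complex.exp (Complex.I * κ * x)) u →
      BoundedAtEdge u →
        (∀ ξ : ℂ, ξ.im < 0 →
          Complex.exp (splitMinus Q ξ) *
              (∫ x in Ioi (0 : ℝ), u x * Complex.exp (-(Complex.I * ξ * x))) -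
            Complex.exp (-splitPlus Q κ) * (-Complex.I / (ξ - κ)) = 0) ∧
        ∀ x : ℝ, 0 < x → u x = fourierSolution k ς κ Q x) := by
  obtain ⟨F, δ, C, c, h, hc, hasymp, hlim⟩ := exists_isSplitting hk_re hk_im hς hP hQ
  have hsin0 : 0 < Real.sin θ := Real.sin_pos_of_pos_of_lt_pi hθ.1 (by linarith [hθ.2, Real.pi_pos])
  have hsin1 : Real.sin θ ≠ 1 := fun h1 => by
    have h2 := Real.sin_lt_sin_of_lt_of_le_pi_div_two (by linarith [hθ.1, Real.pi_pos]) le_rfl hθ.2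
    rw [h1, Real.sin_pi_div_two] at h2
    exact lt_irrefl _ h2
  have hκim : 0 < κ.im := by
    rw [hκ, Complex.im_mul_ofReal]
    exact mul_pos hk_im hsin0
  -- Oblique incidence, `sin θ < 1`, keeps the poles at `κ` and `k` apart.
  have hκk : κ ≠ k := fun h1 => by
    have hk0 : k ≠ 0 := fun h => by simp [h] at hk_im
    rw [hκ, mul_eq_left₀ hk0] at h1
    exact hsin1 (by exact_mod_cast h1)
  obtain ⟨hint, hcont, hedge, hsol, htrans⟩ :=
    h.isIntegrableSolution hQ.2 hk_im hς hκim hκk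
  refine ⟨⟨integrable_kernel hk_im, fun ξ s => kernelHat_eq hk_re hk_im⟩,
    fun ξ => h.integrableOn_div_sq_sub_sq, h.differentiableOn_splitPlus,
    h.differentiableOn_splitMinus, fun ξ => ?_, ⟨c, hc, hasymp, ?_⟩, fun x _ => hint x,
    hcont.continuousOn, hsol, hedge, fun u hu hub => ?_⟩
  · rw [h.splitPlusReal_eq, h.splitMinusReal_eq]
    exact ⟨h.tendsto_splitPlus ξ, h.tendsto_splitMinus ξ, h.add_neg ξ⟩
  · refine hlim.congr' ?_
    filter_upwards [mem_inf_of_right (mem_principal_self upperHalf)] with ξ hξ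
    rw [h.splitPlus_eq hξ]
  · have hueq : ∀ x : ℝ, 0 < x → u x = fourierSolution k ς κ Q x := fun x hx =>
      sub_eq_zero.1
        (h.eq_zero_of_isIntegrableSolution hQ.2 hk_im hς (hu.sub hsol) (hub.sub hedge) hx)
    refine ⟨fun ξ hξ => ?_, hueq⟩
    have hcongr : EqOn (fun x : ℝ => u x * Complex.exp (-(Complex.I * ξ * x)))
        (fun x => fourierSolution k ς κ Q x * Complex.exp (-(Complex.I * ξ * x))) (Ioi 0) :=
      fun x hx => congrArg (· * Complex.exp (-(Complex.I * ξ * x))) (hueq x hx)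
    rw [setIntegral_congr_fun measurableSet_Ioi hcongr,
      htrans ξ hξ, h.splitMinus_eq hξ, h.splitPlus_eq hκim, density, Complex.exp_neg (F (-ξ))]
    have := Complex.exp_ne_zero (F (-ξ))
    field_simp
    ring
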